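/- Let $A\in\mathbb R^{n\times n}$ and $b,c\in\mathbb R^n$, and let $H(z)=c^T(zI-A)^{-1}b$ be the transfer function of the linear system $\dot x=Ax+bu$, $y=c^Tx$. Assume that the system is state-space-symmetric ($A=A^T$, $c=b$), minimal (no real system of smaller order has the same transfer function) and asymptotically stable (all eigenvalues of $A$ have negative real part). Let $r<n$. For points $s=(s_1,\dots,s_r)\in\mathbb C^r$ let $V_r$ be the matrix with columns $(s_iI-A)^{-1}b$ and let $W_r^T$ be the matrix with rows $c^T(s_iI-A)^{-1}$. The points are admissible if no $s_i$ is an eigenvalue of $A$ and $W_r^TV_r$ is invertible; then put $A_r(s)=(W_r^TV_r)^{-1}W_r^TAV_r$, $b_r=(W_r^TV_r)^{-1}W_r^Tb$, $c_r=V_r^Tc$, $H_{r,s}(z)=c_r^T(zI-A_r(s))^{-1}b_r$. A step of IRKA replaces admissible points $s$ by the negatives $-\lambda_i(A_r(s))$ of the eigenvalues of $A_r(s)$, listed in any order. IRKA is started at $r$ distinct points that are closed under complex conjugation. A fixed point is an admissible family $s$ of distinct points, closed under conjugation, such that the numbers $-\lambda_i(A_r(s))$ are again $s_1,\dots,s_r$.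 Let $\|F\|_{\mathcal H_2}=\left(\frac1{2\pi}\int_{-\infty}^{\infty}|F(\imath\omega)|^2\,d\omega\right)^{1/2}$. Let $s$ be a fixed point, let $H_r:=H_{r,s}=\sum_j\phi_j/(z+s_j)$ be the partial fraction decomposition of its reduced model, and suppose that $(\phi,-s)$ is a local minimizer of the error $(\psi,\lambda)\mapsto\mathcal J(\psi,\lambda)=\big\|H-\sum_j\psi_j/(\cdot-\lambda_j)\big\|_{\mathcal H_2}^2$ over the residues $\psi$ and poles $\lambda$ of real systems of order $r$ (that is, those for which the pairs $(\psi_j,\lambda_j)$ are closed under conjugation). 1. $s$ is locally attractive: there is $\delta>0$ such that from every initial selection of $r$ distinct points, closed under conjugation and within $\delta$ of $s$ (up to ordering), all IRKA steps are well defined, the iterates $s^{(k)}$ converge to $s$ up to ordering, and the reduced models converge to the locally optimal one: $\|H_{r,s^{(k)}}-H_r\|_{\mathcal H_2}\to0$. 2. Near $s$, with a suitable ordering of the eigenvalues, the map $t\mapsto-\lambda(A_r(t))$ maps $s$ to itself and is differentiable at $s$. Write $\tilde\lambda_i=-s_i$, $$[S_{11}]_{ij}=-(\tilde\lambda_i+\tilde\lambda_j)^{-1},\quad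 [S_{12}]_{ij}=-(\tilde\lambda_i+\tilde\lambda_j)^{-2},\quad [S_{22}]_{ij}=-2(\tilde\lambda_i+\tilde\lambda_j)^{-3},$$ $S_c=S_{22}-S_{12}S_{11}^{-1}S_{12}$, $R=\mathrm{diag}(\phi_j)$, $E=\mathrm{diag}\big(H''(s_j)-H_r''(s_j)\big)$ and $K=ER^{-1}$. Then $S_{11}$, $S_c$ and $R$ are invertible and the Jacobian of the map at $s$ is $R^{-1}(S_c^{-1}K)R$. All its eigenvalues are real and lie in $(0,1]$, and they lie in $(0,1)$ if the local minimizer is nondegenerate, i.e. if $\mathcal J$ grows at least quadratically around $(\phi,-s)$ within the parameters of real systems (equivalently, its Hessian is positive definite there). -/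

import Mathlib

open Filter Topology

/-- A single-input single-output linear system `x' = A x + b u`, `y = cᵀ x` of order `n`. -/
structure LTISystem (K : Type) (n : ℕ) where
  A : Matrix (Fin n) (Fin n) K
  b : Fin n → K
  c : Fin n → K

namespace LTISystem

/-- A real system, regarded as a system over `ℂ`. -/
def complexify {n : ℕ} (G : LTISystem ℝ n) : LTISystem ℂ n where
  A := G.A.map (fun x : ℝ => (x : ℂ))
  b := fun i => (G.b i : ℂ)
  c := fun i => (G.c i : ℂ)

/-- The matrix `z I - A`. -/
def pencil {n : ℕ} (G : LTISystem ℂ n) (z : ℂ) : Matrix (Fin n) (Fin n) ℂ :=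
  z • (1 : Matrix (Fin n) (Fin n) ℂ) - G.A

/-- The transfer function `z ↦ cᵀ (z I - A)⁻¹ b`. -/
noncomputable def transfer {n : ℕ} (G : LTISystem ℂ n) (z : ℂ) : ℂ :=
  dotProduct G.c (Matrix.mulVec (G.pencil z)⁻¹ G.b)

/-- Asymptotic stability: every eigenvalue of `A` has negative real part. -/
def IsStable {n : ℕ} (G : LTISystem ℝ n) : Prop :=
  ∀ z : ℂ, (G.complexify.pencil z).det = 0 → z.re < 0

/-- State-space symmetry: `A = Aᵀ` and `c = b`. -/
def IsSSS {n : ℕ} (G : LTISystem ℝ n) : Prop :=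
  G.A.transpose = G.A ∧ G.c = G.b

/-- Minimality: no realization of the same transfer function has a smaller state dimension. -/
def IsMinimal {n : ℕ} (G : LTISystem ℝ n) : Prop :=
  ∀ (m : ℕ) (G' : LTISystem ℝ m),
    (∀ z : ℂ, (G.complexify.pencil z).det ≠ 0 → (G'.complexify.pencil z).det ≠ 0 →
      G'.complexify.transfer z = G.complexify.transfer z) → n ≤ m

/-- The matrix `V_r` with columns `(s_i I - A)⁻¹ b`. -/
noncomputable def krylovV {n r : ℕ} (G : LTISystem ℝ n) (s : Fin r → ℂ) :
    Matrix (Fin n) (Fin r) ℂ :=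
  Matrix.of fun k i => Matrix.mulVec (G.complexify.pencil (s i))⁻¹ G.complexify.b k

/-- The matrix `W_r`; the rows of `W_rᵀ` are `cᵀ (s_i I - A)⁻¹`. -/
noncomputable def krylovW {n r : ℕ} (G : LTISystem ℝ n) (s : Fin r → ℂ) :
    Matrix (Fin n) (Fin r) ℂ :=
  Matrix.of fun k i => Matrix.vecMul G.complexify.c (G.complexify.pencil (s i))⁻¹ k

/-- The reduced model obtained by projection at the interpolation points `s`:
`A_r = (WᵀV)⁻¹ Wᵀ A V`, `b_r = (WᵀV)⁻¹ Wᵀ b`, `c_r = Vᵀ c`. -/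
noncomputable def reduced {n r : ℕ} (G : LTISystem ℝ n) (s : Fin r → ℂ) : LTISystem ℂ r where
  A := ((G.krylovW s).transpose * G.krylovV s)⁻¹ * (G.krylovW s).transpose *
    G.complexify.A * G.krylovV s
  b := Matrix.mulVec (((G.krylovW s).transpose * G.krylovV s)⁻¹ * (G.krylovW s).transpose)
    G.complexify.b
  c := Matrix.mulVec (G.krylovV s).transpose G.complexify.c

/-- The reduced model at `s` is well defined: no `s_i` is a pole of the full model, and
`W_rᵀ V_r` is invertible (in particular, the `s_i` are distinct). -/
def IsAdmissible {n r : ℕ} (G : LTISystem ℝ n) (s : Fin r → ℂ) : Prop :=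
  (∀ i, (G.complexify.pencil (s i)).det ≠ 0) ∧
    ((G.krylovW s).transpose * G.krylovV s).det ≠ 0

/-- One step of IRKA: `t` lists, in some order and with multiplicities, the numbers
`-λ_i(A_r(s))`. -/
def IRKAStep {n r : ℕ} (G : LTISystem ℝ n) (s t : Fin r → ℂ) : Prop :=
  G.IsAdmissible s ∧
    (G.reduced s).A.charpoly = ∏ i, (Polynomial.X - Polynomial.C (-(t i)))

end LTISystem

/-- A family of interpolation points that is closed under complex conjugation. -/
def IsConjClosed {r : ℕ} (s : Fin r → ℂ) : Prop :=
  ∃ π : Equiv.Perm (Fin r), ∀ i, (starRingEnd ℂ) (s i) = s (π i)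

/-- Distance of two families of points up to their ordering. -/
noncomputable def unorderedDist {r : ℕ} (s t : Fin r → ℂ) : ℝ :=
  ⨅ π : Equiv.Perm (Fin r), ‖(fun i => s (π i)) - t‖

/-- The `H₂` norm `((1 / 2π) ∫ |F(iω)|² dω)^(1/2)`. -/
noncomputable def h2Norm (F : ℂ → ℂ) : ℝ :=
  Real.sqrt ((2 * Real.pi)⁻¹ * ∫ ω : ℝ, ‖F (Complex.I * (ω : ℂ))‖ ^ 2)

/-- The rational function `∑ φ_j / (z - λ_j)`, with the residues `p.1 = φ` and the poles
`p.2 = λ`. -/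
noncomputable def poleResidue {r : ℕ} (p : (Fin r → ℂ) × (Fin r → ℂ)) (z : ℂ) : ℂ :=
  ∑ j, p.1 j / (z - p.2 j)

/-- The pole-residue parameters of real systems: the pairs (residue, pole) are closed under
complex conjugation. -/
def realParams (r : ℕ) : Set ((Fin r → ℂ) × (Fin r → ℂ)) :=
  {p | ∃ π : Equiv.Perm (Fin r), ∀ i,
    (starRingEnd ℂ) (p.1 i) = p.1 (π i) ∧ (starRingEnd ℂ) (p.2 i) = p.2 (π i)}

namespace LTISystem

/-- The squared `H₂` error of the reduced model with pole-residue parameters `p`. -/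
noncomputable def h2Cost {n r : ℕ} (G : LTISystem ℝ n) (p : (Fin r → ℂ) × (Fin r → ℂ)) : ℝ :=
  h2Norm (fun z => G.complexify.transfer z - poleResidue p z) ^ 2

/-- `p` is a local minimizer of the `H₂` error among the real systems of order `r`. -/
def IsLocalH2Minimizer {n r : ℕ} (G : LTISystem ℝ n) (p : (Fin r → ℂ) × (Fin r → ℂ)) : Prop :=
  p ∈ realParams r ∧ IsLocalMinOn G.h2Cost (realParams r) p

/-- `p` is a nondegenerate local minimizer: the squared `H₂` error grows at least quadratically
around `p`. Since the squared error is a smooth function of the parameters, this says that `p` is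
a local minimizer at which the Hessian is positive definite. -/
def IsNondegenerateH2Minimizer {n r : ℕ} (G : LTISystem ℝ n)
    (p : (Fin r → ℂ) × (Fin r → ℂ)) : Prop :=
  p ∈ realParams r ∧ ∃ κ : ℝ, 0 < κ ∧
    ∀ᶠ q in 𝓝[realParams r] p, G.h2Cost p + κ * ‖q - p‖ ^ 2 ≤ G.h2Cost q

/-- `φ` are the residues of the reduced model at `s` when its poles are the points `-s_j`. -/
def HasResidues {n r : ℕ} (G : LTISystem ℝ n) (s φ : Fin r → ℂ) : Prop :=
  ∀ z : ℂ, ((G.reduced s).pencil z).det ≠ 0 → (G.reduced s).transfer z = poleResidue (φ, -s) z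

/-- A fixed point of IRKA: distinct points, closed under conjugation, that one step reproduces. -/
def IsIRKAFixedPoint {n r : ℕ} (G : LTISystem ℝ n) (s : Fin r → ℂ) : Prop :=
  Function.Injective s ∧ IsConjClosed s ∧ G.IRKAStep s s

/-- An infinite run of IRKA started at `s₀`; every step is well defined. -/
def IsIRKARun {n r : ℕ} (G : LTISystem ℝ n) (s₀ : Fin r → ℂ) (σ : ℕ → Fin r → ℂ) : Prop :=
  σ 0 = s₀ ∧ ∀ k, G.IRKAStep (σ k) (σ (k + 1))

/-- Local attractivity of `s`: from every permitted initial selection of interpolation points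
(distinct, closed under conjugation) close enough to `s`, IRKA never breaks down, its points
converge to `s` (up to ordering), and its reduced models converge in the `H₂` norm to the reduced
model at `s`. -/
def IsLocallyAttractive {n r : ℕ} (G : LTISystem ℝ n) (s : Fin r → ℂ) : Prop :=
  ∃ δ : ℝ, 0 < δ ∧ ∀ s₀ : Fin r → ℂ, Function.Injective s₀ → IsConjClosed s₀ →
    unorderedDist s₀ s < δ →
      (∀ (N : ℕ) (σ : ℕ → Fin r → ℂ), σ 0 = s₀ →
        (∀ k, k < N → G.IRKAStep (σ k) (σ (k + 1))) → G.IsAdmissible (σ N)) ∧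
      (∃ σ : ℕ → Fin r → ℂ, G.IsIRKARun s₀ σ) ∧
      ∀ σ : ℕ → Fin r → ℂ, G.IsIRKARun s₀ σ →
        Tendsto (fun k => unorderedDist (σ k) s) atTop (𝓝 0) ∧
        Tendsto (fun k => h2Norm (fun z =>
          (G.reduced (σ k)).transfer z - (G.reduced s).transfer z)) atTop (𝓝 0)

end LTISystem

/-- `[S₁₁]_{ij} = -(λ_i + λ_j)⁻¹`. -/
noncomputable def matS11 {r : ℕ} (l : Fin r → ℂ) : Matrix (Fin r) (Fin r) ℂ :=
  Matrix.of fun i j => -(l i + l j)⁻¹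

/-- `[S₁₂]_{ij} = -(λ_i + λ_j)⁻²`. -/
noncomputable def matS12 {r : ℕ} (l : Fin r → ℂ) : Matrix (Fin r) (Fin r) ℂ :=
  Matrix.of fun i j => -((l i + l j) ^ 2)⁻¹

/-- `[S₂₂]_{ij} = -2 (λ_i + λ_j)⁻³`. -/
noncomputable def matS22 {r : ℕ} (l : Fin r → ℂ) : Matrix (Fin r) (Fin r) ℂ :=
  Matrix.of fun i j => -2 * ((l i + l j) ^ 3)⁻¹

/-- The Schur complement `S_c = S₂₂ - S₁₂ S₁₁⁻¹ S₁₂`. -/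
noncomputable def matSc {r : ℕ} (l : Fin r → ℂ) : Matrix (Fin r) (Fin r) ℂ :=
  matS22 l - matS12 l * (matS11 l)⁻¹ * matS12 l

namespace LTISystem

/-- `E = diag (H''(s_i) - H_r''(s_i))`, where `H_r` is the reduced model at `s`. -/
noncomputable def matE {n r : ℕ} (G : LTISystem ℝ n) (s : Fin r → ℂ) :
    Matrix (Fin r) (Fin r) ℂ :=
  Matrix.diagonal fun i =>
    iteratedDeriv 2 (fun z => G.complexify.transfer z - (G.reduced s).transfer z) (s i)

/-- `K = E R⁻¹` with `R = diag φ`. -/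
noncomputable def matK {n r : ℕ} (G : LTISystem ℝ n) (s φ : Fin r → ℂ) :
    Matrix (Fin r) (Fin r) ℂ :=
  G.matE s * (Matrix.diagonal φ)⁻¹

end LTISystem

/-! Diagonalising `A` turns the full model into H(z) = ∑ m_i / (z + a_i); stability and minimality
make the a_i positive and distinct and the masses m_i = b_i² positive. The Krylov space at points t
consists of the vectors b_i q(a_i) / ∏_j (a_i + t_j) with deg q < r, so projecting is a Galerkin
method in a polynomial space. Its poles are -y_k exactly when p = ∏_j (X - y_j) is orthogonal to all
polynomials of lower degree for the weights m_i / ∏_j (a_i + t_j)². For distinct y_k this is the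
system `residual` = 0, the pairing of p with each p / (X - y_k). An IRKA step is thus an implicit
function y = F(t).

At a zero, the derivative of `residual` in y is diagonal with entries -`gramDiag`, and the
derivative in t is a Cauchy matrix with positive weights (`exists_hasStrictFDerivAt_residual`).
Hence the Jacobian `jac` has positive entries and is similar to a symmetric matrix that is congruent
to a positive definite Cauchy matrix: its eigenvalues are real and positive. Explicit inverses of
Cauchy matrices, obtained from the Blaschke product B(z) = ∏ (z - x_j) / (z + x_j), identify `jac`
with R⁻¹ S_c⁻¹ K R (`SpectralForm.jac_eq`).

The link with optimality is the reduced error `redCost`, in which the residues are the interpolating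
ones. Its derivative is -2 times a Cauchy form in the direction and the residual
(`hasDerivAt_errCost`). In an eigendirection w of the Jacobian with eigenvalue ρ the residual is (ρ
- 1) `gramDiag` w to first order, so the second derivative of the error is 2(1 - ρ) times a positive
number (`eigenvalue_bound`). A local minimum gives ρ ≤ 1, quadratic growth gives ρ < 1.

Attractivity must also cover ρ = 1, where linearisation decides nothing. There, positivity of the
Jacobian provides a Perron eigenvector w > 0 and makes F monotone near x. A Lyapunov–Schmidt
reduction yields an analytic curve γ through x with tangent w, containing all nearby fixed points,
along which the residual is η(τ) times a fixed positive vector (`exists_isCurve`). If η vanished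
identically, there would be an arc of degenerate fixed points; the set of all of these is compact,
and an accumulation point of it with maximal coordinate sum lies on such an arc too, which rises
beyond it, a contradiction (`IsCurve.eventually_eta_ne`). So zeros of η are isolated, and local
minimality of the error forces η < 0 for small τ > 0 and η > 0 for small τ < 0
(`IsCurve.eventually_eta_sign`). Since F moves points of γ in the direction η w, the points u =
γ(-τ) and v = γ(τ) satisfy u ≤ F(u) and F(v) ≤ v. Monotone iteration on the order interval [u, v],
which contains no other fixed point, converges to x (`exists_attracting_nhds`).

Finally, a fixed point is real, its coordinates being Rayleigh quotients, and conjugation-closed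
points near distinct real points are themselves real. Thus only the real dynamics matters for
attractivity. -/

namespace IRKA

open Finset

/-! ### Orthogonality defects of the pole polynomial -/

section Algebra

variable {K : Type*} [Field K] {n r : ℕ}

/-- The rational function `z ↦ ∏_{j ∈ S} (z - y_j) / ∏_j (z + t_j)`. -/
def ratio (t y : Fin r → K) (S : Finset (Fin r)) (z : K) : K :=
  (∏ j ∈ S, (z - y j)) / ∏ j, (z + t j)

/-- The orthogonality defects of `∏_j (X - y_j)` for the weights `m_i / ∏_j (a_i + t_j)²`. -/
def residual (a m : Fin n → K) (t y : Fin r → K) (k : Fin r) : K :=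
  ∑ i, m i * ((a i - y k) * ratio t y (univ.erase k) (a i) ^ 2)

/-- The squared norms of the polynomials `∏_{j ≠ k} (X - y_j)`. -/
def gramDiag (a m : Fin n → K) (t y : Fin r → K) (k : Fin r) : K :=
  ∑ i, m i * ratio t y (univ.erase k) (a i) ^ 2

/-- The inner products of the polynomials `∏_{j ≠ k} (X - y_j)` and `∏_{j ≠ l} (X - y_j)`. -/
def gramOff (a m : Fin n → K) (t y : Fin r → K) (k l : Fin r) : K :=
  ∑ i, m i * (ratio t y (univ.erase k) (a i) * ratio t y (univ.erase l) (a i))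

/-- The weights that govern the second-order interpolation error. -/
def errWeight (a m : Fin n → K) (t y : Fin r → K) (l : Fin r) : K :=
  ∑ i, m i * (ratio t y univ (a i) ^ 2 / (a i + t l))

lemma ratio_univ (t y : Fin r → K) (k : Fin r) (z : K) :
    ratio t y univ z = (z - y k) * ratio t y (univ.erase k) z := by
  unfold ratio
  rw [← mul_prod_erase univ _ (mem_univ k)]
  ring

lemma ratio_comp_perm (t y : Fin r → K) (π : Equiv.Perm (Fin r)) (S : Finset (Fin r)) (z : K) :
    ratio (fun i => t (π i)) y S z = ratio t y S z := by
  unfold ratio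
  rw [Equiv.prod_comp π (fun j => z + t j)]

lemma residual_comp_perm (a m : Fin n → K) (t y : Fin r → K) (π : Equiv.Perm (Fin r)) :
    residual a m (fun i => t (π i)) y = residual a m t y := by
  funext k
  simp [residual, ratio_comp_perm]

lemma gramDiag_comp_perm (a m : Fin n → K) (t y : Fin r → K) (π : Equiv.Perm (Fin r)) :
    gramDiag a m (fun i => t (π i)) y = gramDiag a m t y := by
  funext k
  simp [gramDiag, ratio_comp_perm]

/-- With p = ∏_j (X - y_j) and p_k = p / (X - y_k), one has p (p_k - p_l) = (y_k - y_l) p_k p_l;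
summing against the weights gives the identity. -/
lemma mul_gramOff (a m : Fin n → K) (t y : Fin r → K) {k l : Fin r} (hkl : k ≠ l) :
    (y k - y l) * gramOff a m t y k l = residual a m t y k - residual a m t y l := by
  unfold gramOff residual
  rw [mul_sum, ← sum_sub_distrib]
  refine sum_congr rfl fun i _ => ?_
  have hk : ratio t y (univ.erase k) (a i) =
      (a i - y l) * ((∏ j ∈ (univ.erase k).erase l, (a i - y j)) / ∏ j, (a i + t j)) := by
    unfold ratio
    rw [← mul_prod_erase (univ.erase k) _ (mem_erase.2 ⟨hkl.symm, mem_univ l⟩)]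
    ring
  have hl : ratio t y (univ.erase l) (a i) =
      (a i - y k) * ((∏ j ∈ (univ.erase k).erase l, (a i - y j)) / ∏ j, (a i + t j)) := by
    unfold ratio
    rw [← mul_prod_erase (univ.erase l) _ (mem_erase.2 ⟨hkl, mem_univ k⟩), erase_right_comm]
    ring
  rw [hk, hl]
  ring

/-- The r scalar defects therefore encode full orthogonality: when they vanish, the p_k form an
orthogonal basis of the polynomials of degree < r. -/
lemma gramOff_eq_zero {a m : Fin n → K} {t y : Fin r → K} (hy : Function.Injective y)
    (h : residual a m t y = 0) {k l : Fin r} (hkl : k ≠ l) : gramOff a m t y k l = 0 := by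
  have := mul_gramOff a m t y hkl
  rw [h] at this
  simpa [sub_eq_zero, hy.ne hkl] using this

lemma gramOff_self (a m : Fin n → K) (t y : Fin r → K) (k : Fin r) :
    gramOff a m t y k k = gramDiag a m t y k := by
  simp [gramOff, gramDiag, sq]

/-- Partial fraction decomposition of a polynomial of degree `< r` over `∏_j (X + t_j)`. -/
lemma partial_fractions {t : Fin r → K} (ht : Function.Injective t) (f : Polynomial K)
    (hf : f.degree < r) {u : K} (hu : ∀ j, u + t j ≠ 0) :
    f.eval u / ∏ j, (u + t j) =
      ∑ l, f.eval (-(t l)) / (∏ j ∈ univ.erase l, (t j - t l)) / (u + t l) := by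
  have hinj : Set.InjOn (fun j => -(t j)) (univ : Finset (Fin r)) :=
    fun i _ j _ h => ht (neg_injective h)
  have h := Lagrange.eq_interpolate (s := univ) (v := fun j => -(t j)) hinj (f := f)
    (by simpa using hf)
  have h2 := congrArg (Polynomial.eval u) h
  rw [Lagrange.interpolate_apply, Polynomial.eval_finsetSum] at h2
  rw [h2, sum_div]
  refine sum_congr rfl fun l _ => ?_
  have hb : (Lagrange.basis univ (fun j => -(t j)) l).eval u =
      (∏ j ∈ univ.erase l, (u + t j)) / ∏ j ∈ univ.erase l, (t j - t l) := by
    rw [Lagrange.basis, Polynomial.eval_prod, ← prod_div_distrib]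
    refine prod_congr rfl fun j _ => ?_
    simp only [Lagrange.basisDivisor, Polynomial.eval_mul, Polynomial.eval_C, Polynomial.eval_sub,
      Polynomial.eval_X]
    rw [show -(t l) - -(t j) = t j - t l by ring]
    ring
  rw [Polynomial.eval_mul, Polynomial.eval_C, hb, ← mul_prod_erase univ _ (mem_univ l)]
  have h1 : ∏ j ∈ univ.erase l, (u + t j) ≠ 0 := prod_ne_zero_iff.2 fun j _ => hu j
  have h3 := hu l
  have h4 : ∏ j ∈ univ.erase l, (t j - t l) ≠ 0 := prod_ne_zero_iff.2 fun j hj =>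
    sub_ne_zero.2 (ht.ne (mem_erase.1 hj).1)
  field_simp

/-! ### Blaschke product and interpolation of the Cauchy kernel -/

/-- The Blaschke product `∏_j (z - x_j) / (z + x_j)`. -/
def blaschke (x : Fin r → K) (z : K) : K := ratio x x univ z

/-- The reciprocals of the derivatives of the Blaschke product at its zeros. -/
def bweight (x : Fin r → K) (k : Fin r) : K := (ratio x x (univ.erase k) (x k))⁻¹

lemma blaschke_self (x : Fin r → K) (k : Fin r) : blaschke x (x k) = 0 := by
  rw [blaschke, ratio_univ x x k]; simp

lemma blaschke_eq (x : Fin r → K) (k : Fin r) (z : K) :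
    blaschke x z = (z - x k) * ratio x x (univ.erase k) z := ratio_univ x x k z

/-- Pairwise distinct points with nonzero pairwise sums. -/
structure IsNode (x : Fin r → K) : Prop where
  inj : Function.Injective x
  add_ne : ∀ i j, x i + x j ≠ 0

variable {x : Fin r → K}

lemma IsNode.bweight_ne (hx : IsNode x) (k : Fin r) : bweight x k ≠ 0 := by
  refine inv_ne_zero (div_ne_zero ?_ ?_)
  · exact prod_ne_zero_iff.2 fun j hj => sub_ne_zero.2 (hx.inj.ne (mem_erase.1 hj).1.symm)
  · exact prod_ne_zero_iff.2 fun j _ => hx.add_ne k j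

lemma ratio_erase_of_ne (t : Fin r → K) {k l : Fin r} (hkl : k ≠ l) :
    ratio t x (univ.erase l) (x k) = 0 := by
  unfold ratio
  rw [prod_eq_zero (mem_erase.2 ⟨hkl, mem_univ k⟩) (sub_self _), zero_div]

/-- Partial fractions of the Blaschke product. -/
lemma IsNode.sum_bweight (hx : IsNode x) {u : K} (hu : ∀ j, u + x j ≠ 0) :
    ∑ l, bweight x l / (u + x l) = 1 - blaschke x u := by
  -- This is the numerator of 1 - B. Both products are monic of degree r, so the leading terms
  -- cancel and the partial fraction formula applies.
  set f : Polynomial K := (∏ j, (Polynomial.X + Polynomial.C (x j))) -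
    ∏ j, (Polynomial.X - Polynomial.C (x j)) with hf
  have hm1 : (∏ j, (Polynomial.X + Polynomial.C (x j))).Monic :=
    Polynomial.monic_prod_of_monic _ _ fun j _ => Polynomial.monic_X_add_C _
  have hm2 : (∏ j, (Polynomial.X - Polynomial.C (x j))).Monic :=
    Polynomial.monic_prod_of_monic _ _ fun j _ => Polynomial.monic_X_sub_C _
  have hd1 : (∏ j, (Polynomial.X + Polynomial.C (x j))).degree = (r : WithBot ℕ) := by
    rw [Polynomial.degree_prod]; simp
  have hd2 : (∏ j, (Polynomial.X - Polynomial.C (x j))).degree = (r : WithBot ℕ) := by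
    rw [Polynomial.degree_prod]; simp
  have hdeg : f.degree < r := by
    rw [← hd1]
    exact Polynomial.degree_sub_lt_left (hd1.trans hd2.symm) hm1.ne_zero
      (hm1.leadingCoeff.trans hm2.leadingCoeff.symm)
  have hpf := partial_fractions hx.inj f hdeg hu
  have hev : ∀ w, f.eval w = ∏ j, (w + x j) - ∏ j, (w - x j) := by
    intro w; simp [hf, Polynomial.eval_prod]
  rw [hev] at hpf
  have h1 : ∏ j, (u + x j) ≠ 0 := prod_ne_zero_iff.2 fun j _ => hu j
  rw [blaschke, ratio, show (1 : K) - (∏ j, (u - x j)) / ∏ j, (u + x j) =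
    (∏ j, (u + x j) - ∏ j, (u - x j)) / ∏ j, (u + x j) by field_simp, hpf]
  refine sum_congr rfl fun l _ => ?_
  congr 1
  rw [hev, prod_eq_zero (f := fun j => -x l + x j) (mem_univ l) (neg_add_cancel (x l)), zero_sub,
    bweight]
  unfold ratio
  rw [inv_div]
  have e1 : ∏ j, (-x l - x j) = (-1) ^ r * ∏ j, (x l + x j) := by
    have := prod_neg (s := univ) (f := fun j => x l + x j)
    simp only [card_fin] at this
    rw [← this]
    exact prod_congr rfl fun j _ => by ring
  have e2 : ∏ j ∈ univ.erase l, (x j - x l) =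
      (-1) ^ (r - 1) * ∏ j ∈ univ.erase l, (x l - x j) := by
    have := prod_neg (s := univ.erase l) (f := fun j => x l - x j)
    simp only [card_erase_of_mem (mem_univ l), card_fin] at this
    rw [← this]
    exact prod_congr rfl fun j _ => by ring
  rw [e1, e2]
  -- The index l forces r ≥ 1. The signs (-1)^r and (-1)^(r-1) leave a quotient -1, which cancels
  -- the minus sign of the numerator.
  obtain ⟨q, rfl⟩ : ∃ q, r = q + 1 := ⟨r - 1, by have := l.2; omega⟩
  have : ((-1 : K)) ^ q ≠ 0 := pow_ne_zero _ (by simp)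
  have h4 : ∏ j ∈ univ.erase l, (x l - x j) ≠ 0 := prod_ne_zero_iff.2 fun j hj =>
    sub_ne_zero.2 (hx.inj.ne (mem_erase.1 hj).1.symm)
  simp only [Nat.add_sub_cancel, pow_succ]
  field_simp

lemma IsNode.sum_bweight_self (hx : IsNode x) (k : Fin r) :
    ∑ l, bweight x l / (x k + x l) = 1 := by
  rw [hx.sum_bweight (hx.add_ne k), blaschke_self, sub_zero]

lemma blaschke_mul_blaschke_neg {u : K} (hu : ∀ j, u + x j ≠ 0) (h : ∀ j, u ≠ x j) :
    blaschke x u * blaschke x (-u) = 1 := by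
  unfold blaschke ratio
  rw [← prod_div_distrib, ← prod_div_distrib, ← prod_mul_distrib]
  refine prod_eq_one fun j _ => ?_
  have h1 := hu j
  have h2 : -u + x j ≠ 0 := fun hj => h j (by linear_combination -hj)
  field_simp
  ring

/-- The interpolation error of the Cauchy kernel. -/
lemma IsNode.cauchy_interpolation (hx : IsNode x) {u z : K} (hu : ∀ j, u + x j ≠ 0)
    (hz : ∀ j, z + x j ≠ 0) :
    (z + u) * ∑ l, bweight x l * ratio x x (univ.erase l) u / (z + x l) =
      1 - blaschke x z * blaschke x u := by
  -- At a node only the term l = k survives. Away from the nodes -u is not a pole, so B(u) B(-u) = 1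
  -- and the partial fractions of B at -u can be used.
  by_cases h : ∃ k, u = x k
  · obtain ⟨k, rfl⟩ := h
    rw [blaschke_self, mul_zero, sub_zero, sum_eq_single k]
    · have h1 := hx.bweight_ne k
      have h2 := hz k
      unfold bweight at h1 ⊢
      rw [inv_mul_cancel₀ (fun h0 => h1 (by rw [h0, inv_zero]))]
      field_simp
    · intro l _ hl
      rw [ratio_erase_of_ne x hl.symm]; simp
    · simp
  · push Not at h
    have hneg : ∀ j, -u + x j ≠ 0 := fun j hj => h j (by linear_combination -hj)
    have hB := blaschke_mul_blaschke_neg hu h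
    have hS1 := hx.sum_bweight hz
    have hS2 := hx.sum_bweight hneg
    have key : (z + u) * ∑ l, bweight x l * ratio x x (univ.erase l) u / (z + x l) =
        blaschke x u * (∑ l, bweight x l / (z + x l) - ∑ l, bweight x l / (-u + x l)) := by
      rw [← sum_sub_distrib, mul_sum, mul_sum]
      refine sum_congr rfl fun l _ => ?_
      rw [blaschke_eq x l]
      have h1 := hz l
      have h2 := hneg l
      have h3 : u - x l ≠ 0 := sub_ne_zero.2 (h l)
      field_simp
      ring
    rw [key, hS1, hS2]
    linear_combination hB

/-- The interpolation property at infinity. -/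
lemma IsNode.sum_bweight_mul_ratio (hx : IsNode x) {u : K} (hu : ∀ j, u + x j ≠ 0) :
    ∑ l, bweight x l * ratio x x (univ.erase l) u = 1 - blaschke x u := by
  by_cases h : ∃ k, u = x k
  · obtain ⟨k, rfl⟩ := h
    rw [blaschke_self, sub_zero, sum_eq_single k]
    · have h1 := hx.bweight_ne k
      unfold bweight at h1 ⊢
      rw [inv_mul_cancel₀ (fun h0 => h1 (by rw [h0, inv_zero]))]
    · intro l _ hl
      rw [ratio_erase_of_ne x hl.symm]; simp
    · simp
  · push Not at h
    have hneg : ∀ j, -u + x j ≠ 0 := fun j hj => h j (by linear_combination -hj)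
    have hB := blaschke_mul_blaschke_neg hu h
    have hS2 := hx.sum_bweight hneg
    have key : ∑ l, bweight x l * ratio x x (univ.erase l) u =
        -(blaschke x u * ∑ l, bweight x l / (-u + x l)) := by
      rw [mul_sum, ← sum_neg_distrib]
      refine sum_congr rfl fun l _ => ?_
      rw [blaschke_eq x l]
      have h2 := hneg l
      field_simp
      ring
    rw [key, hS2]
    linear_combination hB

/-- The Cauchy matrix `1 / (x_i + x_j)`. -/
def cauchy (x : Fin r → K) : Matrix (Fin r) (Fin r) K := Matrix.of fun i j => (x i + x j)⁻¹

/-- The double Cauchy sum. -/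
lemma IsNode.double_sum (hx : IsNode x) {u v : K} (hu : ∀ j, u + x j ≠ 0)
    (hv : ∀ j, v + x j ≠ 0) :
    (u + v) * ∑ j, ∑ l, bweight x j * bweight x l / ((x j + x l) * (u + x j) * (v + x l)) =
      1 - blaschke x u * blaschke x v := by
  have h1 := hx.sum_bweight hu
  have h2 := hx.sum_bweight hv
  -- Each term is split by u + v = (u + x_j) + (v + x_l) - (x_j + x_l). The inner sums are then 1,
  -- and what remains is S_u + S_v - S_u S_v = 1 - (1 - S_u)(1 - S_v) with S = 1 - B.
  have e : (u + v) * ∑ j, ∑ l, bweight x j * bweight x l / ((x j + x l) * (u + x j) * (v + x l)) =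
      (∑ l, bweight x l / (v + x l) * ∑ j, bweight x j / (x l + x j)) +
      (∑ j, bweight x j / (u + x j) * ∑ l, bweight x l / (x j + x l)) -
      (∑ j, bweight x j / (u + x j)) * ∑ l, bweight x l / (v + x l) := by
    simp_rw [sum_mul, mul_sum]
    rw [sum_comm (s := univ) (t := univ) (f := fun l j => bweight x l / (v + x l) *
      (bweight x j / (x l + x j))), ← sum_add_distrib, ← sum_sub_distrib]
    refine sum_congr rfl fun j _ => ?_
    rw [← sum_add_distrib, ← sum_sub_distrib]
    refine sum_congr rfl fun l _ => ?_
    have h1 := hu j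
    have h2 := hv l
    have h3 := hx.add_ne j l
    have h4 := hx.add_ne l j
    rw [add_comm (x l) (x j)]
    field_simp
    ring
  rw [e]
  simp_rw [hx.sum_bweight_self, mul_one, h1, h2]
  ring

end Algebra

end IRKA

namespace IRKA

open Finset

/-! ### The inverse of the Cauchy matrix -/

section Cauchy

variable {K : Type*} [Field K] {n r : ℕ} {x : Fin r → K}

/-- In the residue at -x_j the numerator lacks only the factor of index l, which accounts for the
quotient `bweight x j / (x j + x l)`. The right-hand side is a Cauchy matrix product in disguise. -/
lemma IsNode.ratio_eq_sum (hx : IsNode x) (l : Fin r) {u : K} (hu : ∀ j, u + x j ≠ 0) :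
    ratio x x (univ.erase l) u = ∑ j, bweight x j / ((x j + x l) * (u + x j)) := by
  have hdeg : (∏ j ∈ univ.erase l, (Polynomial.X - Polynomial.C (x j))).degree <
      (r : WithBot ℕ) := by
    rw [Polynomial.degree_prod]
    simp only [Polynomial.degree_X_sub_C, sum_const, card_erase_of_mem (mem_univ l), card_fin]
    have := l.2
    rw [nsmul_one]
    exact_mod_cast Nat.sub_lt (by omega) one_pos
  have h := partial_fractions hx.inj _ hdeg hu
  simp only [Polynomial.eval_prod, Polynomial.eval_sub, Polynomial.eval_X, Polynomial.eval_C] at h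
  rw [ratio, h]
  refine sum_congr rfl fun j _ => ?_
  have e1 : ∏ i ∈ univ.erase l, (-x j - x i) =
      (-1) ^ (r - 1) * ∏ i ∈ univ.erase l, (x j + x i) := by
    have := prod_neg (s := univ.erase l) (f := fun i => x j + x i)
    simp only [card_erase_of_mem (mem_univ l), card_fin] at this
    rw [← this]
    exact prod_congr rfl fun j _ => by ring
  have e2 : ∏ i ∈ univ.erase j, (x i - x j) =
      (-1) ^ (r - 1) * ∏ i ∈ univ.erase j, (x j - x i) := by
    have := prod_neg (s := univ.erase j) (f := fun i => x j - x i)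
    simp only [card_erase_of_mem (mem_univ j), card_fin] at this
    rw [← this]
    exact prod_congr rfl fun j _ => by ring
  have h1 : ((-1 : K)) ^ (r - 1) ≠ 0 := pow_ne_zero _ (by simp)
  have h4 : ∏ i ∈ univ.erase j, (x j - x i) ≠ 0 := prod_ne_zero_iff.2 fun i hi =>
    sub_ne_zero.2 (hx.inj.ne (mem_erase.1 hi).1.symm)
  have h5 := hx.add_ne j l
  have h6 := hu j
  rw [e1, e2, bweight]
  unfold ratio
  rw [inv_div, ← mul_prod_erase univ (fun i => x j + x i) (mem_univ l)]
  field_simp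

/-- The entry (i, k) of the product is the partial fraction expansion of `ratio x x (univ.erase k)`
at x_i times `bweight x k`. This function vanishes at every node except x_k, where it is the
reciprocal of `bweight x k`. -/
lemma IsNode.cauchy_mul_inverse (hx : IsNode x) :
    cauchy x * (Matrix.diagonal (bweight x) * cauchy x * Matrix.diagonal (bweight x)) = 1 := by
  ext i k
  rw [Matrix.mul_apply]
  have h := hx.ratio_eq_sum k (hx.add_ne i)
  have e : ∑ j, cauchy x i j *
      (Matrix.diagonal (bweight x) * cauchy x * Matrix.diagonal (bweight x)) j k =
      ratio x x (univ.erase k) (x i) * bweight x k := by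
    rw [h, sum_mul]
    refine sum_congr rfl fun j _ => ?_
    rw [Matrix.mul_diagonal, Matrix.diagonal_mul]
    simp only [cauchy, Matrix.of_apply]
    have h1 := hx.add_ne i j
    have h2 := hx.add_ne j k
    field_simp
  rw [e]
  by_cases hik : i = k
  · subst hik
    have h1 := hx.bweight_ne i
    unfold bweight at h1 ⊢
    rw [mul_inv_cancel₀ (fun h0 => h1 (by rw [h0, inv_zero])), Matrix.one_apply_eq]
  · rw [ratio_erase_of_ne x hik, zero_mul, Matrix.one_apply_ne hik]

lemma IsNode.isUnit_cauchy (hx : IsNode x) : IsUnit (cauchy x) :=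
  IsUnit.of_mul_eq_one _ hx.cauchy_mul_inverse

lemma IsNode.cauchy_inv (hx : IsNode x) :
    (cauchy x)⁻¹ = Matrix.diagonal (bweight x) * cauchy x * Matrix.diagonal (bweight x) :=
  Matrix.inv_eq_right_inv hx.cauchy_mul_inverse

end Cauchy

/-! ### The Schur complement S_c -/

section Schur

variable {K : Type*} [NontriviallyNormedField K] {n r : ℕ} {x : Fin r → K}

lemma differentiableAt_ratio (t y : Fin r → K) (S : Finset (Fin r)) {z : K}
    (hz : ∀ j, z + t j ≠ 0) : DifferentiableAt K (ratio t y S) z := by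
  unfold ratio
  refine DifferentiableAt.div ?_ ?_ (prod_ne_zero_iff.2 fun j _ => hz j)
  · exact DifferentiableAt.fun_finsetProd fun j _ => by fun_prop
  · exact DifferentiableAt.fun_finsetProd fun j _ => by fun_prop

lemma IsNode.hasDerivAt_blaschke (hx : IsNode x) (k : Fin r) :
    HasDerivAt (blaschke x) (bweight x k)⁻¹ (x k) := by
  have h1 := (differentiableAt_ratio x x (univ.erase k) (hx.add_ne k)).hasDerivAt
  have h2 := ((hasDerivAt_id (x k)).sub_const (x k)).mul h1
  have : blaschke x = (fun z => id z - x k) * ratio x x (univ.erase k) := by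
    funext z; rw [blaschke_eq x k]; rfl
  rw [this]
  refine h2.congr_deriv ?_
  simp [bweight]

lemma IsNode.eventually_add_ne (hx : IsNode x) (k : Fin r) : ∀ᶠ u in 𝓝 (x k), ∀ j, u + x j ≠ 0 := by
  refine eventually_all.2 fun j => ?_
  have : ContinuousAt (fun u => u + x j) (x k) := by fun_prop
  exact this.eventually_ne (hx.add_ne k j)

lemma hasDerivAt_inv_add {c u : K} (h : u + c ≠ 0) :
    HasDerivAt (fun u => (u + c)⁻¹) (-((u + c) ^ 2)⁻¹) u := by
  have := ((hasDerivAt_id u).add_const c).inv h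
  refine this.congr_deriv ?_
  simp [neg_div]

/-- The first differentiation of the double Cauchy sum. -/
lemma IsNode.double_sum_deriv (hx : IsNode x) (i : Fin r) {v : K} (hv : ∀ j, v + x j ≠ 0) :
    ∑ j, ∑ l, bweight x j * bweight x l * (x j + x l)⁻¹ *
      (-((x i + x j) ^ 2)⁻¹) * (v + x l)⁻¹ =
    -(bweight x i)⁻¹ * blaschke x v * (v + x i)⁻¹ - ((v + x i) ^ 2)⁻¹ := by
  have hiv : x i + v ≠ 0 := by rw [add_comm]; exact hv i
  have hf : HasDerivAt (fun u => ∑ j, ∑ l, bweight x j * bweight x l * (x j + x l)⁻¹ *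
      (u + x j)⁻¹ * (v + x l)⁻¹) (∑ j, ∑ l, bweight x j * bweight x l * (x j + x l)⁻¹ *
      (-((x i + x j) ^ 2)⁻¹) * (v + x l)⁻¹) (x i) :=
    HasDerivAt.fun_sum fun j _ => HasDerivAt.fun_sum fun l _ =>
      ((hasDerivAt_inv_add (hx.add_ne i j)).const_mul _).mul_const _
  have hg : HasDerivAt (fun u => (1 - blaschke x u * blaschke x v) * (u + v)⁻¹)
      (-(bweight x i)⁻¹ * blaschke x v * (v + x i)⁻¹ - ((v + x i) ^ 2)⁻¹) (x i) := by
    have := ((((hx.hasDerivAt_blaschke i).mul_const (blaschke x v)).const_sub 1).mul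
      (hasDerivAt_inv_add hiv))
    refine this.congr_deriv ?_
    rw [blaschke_self, add_comm (x i) v]
    ring
  have heq : (fun u => ∑ j, ∑ l, bweight x j * bweight x l * (x j + x l)⁻¹ *
      (u + x j)⁻¹ * (v + x l)⁻¹) =ᶠ[𝓝 (x i)]
      (fun u => (1 - blaschke x u * blaschke x v) * (u + v)⁻¹) := by
    have hne : ∀ᶠ u in 𝓝 (x i), u + v ≠ 0 := by
      have : ContinuousAt (fun u => u + v) (x i) := by fun_prop
      exact this.eventually_ne hiv
    filter_upwards [hx.eventually_add_ne i, hne] with u hu huv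
    rw [← hx.double_sum hu hv, mul_comm, inv_mul_cancel_left₀ huv]
    refine sum_congr rfl fun j _ => sum_congr rfl fun l _ => ?_
    rw [div_eq_mul_inv, mul_inv, mul_inv]
    ring
  exact hf.unique (hg.congr_of_eventuallyEq heq)

/-- The mixed derivative in u and v of (1 - B(u) B(v)) / (u + v) at two nodes: since B vanishes
there, only the derivative of the kernel and the product of the two derivatives of B remain. -/
lemma IsNode.double_sum_deriv_deriv (hx : IsNode x) (i k : Fin r) :
    ∑ j, ∑ l, bweight x j * bweight x l * (x j + x l)⁻¹ *
      (-((x i + x j) ^ 2)⁻¹) * (-((x k + x l) ^ 2)⁻¹) =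
    2 * ((x i + x k) ^ 3)⁻¹ - (bweight x i)⁻¹ * (bweight x k)⁻¹ * (x i + x k)⁻¹ := by
  have hf : HasDerivAt (fun v => ∑ j, ∑ l, bweight x j * bweight x l * (x j + x l)⁻¹ *
      (-((x i + x j) ^ 2)⁻¹) * (v + x l)⁻¹) (∑ j, ∑ l, bweight x j * bweight x l * (x j + x l)⁻¹ *
      (-((x i + x j) ^ 2)⁻¹) * (-((x k + x l) ^ 2)⁻¹)) (x k) :=
    HasDerivAt.fun_sum fun j _ => HasDerivAt.fun_sum fun l _ =>
      ((hasDerivAt_inv_add (hx.add_ne k l)).const_mul _)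
  have hg : HasDerivAt (fun v => -(bweight x i)⁻¹ * blaschke x v * (v + x i)⁻¹ -
      (v + x i)⁻¹ ^ 2)
      (2 * ((x i + x k) ^ 3)⁻¹ - (bweight x i)⁻¹ * (bweight x k)⁻¹ * (x i + x k)⁻¹) (x k) := by
    have := (((hx.hasDerivAt_blaschke k).const_mul (-(bweight x i)⁻¹)).mul
      (hasDerivAt_inv_add (hx.add_ne k i))).sub ((hasDerivAt_inv_add (hx.add_ne k i)).pow 2)
    refine this.congr_deriv ?_
    rw [blaschke_self, add_comm (x k) (x i)]
    simp only [Nat.cast_ofNat, Nat.add_one_sub_one, pow_one, ← inv_pow]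
    generalize (x i + x k)⁻¹ = w
    ring
  refine hf.unique (hg.congr_of_eventuallyEq ?_)
  filter_upwards [hx.eventually_add_ne k] with v hv
  rw [hx.double_sum_deriv i hv, inv_pow]

end Schur

section SchurMatrices

variable {r : ℕ} {x : Fin r → ℂ}

lemma matS11_neg (x : Fin r → ℂ) : matS11 (-x) = cauchy x := by
  ext i j
  simp only [matS11, cauchy, Matrix.of_apply, Pi.neg_apply]
  rw [← inv_neg]; congr 1; ring

/-- The entries of S₁₂ S₁₁⁻¹ S₁₂ are the mixed derivatives of the double Cauchy sum. Their cubic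
part is S₂₂, so the Schur complement is again a Cauchy matrix with diagonal scalings. -/
lemma IsNode.matSc_neg (hx : IsNode x) :
    matSc (-x) = Matrix.diagonal (bweight x)⁻¹ * cauchy x * Matrix.diagonal (bweight x)⁻¹ := by
  ext i k
  rw [matSc, matS11_neg, hx.cauchy_inv, Matrix.sub_apply, Matrix.mul_apply, Matrix.mul_diagonal,
    Matrix.diagonal_mul]
  have h := hx.double_sum_deriv_deriv i k
  have e : ∑ l, (matS12 (-x) * (Matrix.diagonal (bweight x) * cauchy x *
      Matrix.diagonal (bweight x))) i l * matS12 (-x) l k =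
      ∑ j, ∑ l, bweight x j * bweight x l * (x j + x l)⁻¹ *
      (-((x i + x j) ^ 2)⁻¹) * (-((x k + x l) ^ 2)⁻¹) := by
    rw [sum_comm]
    refine sum_congr rfl fun l _ => ?_
    rw [Matrix.mul_apply, sum_mul]
    refine sum_congr rfl fun j _ => ?_
    rw [Matrix.mul_diagonal, Matrix.diagonal_mul]
    simp only [matS12, cauchy, Matrix.of_apply, Pi.neg_apply]
    rw [show -x i + -x j = -(x i + x j) by ring, show -x l + -x k = -(x k + x l) by ring,
      neg_sq, neg_sq]
    ring
  rw [e, h]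
  simp only [matS22, cauchy, Matrix.of_apply, Pi.neg_apply, Pi.inv_apply]
  rw [show -x i + -x k = -(x i + x k) by ring, Odd.neg_pow (by decide), inv_neg]
  ring

lemma IsNode.matSc_neg_mul (hx : IsNode x) :
    matSc (-x) * (Matrix.diagonal (bweight x ^ 2) * cauchy x * Matrix.diagonal (bweight x ^ 2)) =
      1 := by
  have h := hx.cauchy_mul_inverse
  have e : Matrix.diagonal (bweight x)⁻¹ * Matrix.diagonal (bweight x ^ 2) =
      Matrix.diagonal (bweight x) := by
    rw [Matrix.diagonal_mul_diagonal]
    congr 1; funext i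
    have := hx.bweight_ne i
    simp only [Pi.inv_apply, Pi.pow_apply]
    field_simp
  have e2 : Matrix.diagonal (bweight x ^ 2) =
      Matrix.diagonal (bweight x) * Matrix.diagonal (bweight x) := by
    rw [Matrix.diagonal_mul_diagonal]
    congr 1; funext i
    simp [sq]
  have e3 : Matrix.diagonal (bweight x)⁻¹ * Matrix.diagonal (bweight x) = 1 := by
    rw [Matrix.diagonal_mul_diagonal, ← Matrix.diagonal_one]
    congr 1; funext i
    have := hx.bweight_ne i
    simp [this]
  calc _ = Matrix.diagonal (bweight x)⁻¹ * cauchy x *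
        (Matrix.diagonal (bweight x)⁻¹ * Matrix.diagonal (bweight x ^ 2)) * cauchy x *
        Matrix.diagonal (bweight x ^ 2) := by
          rw [hx.matSc_neg]; simp only [Matrix.mul_assoc]
    _ = Matrix.diagonal (bweight x)⁻¹ * (cauchy x * (Matrix.diagonal (bweight x) * cauchy x *
        Matrix.diagonal (bweight x))) * Matrix.diagonal (bweight x) := by
          rw [e, e2]; simp only [Matrix.mul_assoc]
    _ = 1 := by rw [h, Matrix.mul_one, e3]

lemma IsNode.isUnit_matSc (hx : IsNode x) : IsUnit (matSc (-x)) :=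
  IsUnit.of_mul_eq_one _ hx.matSc_neg_mul

lemma IsNode.matSc_inv (hx : IsNode x) : (matSc (-x))⁻¹ =
    Matrix.diagonal (bweight x ^ 2) * cauchy x * Matrix.diagonal (bweight x ^ 2) :=
  Matrix.inv_eq_right_inv hx.matSc_neg_mul

end SchurMatrices

end IRKA

namespace IRKA

open Finset Matrix

/-! ### Diagonalisation of the full model -/

section Spectral

variable {n r : ℕ}

/-- An orthogonal diagonalisation `A = U diag(-a) Uᵀ`, `b = c = U β` of a symmetric system. -/
structure SpectralForm (G : LTISystem ℝ n) (a b : Fin n → ℝ) (U : Matrix (Fin n) (Fin n) ℝ) :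
    Prop where
  orth : Uᵀ * U = 1
  hA : G.A = U * diagonal (-a) * Uᵀ
  hb : G.b = U *ᵥ b
  hc : G.c = G.b

lemma exists_spectralForm (G : LTISystem ℝ n) (h : G.IsSSS) :
    ∃ a b U, SpectralForm G a b U := by
  have hH : G.A.IsHermitian := by
    rw [IsHermitian, conjTranspose_eq_transpose_of_trivial]; exact h.1
  set U : Matrix (Fin n) (Fin n) ℝ := (hH.eigenvectorUnitary : Matrix (Fin n) (Fin n) ℝ)
  have hU : Uᵀ * U = 1 := by
    have := Unitary.coe_star_mul_self hH.eigenvectorUnitary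
    rwa [star_eq_conjTranspose, conjTranspose_eq_transpose_of_trivial] at this
  have hU2 : U * Uᵀ = 1 := mul_eq_one_comm.1 hU
  refine ⟨-hH.eigenvalues, Uᵀ *ᵥ G.b, U, hU, ?_, ?_, h.2⟩
  · have := hH.spectral_theorem
    rw [Unitary.conjStarAlgAut_apply, star_eq_conjTranspose,
      conjTranspose_eq_transpose_of_trivial] at this
    rw [neg_neg]
    exact this
  · rw [mulVec_mulVec, hU2, one_mulVec]

variable {G : LTISystem ℝ n} {a b : Fin n → ℝ} {U : Matrix (Fin n) (Fin n) ℝ}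

/-- The complexification of a real matrix. -/
noncomputable abbrev cmap {k l : ℕ} (M : Matrix (Fin k) (Fin l) ℝ) : Matrix (Fin k) (Fin l) ℂ :=
  M.map (algebraMap ℝ ℂ)

namespace SpectralForm

lemma orth_c (h : SpectralForm G a b U) : (cmap U)ᵀ * cmap U = 1 := by
  have := congrArg cmap h.orth
  rw [cmap, Matrix.map_mul, cmap, Matrix.map_one _ (map_zero _) (map_one _)] at this
  exact this

lemma orth_c' (h : SpectralForm G a b U) : cmap U * (cmap U)ᵀ = 1 :=
  mul_eq_one_comm.1 h.orth_c

lemma complexify_A (h : SpectralForm G a b U) :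
    G.complexify.A = cmap U * diagonal (fun i => -(a i : ℂ)) * (cmap U)ᵀ := by
  have : G.complexify.A = cmap G.A := rfl
  rw [this, h.hA, cmap, Matrix.map_mul, Matrix.map_mul, Matrix.diagonal_map (map_zero _)]
  congr 2
  congr 1
  funext i
  simp

lemma complexify_b (h : SpectralForm G a b U) :
    G.complexify.b = cmap U *ᵥ fun i => (b i : ℂ) := by
  funext i
  change ((G.b i : ℝ) : ℂ) = _
  rw [h.hb]
  simp [mulVec, dotProduct]

lemma complexify_c (h : SpectralForm G a b U) : G.complexify.c = G.complexify.b := by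
  funext i
  change ((G.c i : ℝ) : ℂ) = ((G.b i : ℝ) : ℂ)
  rw [h.hc]

lemma pencil_eq (h : SpectralForm G a b U) (z : ℂ) :
    G.complexify.pencil z = cmap U * diagonal (fun i => z + a i) * (cmap U)ᵀ := by
  have e : diagonal (fun i => z + (a i : ℂ)) = z • (1 : Matrix (Fin n) (Fin n) ℂ) -
      diagonal (fun i => -(a i : ℂ)) := by
    rw [smul_one_eq_diagonal, diagonal_sub]
    congr 1; funext i; ring
  rw [LTISystem.pencil, h.complexify_A, e, Matrix.mul_sub, Matrix.sub_mul, Matrix.mul_smul,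
    Matrix.mul_one, Matrix.smul_mul, h.orth_c']

lemma det_pencil (h : SpectralForm G a b U) (z : ℂ) :
    (G.complexify.pencil z).det = ∏ i, (z + a i) := by
  have h1 := congrArg det h.orth_c
  rw [det_mul, det_one] at h1
  rw [h.pencil_eq, det_mul, det_mul, det_diagonal]
  linear_combination (∏ i, (z + (a i : ℂ))) * h1

lemma pencil_inv (h : SpectralForm G a b U) {z : ℂ} (hz : ∀ i, z + a i ≠ 0) :
    (G.complexify.pencil z)⁻¹ = cmap U * diagonal (fun i => (z + a i)⁻¹) * (cmap U)ᵀ := by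
  apply inv_eq_right_inv
  rw [h.pencil_eq]
  calc _ = cmap U * (diagonal (fun i => z + (a i : ℂ)) * ((cmap U)ᵀ * cmap U) *
        diagonal (fun i => (z + (a i : ℂ))⁻¹)) * (cmap U)ᵀ := by simp only [Matrix.mul_assoc]
    _ = 1 := by
      rw [h.orth_c, Matrix.mul_one, diagonal_mul_diagonal]
      simp only [mul_inv_cancel₀ (hz _), diagonal_one, Matrix.mul_one, h.orth_c']

lemma resolvent_mulVec (h : SpectralForm G a b U) {z : ℂ} (hz : ∀ i, z + a i ≠ 0) :
    (G.complexify.pencil z)⁻¹ *ᵥ G.complexify.b =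
      cmap U *ᵥ fun i => (b i : ℂ) / (z + a i) := by
  rw [h.pencil_inv hz, h.complexify_b, mulVec_mulVec, Matrix.mul_assoc, h.orth_c, Matrix.mul_one,
    ← mulVec_mulVec]
  congr 1
  funext i
  rw [mulVec_diagonal, div_eq_inv_mul]

lemma transfer_eq (h : SpectralForm G a b U) {z : ℂ} (hz : ∀ i, z + a i ≠ 0) :
    G.complexify.transfer z = ∑ i, (b i : ℂ) ^ 2 / (z + a i) := by
  rw [LTISystem.transfer, h.resolvent_mulVec hz, h.complexify_c, h.complexify_b, dotProduct_mulVec,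
    ← mulVec_transpose, mulVec_mulVec, h.orth_c, one_mulVec, dotProduct]
  exact sum_congr rfl fun i _ => by ring

/-- The Cauchy matrix `b_i / (t_j + a_i)`. -/
noncomputable def vhat (a b : Fin n → ℝ) (t : Fin r → ℂ) : Matrix (Fin n) (Fin r) ℂ :=
  Matrix.of fun i j => (b i : ℂ) / (t j + a i)

lemma krylovV_eq (h : SpectralForm G a b U) {t : Fin r → ℂ} (ht : ∀ j i, t j + a i ≠ 0) :
    G.krylovV t = cmap U * vhat a b t := by
  ext k j
  rw [LTISystem.krylovV, of_apply, h.resolvent_mulVec (ht j)]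
  rfl

lemma krylovW_eq (h : SpectralForm G a b U) {t : Fin r → ℂ} (ht : ∀ j i, t j + a i ≠ 0) :
    G.krylovW t = cmap U * vhat a b t := by
  rw [← h.krylovV_eq ht]
  ext k j
  rw [LTISystem.krylovW, LTISystem.krylovV, of_apply, of_apply, h.complexify_c, ← mulVec_transpose]
  have : ((G.complexify.pencil (t j))⁻¹)ᵀ = (G.complexify.pencil (t j))⁻¹ := by
    rw [h.pencil_inv (ht j)]
    simp only [transpose_mul, transpose_transpose, diagonal_transpose, Matrix.mul_assoc]
  rw [this]

lemma krylov_gram (h : SpectralForm G a b U) {t : Fin r → ℂ} (ht : ∀ j i, t j + a i ≠ 0) :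
    (G.krylovW t)ᵀ * G.krylovV t = (vhat a b t)ᵀ * vhat a b t := by
  rw [h.krylovW_eq ht, h.krylovV_eq ht, transpose_mul, Matrix.mul_assoc,
    ← Matrix.mul_assoc (cmap U)ᵀ, h.orth_c, Matrix.one_mul]

lemma reduced_A (h : SpectralForm G a b U) {t : Fin r → ℂ} (ht : ∀ j i, t j + a i ≠ 0) :
    (G.reduced t).A = ((vhat a b t)ᵀ * vhat a b t)⁻¹ *
      ((vhat a b t)ᵀ * diagonal (fun i => -(a i : ℂ)) * vhat a b t) := by
  change ((G.krylovW t)ᵀ * G.krylovV t)⁻¹ * (G.krylovW t)ᵀ * G.complexify.A * G.krylovV t = _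
  rw [h.krylov_gram ht, h.krylovW_eq ht, h.krylovV_eq ht, h.complexify_A, transpose_mul]
  calc _ = ((vhat a b t)ᵀ * vhat a b t)⁻¹ * ((vhat a b t)ᵀ * ((cmap U)ᵀ * cmap U) *
        diagonal (fun i => -(a i : ℂ)) * ((cmap U)ᵀ * cmap U) * vhat a b t) := by
          simp only [Matrix.mul_assoc]
    _ = _ := by rw [h.orth_c]; simp only [Matrix.mul_one]

lemma reduced_b (h : SpectralForm G a b U) {t : Fin r → ℂ} (ht : ∀ j i, t j + a i ≠ 0) :
    (G.reduced t).b = (((vhat a b t)ᵀ * vhat a b t)⁻¹ * (vhat a b t)ᵀ) *ᵥ fun i => (b i : ℂ) := by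
  change (((G.krylovW t)ᵀ * G.krylovV t)⁻¹ * (G.krylovW t)ᵀ) *ᵥ G.complexify.b = _
  rw [h.krylov_gram ht, h.krylovW_eq ht, h.complexify_b, mulVec_mulVec, transpose_mul,
    Matrix.mul_assoc, Matrix.mul_assoc, h.orth_c, Matrix.mul_one]

lemma reduced_c (h : SpectralForm G a b U) {t : Fin r → ℂ} (ht : ∀ j i, t j + a i ≠ 0) :
    (G.reduced t).c = (vhat a b t)ᵀ *ᵥ fun i => (b i : ℂ) := by
  change (G.krylovV t)ᵀ *ᵥ G.complexify.c = _
  rw [h.complexify_c, h.krylovV_eq ht, h.complexify_b, mulVec_mulVec, transpose_mul,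
    Matrix.mul_assoc, h.orth_c, Matrix.mul_one]

lemma pos_of_isStable (h : SpectralForm G a b U) (hs : G.IsStable) (i : Fin n) : 0 < a i := by
  have := hs (-(a i : ℂ)) (by
    rw [h.det_pencil]
    exact prod_eq_zero (mem_univ i) (by ring))
  simpa using this

/-- The diagonal realization with prescribed poles. -/
def diagSystem {m : ℕ} (a b : Fin m → ℝ) : LTISystem ℝ m where
  A := diagonal (-a)
  b := b
  c := b

lemma diagSystem_spectralForm {m : ℕ} (a b : Fin m → ℝ) :
    SpectralForm (diagSystem a b) a b 1 where
  orth := by simp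
  hA := by simp [diagSystem]
  hb := by simp [diagSystem]
  hc := rfl

/-- Merging equal poles and dropping zero masses gives a realization of the same transfer function;
minimality says that nothing was merged or dropped. -/
lemma of_isMinimal (h : SpectralForm G a b U) (hm : G.IsMinimal) :
    Function.Injective a ∧ ∀ i, b i ≠ 0 := by
  classical
  set S : Finset (Fin n) := univ.filter fun i => b i ≠ 0 with hS
  set T : Finset ℝ := S.image a with hT
  set e : Fin T.card ≃ T := T.equivFin.symm
  have hle : n ≤ T.card := by
    -- The square root makes the squared input coefficient equal to the total mass at the pole.
    refine hm T.card (diagSystem (fun j => (e j : ℝ))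
      (fun j => Real.sqrt (∑ i ∈ S.filter (fun i => a i = e j), b i ^ 2))) fun z hz hz' => ?_
    rw [h.det_pencil, prod_ne_zero_iff] at hz
    rw [(diagSystem_spectralForm _ _).det_pencil, prod_ne_zero_iff] at hz'
    rw [h.transfer_eq fun i => hz i (mem_univ i),
      (diagSystem_spectralForm _ _).transfer_eq fun i => hz' i (mem_univ i)]
    have e1 : ∑ i, (b i : ℂ) ^ 2 / (z + a i) = ∑ i ∈ S, (b i : ℂ) ^ 2 / (z + a i) := by
      rw [hS, sum_filter]
      refine sum_congr rfl fun i _ => ?_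
      split_ifs with hi
      · rfl
      · push Not at hi; simp [hi]
    rw [e1, ← sum_fiberwise_of_maps_to (t := T) (g := a) fun i hi => mem_image_of_mem a hi,
      ← sum_coe_sort T, ← e.sum_comp]
    refine sum_congr rfl fun j _ => ?_
    rw [← Complex.ofReal_pow, Real.sq_sqrt (sum_nonneg fun i _ => sq_nonneg _),
      Complex.ofReal_sum, sum_div]
    refine sum_congr rfl fun i hi => ?_
    rw [(mem_filter.1 hi).2, Complex.ofReal_pow]
  have h1 : T.card ≤ S.card := card_image_le
  have h2 : S.card ≤ n := by simpa using card_le_univ S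
  have h3 : S = univ := (card_eq_iff_eq_univ S).1 (by simp; omega)
  have h4 : T.card = S.card := by omega
  refine ⟨?_, fun i => ?_⟩
  · have := card_image_iff.1 h4
    rw [h3] at this
    exact fun i j hij => this (by simp) (by simp) hij
  · have : i ∈ S := h3 ▸ mem_univ i
    exact (mem_filter.1 this).2

end SpectralForm

end Spectral

/-! ### The projected model in the polynomial basis -/

section Reduced

variable {n r : ℕ} {a b : Fin n → ℝ}

/-- The vectors `b_i ∏_{j ≠ k} (a_i - y_j) / ∏_j (a_i + t_j)`. -/
noncomputable def ritz (a b : Fin n → ℝ) (t y : Fin r → ℂ) : Matrix (Fin n) (Fin r) ℂ :=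
  Matrix.of fun i k => (b i : ℂ) * ratio t y (univ.erase k) (a i)

/-- The coordinates of `ritz` with respect to `vhat`. -/
noncomputable def ritzCoord (t y : Fin r → ℂ) : Matrix (Fin r) (Fin r) ℂ :=
  Matrix.of fun j k => (∏ l ∈ univ.erase k, (-(t j) - y l)) / ∏ l ∈ univ.erase j, (t l - t j)

/-- The change from the basis 1 / (X + t_j) to the basis p_k / ∏_j (X + t_j) is a partial fraction
decomposition. -/
lemma vhat_mul_ritzCoord {t : Fin r → ℂ} (y : Fin r → ℂ) (hti : Function.Injective t)
    (ht : ∀ j i, t j + a i ≠ 0) :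
    SpectralForm.vhat a b t * ritzCoord t y = ritz a b t y := by
  ext i k
  have hdeg : (∏ j ∈ univ.erase k, (Polynomial.X - Polynomial.C (y j))).degree <
      (r : WithBot ℕ) := by
    rw [Polynomial.degree_prod]
    simp only [Polynomial.degree_X_sub_C, sum_const, card_erase_of_mem (mem_univ k), card_fin]
    have := k.2
    rw [nsmul_one]
    exact_mod_cast Nat.sub_lt (by omega) one_pos
  have h := partial_fractions hti _ hdeg (u := (a i : ℂ)) fun j => by rw [add_comm]; exact ht j i
  simp only [Polynomial.eval_prod, Polynomial.eval_sub, Polynomial.eval_X, Polynomial.eval_C] at h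
  simp only [mul_apply, SpectralForm.vhat, ritzCoord, ritz, of_apply]
  rw [ratio, h, mul_sum]
  refine sum_congr rfl fun j _ => ?_
  rw [add_comm (a i : ℂ)]
  ring

/-- Complex versions of the spectral data. -/
abbrev cpole (a : Fin n → ℝ) : Fin n → ℂ := fun i => (a i : ℂ)

/-- The residues `b_i²` of the full model. -/
abbrev cmass (b : Fin n → ℝ) : Fin n → ℂ := fun i => (b i : ℂ) ^ 2

lemma ritz_gram {t y : Fin r → ℂ} (hy : Function.Injective y)
    (hres : residual (cpole a) (cmass b) t y = 0) :
    (ritz a b t y)ᵀ * ritz a b t y = diagonal (gramDiag (cpole a) (cmass b) t y) := by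
  ext k l
  have e : ((ritz a b t y)ᵀ * ritz a b t y) k l = gramOff (cpole a) (cmass b) t y k l := by
    simp only [mul_apply, transpose_apply, ritz, of_apply, gramOff]
    exact sum_congr rfl fun i _ => by ring
  rw [e]
  by_cases hkl : k = l
  · subst hkl; rw [gramOff_self, diagonal_apply_eq]
  · rw [gramOff_eq_zero hy hres hkl, diagonal_apply_ne _ hkl]

/-- The p_k are Ritz vectors: (X - y_k) p_k = p is orthogonal to every p_l, so multiplication by X
acts on p_k as y_k within the projected space. -/
lemma ritz_stiff {t y : Fin r → ℂ} (hy : Function.Injective y)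
    (hres : residual (cpole a) (cmass b) t y = 0) :
    (ritz a b t y)ᵀ * diagonal (fun i => -(a i : ℂ)) * ritz a b t y =
      diagonal (gramDiag (cpole a) (cmass b) t y) * diagonal (fun k => -(y k)) := by
  ext k l
  have e : ((ritz a b t y)ᵀ * diagonal (fun i => -(a i : ℂ)) * ritz a b t y) k l =
      -(∑ i, cmass b i * ((a i - y k) * (ratio t y (univ.erase k) (a i) *
        ratio t y (univ.erase l) (a i)))) - y k * gramOff (cpole a) (cmass b) t y k l := by
    rw [mul_apply]
    simp only [mul_diagonal, transpose_apply, ritz, of_apply, gramOff]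
    rw [mul_sum, ← sum_neg_distrib, ← sum_sub_distrib]
    exact sum_congr rfl fun i _ => by ring
  rw [e, diagonal_mul_diagonal]
  by_cases hkl : k = l
  · subst hkl
    have : ∑ i, cmass b i * ((a i - y k) * (ratio t y (univ.erase k) (a i) *
        ratio t y (univ.erase k) (a i))) = 0 := by
      have := congrFun hres k
      simpa only [residual, sq, Pi.zero_apply] using this
    rw [this, gramOff_self, diagonal_apply_eq]
    ring
  · rw [gramOff_eq_zero hy hres hkl, diagonal_apply_ne _ hkl]
    have h1 : ∀ i, (a i - y k) * (ratio t y (univ.erase k) (a i) *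
        ratio t y (univ.erase l) (a i)) = (a i - y l) * (ratio t y (univ.erase l) (a i) *
        ratio t y (univ.erase l) (a i)) := fun i => by
      have h1 := ratio_univ t y k (a i)
      have h2 := ratio_univ t y l (a i)
      linear_combination ratio t y (univ.erase l) (a i) * (h2 - h1)
    have : ∑ i, cmass b i * ((a i - y k) * (ratio t y (univ.erase k) (a i) *
        ratio t y (univ.erase l) (a i))) = 0 := by
      have := congrFun hres l
      simp_rw [h1]
      simpa only [residual, sq, Pi.zero_apply] using this
    rw [this]; ring

/-- The residues of the projected model. -/
def ritzMoment {K : Type*} [Field K] (a m : Fin n → K) (t y : Fin r → K) (k : Fin r) : K :=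
  ∑ i, m i * ratio t y (univ.erase k) (a i)

variable {G : LTISystem ℝ n} {U : Matrix (Fin n) (Fin n) ℝ}

/-- A zero of the residual determines the poles and the residues of the projected model. -/
lemma SpectralForm.reduced_of_residual (h : SpectralForm G a b U) {t y : Fin r → ℂ}
    (hti : Function.Injective t) (ht : ∀ j i, t j + a i ≠ 0) (hy : Function.Injective y)
    (hres : residual (cpole a) (cmass b) t y = 0)
    (hd : ∀ k, gramDiag (cpole a) (cmass b) t y k ≠ 0) :
    G.IsAdmissible t ∧
    (G.reduced t).A.charpoly = ∏ i, (Polynomial.X - Polynomial.C (-(y i))) ∧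
    ∀ z : ℂ, (∀ k, z + y k ≠ 0) → (G.reduced t).transfer z =
      ∑ k, ritzMoment (cpole a) (cmass b) t y k ^ 2 / gramDiag (cpole a) (cmass b) t y k /
        (z + y k) := by
  set V := SpectralForm.vhat a b t with hV
  set Q := ritzCoord t y with hQ
  set d := gramDiag (cpole a) (cmass b) t y with hdd
  have hVQ : V * Q = ritz a b t y := vhat_mul_ritzCoord y hti ht
  have hgram : Qᵀ * (Vᵀ * V) * Q = diagonal d := by
    rw [← ritz_gram hy hres, ← hVQ, transpose_mul]; simp only [Matrix.mul_assoc]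
  have hstiff : Qᵀ * (Vᵀ * diagonal (fun i => -(a i : ℂ)) * V) * Q =
      diagonal d * diagonal (fun k => -(y k)) := by
    rw [← ritz_stiff hy hres, ← hVQ, transpose_mul]; simp only [Matrix.mul_assoc]
  have hdet : (Qᵀ * (Vᵀ * V) * Q).det ≠ 0 := by
    rw [hgram, det_diagonal]; exact prod_ne_zero_iff.2 fun k _ => hd k
  rw [det_mul, det_mul, det_transpose] at hdet
  have hQdet : IsUnit Q.det := isUnit_iff_ne_zero.2 (right_ne_zero_of_mul hdet)
  have hNdet : (Vᵀ * V).det ≠ 0 := right_ne_zero_of_mul (left_ne_zero_of_mul hdet)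
  have hdinv : diagonal d * diagonal d⁻¹ = 1 := by
    rw [diagonal_mul_diagonal, ← diagonal_one]
    congr 1; funext k; exact mul_inv_cancel₀ (hd k)
  have hdinv' : diagonal d⁻¹ * diagonal d = 1 := mul_eq_one_comm.1 hdinv
  have hQtdet : IsUnit Qᵀ.det := by rwa [det_transpose]
  -- The congruence by Q diagonalises the Gram matrix and the projected `A` simultaneously, so Q
  -- consists of eigenvectors of the reduced matrix.
  have hNinv : (Vᵀ * V)⁻¹ = Q * diagonal d⁻¹ * Qᵀ := by
    apply inv_eq_right_inv
    have : Qᵀ * ((Vᵀ * V) * (Q * diagonal d⁻¹ * Qᵀ)) = Qᵀ * 1 := by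
      calc _ = Qᵀ * (Vᵀ * V) * Q * diagonal d⁻¹ * Qᵀ := by simp only [Matrix.mul_assoc]
        _ = _ := by rw [hgram, hdinv, Matrix.one_mul, Matrix.mul_one]
    have h2 := congrArg (fun M => Qᵀ⁻¹ * M) this
    simpa only [nonsing_inv_mul_cancel_left _ _ hQtdet] using h2
  have hArQ : (G.reduced t).A * Q = Q * diagonal (fun k => -(y k)) := by
    rw [h.reduced_A ht, ← hV, hNinv]
    calc _ = Q * diagonal d⁻¹ * (Qᵀ * (Vᵀ * diagonal (fun i => -(a i : ℂ)) * V) * Q) := by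
          simp only [Matrix.mul_assoc]
      _ = Q * (diagonal d⁻¹ * diagonal d) * diagonal (fun k => -(y k)) := by
          rw [hstiff]; simp only [Matrix.mul_assoc]
      _ = _ := by rw [hdinv', Matrix.mul_one]
  have hAr : (G.reduced t).A = Q * diagonal (fun k => -(y k)) * Q⁻¹ := by
    rw [← hArQ, mul_nonsing_inv_cancel_right _ _ hQdet]
  refine ⟨⟨fun i => ?_, ?_⟩, ?_, fun z hz => ?_⟩
  · rw [h.det_pencil]; exact prod_ne_zero_iff.2 fun j _ => ht i j
  · rw [h.krylov_gram ht]; exact hNdet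
  · obtain ⟨u, hu⟩ := (isUnit_iff_isUnit_det Q).2 hQdet
    have : (G.reduced t).A = u.val * diagonal (fun k => -(y k)) * u.val⁻¹ := by
      rw [hAr, ← hu]
    rw [this, charpoly_units_conj, charpoly_diagonal]
  · have hpen : (G.reduced t).pencil z = Q * diagonal (fun k => z + y k) * Q⁻¹ := by
      have e : diagonal (fun k => z + y k) = z • (1 : Matrix (Fin r) (Fin r) ℂ) -
          diagonal (fun k => -(y k)) := by
        rw [smul_one_eq_diagonal, diagonal_sub]
        congr 1; funext i; ring
      rw [LTISystem.pencil, hAr, e, Matrix.mul_sub, Matrix.sub_mul, Matrix.mul_smul,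
        Matrix.mul_one, Matrix.smul_mul, mul_nonsing_inv _ hQdet]
    have hpinv : ((G.reduced t).pencil z)⁻¹ = Q * diagonal (fun k => (z + y k)⁻¹) * Q⁻¹ := by
      apply inv_eq_right_inv
      rw [hpen]
      calc _ = Q * (diagonal (fun k => z + y k) * (Q⁻¹ * Q) *
            diagonal (fun k => (z + y k)⁻¹)) * Q⁻¹ := by simp only [Matrix.mul_assoc]
        _ = 1 := by
          rw [nonsing_inv_mul _ hQdet, Matrix.mul_one, diagonal_mul_diagonal]
          simp only [mul_inv_cancel₀ (hz _), diagonal_one, Matrix.mul_one]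
          rw [mul_nonsing_inv _ hQdet]
    set f := ritzMoment (cpole a) (cmass b) t y with hf
    have hfv : Qᵀ *ᵥ (Vᵀ *ᵥ fun i => (b i : ℂ)) = f := by
      rw [mulVec_mulVec, ← transpose_mul, hVQ]
      funext k
      simp only [mulVec, dotProduct, transpose_apply, ritz, of_apply, hf, ritzMoment]
      exact sum_congr rfl fun i _ => by ring
    have hbr : (G.reduced t).b = Q *ᵥ (diagonal d⁻¹ *ᵥ f) := by
      rw [h.reduced_b ht, ← hV, hNinv, ← hfv]
      simp only [mulVec_mulVec, Matrix.mul_assoc]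
    rw [LTISystem.transfer, hpinv, hbr, h.reduced_c ht, ← hV, mulVec_mulVec, Matrix.mul_assoc,
      Matrix.mul_assoc, nonsing_inv_mul _ hQdet, Matrix.mul_one, ← mulVec_mulVec,
      dotProduct_mulVec, ← mulVec_transpose, hfv, dotProduct]
    refine sum_congr rfl fun k _ => ?_
    rw [mulVec_diagonal, mulVec_diagonal, Pi.inv_apply]
    ring

end Reduced

end IRKA

namespace IRKA

open Finset Matrix

/-! ### Fixed points are real zeros of the residual -/

section FixedPoint

variable {n r : ℕ} {a b : Fin n → ℝ} {G : LTISystem ℝ n} {U : Matrix (Fin n) (Fin n) ℝ}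

/-- Two factorisations of a polynomial with distinct roots agree up to the order. -/
lemma exists_perm_of_prod_eq {t y : Fin r → ℂ} (hy : Function.Injective y)
    (h : ∏ i, (Polynomial.X - Polynomial.C (-(t i))) =
      ∏ i, (Polynomial.X - Polynomial.C (-(y i)))) :
    ∃ π : Equiv.Perm (Fin r), t = fun i => y (π i) := by
  have h1 : ∀ i, ∃ j, t i = y j := fun i => by
    have := congrArg (Polynomial.eval (-(t i))) h
    simp only [Polynomial.eval_prod, Polynomial.eval_sub, Polynomial.eval_X,
      Polynomial.eval_C] at this
    rw [prod_eq_zero (mem_univ i) (sub_self _)] at this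
    obtain ⟨j, -, hj⟩ := prod_eq_zero_iff.1 this.symm
    exact ⟨j, by linear_combination -hj⟩
  have h2 : ∀ j, ∃ i, t i = y j := fun j => by
    have := congrArg (Polynomial.eval (-(y j))) h
    simp only [Polynomial.eval_prod, Polynomial.eval_sub, Polynomial.eval_X,
      Polynomial.eval_C] at this
    rw [prod_eq_zero (s := univ) (f := fun i => -(y j) - -(y i)) (mem_univ j) (sub_self _)] at this
    obtain ⟨i, -, hi⟩ := prod_eq_zero_iff.1 this
    exact ⟨i, by linear_combination hi⟩
  choose π hπ using h1
  have hs : Function.Surjective π := fun j => by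
    obtain ⟨i, hi⟩ := h2 j
    exact ⟨i, hy ((hπ i).symm.trans hi)⟩
  exact ⟨Equiv.ofBijective π (Finite.surjective_iff_bijective.1 hs), funext fun i => hπ i⟩

lemma vhat_conj {t : Fin r → ℂ} {π : Equiv.Perm (Fin r)}
    (hπ : ∀ i, (starRingEnd ℂ) (t i) = t (π i)) (i : Fin n) (j : Fin r) :
    (starRingEnd ℂ) (SpectralForm.vhat a b t i j) = SpectralForm.vhat a b t i (π j) := by
  simp [SpectralForm.vhat, hπ]

lemma SpectralForm.add_ne_of_isAdmissible (h : SpectralForm G a b U) {t : Fin r → ℂ}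
    (ht : G.IsAdmissible t) (j : Fin r) (i : Fin n) : t j + a i ≠ 0 := by
  have := ht.1 j
  rw [h.det_pencil, prod_ne_zero_iff] at this
  exact this i (mem_univ i)

/-- The poles of a projected model at conjugation-closed points are real and negative. -/
lemma SpectralForm.eigenvalue_real (h : SpectralForm G a b U) (ha : ∀ i, 0 < a i)
    {t : Fin r → ℂ} (ht : G.IsAdmissible t) (htc : IsConjClosed t) {c : ℂ}
    (hc : (G.reduced t).A.charpoly.eval (-c) = 0) : ∃ x : ℝ, 0 < x ∧ c = x := by
  have hta := h.add_ne_of_isAdmissible ht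
  obtain ⟨π, hπ⟩ := htc
  set V := SpectralForm.vhat a b t with hV
  have hN : (Vᵀ * V).det ≠ 0 := by rw [hV, ← h.krylov_gram hta]; exact ht.2
  rw [eval_charpoly] at hc
  obtain ⟨u, hu0, hu⟩ := exists_mulVec_eq_zero_iff.2 hc
  have hu1 : (G.reduced t).A *ᵥ u = -c • u := by
    rw [sub_mulVec, sub_eq_zero] at hu
    rw [← hu, scalar_apply, ← smul_one_eq_diagonal, smul_mulVec, one_mulVec]
  set v := V *ᵥ u with hv
  have hv0 : v ≠ 0 := fun h0 => hu0 (by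
    have : (Vᵀ * V) *ᵥ u = 0 := by rw [← mulVec_mulVec, ← hv, h0, mulVec_zero]
    by_contra hne
    exact hN (exists_mulVec_eq_zero_iff.1 ⟨u, hne, this⟩))
  -- This is the Galerkin residual of the Ritz pair (-c, v); the projection makes it orthogonal to
  -- the columns of V for the bilinear form.
  set w : Fin n → ℂ := fun i => (c - a i) * v i with hw
  have hVw : Vᵀ *ᵥ w = 0 := by
    have h1 : (Vᵀ * diagonal (fun i => -(a i : ℂ)) * V) *ᵥ u = -c • ((Vᵀ * V) *ᵥ u) := by
      rw [h.reduced_A hta, ← hV, ← mulVec_mulVec] at hu1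
      have := congrArg (fun q => (Vᵀ * V) *ᵥ q) hu1
      rwa [mulVec_mulVec, mul_nonsing_inv _ (isUnit_iff_ne_zero.2 hN), one_mulVec,
        mulVec_smul] at this
    have h2 : w = c • v + diagonal (fun i => -(a i : ℂ)) *ᵥ v := by
      funext i
      simp only [hw, Pi.add_apply, Pi.smul_apply, smul_eq_mul, mulVec_diagonal]
      ring
    rw [← mulVec_mulVec, ← mulVec_mulVec, ← mulVec_mulVec, ← hv] at h1
    rw [h2, mulVec_add, h1, mulVec_smul, neg_smul, add_neg_cancel]
  -- Conjugation permutes the columns of V, so bilinear orthogonality is also Hermitian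
  -- orthogonality, and w may be paired with the conjugate of v.
  have hcw : ∀ j, ∑ i, (starRingEnd ℂ) (V i j) * w i = 0 := fun j => by
    have := congrFun hVw (π j)
    simp only [mulVec, dotProduct, transpose_apply, Pi.zero_apply] at this
    rw [← this]
    exact sum_congr rfl fun i _ => by rw [vhat_conj hπ]
  have hvw : ∑ i, (starRingEnd ℂ) (v i) * w i = 0 := by
    have : ∀ i, (starRingEnd ℂ) (v i) = ∑ j, (starRingEnd ℂ) (V i j) * (starRingEnd ℂ) (u j) :=
      fun i => by simp [hv, mulVec, dotProduct]
    simp_rw [this, sum_mul]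
    rw [sum_comm]
    refine sum_eq_zero fun j _ => ?_
    have h2 := congrArg (fun q => (starRingEnd ℂ) (u j) * q) (hcw j)
    simp only [mul_zero, mul_sum] at h2
    rw [← h2]
    exact sum_congr rfl fun i _ => by ring
  clear_value v w
  set S : ℝ := ∑ i, ‖v i‖ ^ 2 with hS
  set T : ℝ := ∑ i, a i * ‖v i‖ ^ 2 with hT
  obtain ⟨i₀, hi₀⟩ := Function.ne_iff.1 hv0
  have hpos : 0 < ‖v i₀‖ ^ 2 := by
    have := norm_pos_iff.2 hi₀
    positivity
  have hSpos : 0 < S := sum_pos' (fun i _ => by positivity) ⟨i₀, mem_univ _, hpos⟩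
  have hTpos : 0 < T := sum_pos' (fun i _ => by have := ha i; positivity)
    ⟨i₀, mem_univ _, mul_pos (ha i₀) hpos⟩
  -- Hence c is the Rayleigh quotient of diag(a) at v, a positive real number.
  have hfin : c * S = T := by
    have e : ∑ i, (starRingEnd ℂ) (v i) * w i = c * S - T := by
      rw [hS, hT]
      push_cast
      rw [mul_sum, ← sum_sub_distrib]
      refine sum_congr rfl fun i _ => ?_
      have := Complex.conj_mul' (v i)
      rw [hw, ← this]
      ring
    rw [e] at hvw
    linear_combination hvw
  refine ⟨T / S, by positivity, ?_⟩
  push_cast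
  rw [eq_div_iff (by exact_mod_cast hSpos.ne'), hfin]

/-- At a fixed point the orthogonality defects vanish. -/
lemma SpectralForm.residual_eq_zero (h : SpectralForm G a b U) {s : Fin r → ℂ}
    (hs : Function.Injective s) (hstep : G.IRKAStep s s) :
    residual (cpole a) (cmass b) s s = 0 := by
  obtain ⟨hadm, hchar⟩ := hstep
  have hsa := h.add_ne_of_isAdmissible hadm
  set V := SpectralForm.vhat a b s with hV
  have hN : (Vᵀ * V).det ≠ 0 := by rw [hV, ← h.krylov_gram hsa]; exact hadm.2
  set g : Fin n → ℂ := fun i => (b i : ℂ) * ratio s s univ (a i) with hg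
  have hcol : ∀ k, V *ᵥ (fun j => ritzCoord s s j k) =
      fun i => (b i : ℂ) * ratio s s (univ.erase k) (a i) := fun k => by
    funext i
    have := congrFun (congrFun (vhat_mul_ritzCoord (a := a) (b := b) s hs hsa) i) k
    rw [mul_apply] at this
    exact this
  -- Coordinates of the projection of p = (X - s_k) p_k. They do not depend on k, while they lie in
  -- the range of -s_k I - A_r for each k.
  set ζ := (Vᵀ * V)⁻¹ *ᵥ (Vᵀ *ᵥ g) with hζ
  have hshift : ∀ k, (scalar (Fin r) (-(s k)) - (G.reduced s).A) *ᵥ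
      (fun j => ritzCoord s s j k) = ζ := fun k => by
    have h1 : (G.reduced s).A *ᵥ (fun j => ritzCoord s s j k) = (Vᵀ * V)⁻¹ *ᵥ (Vᵀ *ᵥ
        fun i => -(a i : ℂ) * ((b i : ℂ) * ratio s s (univ.erase k) (a i))) := by
      rw [h.reduced_A hsa, ← hV, ← mulVec_mulVec, ← mulVec_mulVec, hcol, ← mulVec_mulVec]
      congr 2
      funext i
      rw [mulVec_diagonal]
    have h2 : scalar (Fin r) (-(s k)) *ᵥ (fun j => ritzCoord s s j k) =
        (Vᵀ * V)⁻¹ *ᵥ (Vᵀ *ᵥ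
        fun i => -(s k) * ((b i : ℂ) * ratio s s (univ.erase k) (a i))) := by
      have e : (fun i => -(s k) * ((b i : ℂ) * ratio s s (univ.erase k) (a i))) =
          -(s k) • (V *ᵥ (fun j => ritzCoord s s j k)) := by
        rw [hcol]; rfl
      rw [e, mulVec_smul, mulVec_smul, mulVec_mulVec, mulVec_mulVec, Matrix.mul_assoc,
        nonsing_inv_mul _ (isUnit_iff_ne_zero.2 hN), one_mulVec, scalar_apply,
        ← smul_one_eq_diagonal, smul_mulVec, one_mulVec]
    rw [sub_mulVec, h1, h2, hζ, ← mulVec_sub, ← mulVec_sub]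
    congr 2
    funext i
    simp only [Pi.sub_apply, hg, ratio_univ s s k]
    ring
  -- Every left eigenvector of A_r annihilates ζ. The eigenvalues are distinct, so the left
  -- eigenvectors form a basis and ζ = 0; that is, p is orthogonal to the whole projected space.
  have hroot : ∀ k, ∃ y ≠ 0, y ᵥ* (scalar (Fin r) (-(s k)) - (G.reduced s).A) = 0 := fun k => by
    rw [exists_vecMul_eq_zero_iff, ← eval_charpoly, hchar, Polynomial.eval_prod]
    exact prod_eq_zero (mem_univ k) (by simp)
  choose y hy0 hy using hroot
  have hlin : LinearIndependent ℂ y := by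
    refine Module.End.eigenvectors_linearIndependent' (toLin' (G.reduced s).Aᵀ)
      (fun k => -(s k)) (fun i j hij => hs (neg_injective hij)) y fun k => ?_
    refine Module.End.hasEigenvector_iff.2 ⟨Module.End.mem_eigenspace_iff.2 ?_, hy0 k⟩
    have := hy k
    rw [vecMul_sub, sub_eq_zero] at this
    rw [toLin'_apply, mulVec_transpose, ← this, scalar_apply, ← smul_one_eq_diagonal,
      vecMul_smul, vecMul_one]
  have hζ0 : ζ = 0 := by
    have hY : IsUnit (Matrix.of y) := linearIndependent_rows_iff_isUnit.1 hlin
    have h0 : Matrix.of y *ᵥ ζ = 0 := by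
      funext k
      change y k ⬝ᵥ ζ = 0
      rw [← hshift k, dotProduct_mulVec, hy k, zero_dotProduct]
    by_contra hne
    exact (isUnit_iff_ne_zero.1 ((isUnit_iff_isUnit_det _).1 hY))
      (exists_mulVec_eq_zero_iff.1 ⟨ζ, hne, h0⟩)
  have hVg : Vᵀ *ᵥ g = 0 := by
    have := congrArg (fun q => (Vᵀ * V) *ᵥ q) hζ0
    rwa [hζ, mulVec_mulVec, mul_nonsing_inv _ (isUnit_iff_ne_zero.2 hN), one_mulVec,
      mulVec_zero] at this
  funext k
  have h1 : residual (cpole a) (cmass b) s s k = g ⬝ᵥ (V *ᵥ fun j => ritzCoord s s j k) := by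
    rw [hcol]
    simp only [residual, dotProduct, hg, ratio_univ s s k]
    exact sum_congr rfl fun i _ => by ring
  rw [h1, dotProduct_mulVec, ← mulVec_transpose, hVg, zero_dotProduct]
  rfl

/-- The real residual, regarded as a complex one. -/
lemma ofReal_ratio (t y : Fin r → ℝ) (S : Finset (Fin r)) (z : ℝ) :
    ((ratio t y S z : ℝ) : ℂ) = ratio (fun i => (t i : ℂ)) (fun i => (y i : ℂ)) S z := by
  simp [ratio]

lemma ofReal_residual (a b : Fin n → ℝ) (t y : Fin r → ℝ) (k : Fin r) :
    ((residual a (fun i => b i ^ 2) t y k : ℝ) : ℂ) =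
      residual (cpole a) (cmass b) (fun i => (t i : ℂ)) (fun i => (y i : ℂ)) k := by
  simp [residual, ofReal_ratio]

lemma ofReal_gramDiag (a b : Fin n → ℝ) (t y : Fin r → ℝ) (k : Fin r) :
    ((gramDiag a (fun i => b i ^ 2) t y k : ℝ) : ℂ) =
      gramDiag (cpole a) (cmass b) (fun i => (t i : ℂ)) (fun i => (y i : ℂ)) k := by
  simp [gramDiag, ofReal_ratio]

lemma ofReal_errWeight (a b : Fin n → ℝ) (t y : Fin r → ℝ) (k : Fin r) :
    ((errWeight a (fun i => b i ^ 2) t y k : ℝ) : ℂ) =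
      errWeight (cpole a) (cmass b) (fun i => (t i : ℂ)) (fun i => (y i : ℂ)) k := by
  simp [errWeight, ofReal_ratio]

lemma ofReal_ritzMoment (a b : Fin n → ℝ) (t y : Fin r → ℝ) (k : Fin r) :
    ((ritzMoment a (fun i => b i ^ 2) t y k : ℝ) : ℂ) =
      ritzMoment (cpole a) (cmass b) (fun i => (t i : ℂ)) (fun i => (y i : ℂ)) k := by
  simp [ritzMoment, ofReal_ratio]

/-- Fixed points are real and positive. -/
lemma SpectralForm.exists_real_fixedPoint (h : SpectralForm G a b U) (ha : ∀ i, 0 < a i)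
    {s : Fin r → ℂ} (hfix : G.IsIRKAFixedPoint s) :
    ∃ x : Fin r → ℝ, s = (fun k => (x k : ℂ)) ∧ (∀ k, 0 < x k) ∧ Function.Injective x ∧
      residual a (fun i => b i ^ 2) x x = 0 := by
  obtain ⟨hinj, hconj, hstep⟩ := hfix
  have hreal : ∀ k, ∃ x : ℝ, 0 < x ∧ s k = x := fun k => by
    refine h.eigenvalue_real ha hstep.1 hconj ?_
    rw [hstep.2, Polynomial.eval_prod]
    exact prod_eq_zero (mem_univ k) (by simp)
  choose x hx0 hx using hreal
  obtain rfl : s = fun k => (x k : ℂ) := funext hx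
  refine ⟨x, rfl, hx0, fun i j hij => hinj (by simp [hij]), funext fun k => ?_⟩
  have := congrFun (h.residual_eq_zero hinj hstep) k
  rw [← ofReal_residual, Pi.zero_apply] at this
  exact_mod_cast this

end FixedPoint

end IRKA

namespace IRKA

open Finset Matrix

/-! ### The iteration map and its Jacobian -/

section Smooth

variable {𝕜 : Type*} [RCLike 𝕜] {n r : ℕ}

/-- The smoothness order `⊤` here means analytic; the isolation of zeros on the curve through a
fixed point depends on it. -/
lemma contDiffAt_residual (a m : Fin n → 𝕜) {p : (Fin r → 𝕜) × (Fin r → 𝕜)}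
    (hp : ∀ i j, a i + p.1 j ≠ 0) :
    ContDiffAt 𝕜 ⊤ (fun p : (Fin r → 𝕜) × (Fin r → 𝕜) => residual a m p.1 p.2) p := by
  have h1 : ∀ j, ContDiffAt 𝕜 ⊤ (fun p : (Fin r → 𝕜) × (Fin r → 𝕜) => p.1 j) p := fun j => by
    fun_prop
  have h2 : ∀ j, ContDiffAt 𝕜 ⊤ (fun p : (Fin r → 𝕜) × (Fin r → 𝕜) => p.2 j) p := fun j => by
    fun_prop
  refine contDiffAt_pi.2 fun k => ?_
  unfold residual ratio
  refine ContDiffAt.sum fun i _ => ?_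
  have hN : ContDiffAt 𝕜 ⊤ (fun p : (Fin r → 𝕜) × (Fin r → 𝕜) =>
      ∏ j ∈ univ.erase k, (a i - p.2 j)) p :=
    contDiffAt_prod fun j _ => contDiffAt_const.sub (h2 j)
  have hD : ContDiffAt 𝕜 ⊤ (fun p : (Fin r → 𝕜) × (Fin r → 𝕜) => ∏ j, (a i + p.1 j)) p :=
    contDiffAt_prod fun j _ => contDiffAt_const.add (h1 j)
  have hq := (hN.div hD (prod_ne_zero_iff.2 fun j _ => hp i j)).pow 2
  exact contDiffAt_const.mul ((contDiffAt_const.sub (h2 k)).mul hq)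

/-- Multiplying by y_k + t_l = (a_i + t_l) - (a_i - y_k) splits the sum into the vanishing residual
and, since (X - y_k) p_k = p, minus the error weight. -/
lemma sum_errWeight {a m : Fin n → 𝕜} {t y : Fin r → 𝕜} (hta : ∀ i j, a i + t j ≠ 0)
    (hty : ∀ k l, y k + t l ≠ 0) (hres : residual a m t y = 0) (k l : Fin r) :
    ∑ i, m i * ((a i - y k) * ratio t y (univ.erase k) (a i) ^ 2 / (a i + t l)) =
      -(errWeight a m t y l / (y k + t l)) := by
  have h := congrFun hres k
  simp only [residual, Pi.zero_apply] at h
  have e : (y k + t l) *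
      ∑ i, m i * ((a i - y k) * ratio t y (univ.erase k) (a i) ^ 2 / (a i + t l)) =
      ∑ i, m i * ((a i - y k) * ratio t y (univ.erase k) (a i) ^ 2) - errWeight a m t y l := by
    rw [errWeight, mul_sum, ← sum_sub_distrib]
    refine sum_congr rfl fun i _ => ?_
    rw [ratio_univ t y k]
    have := hta i l
    field_simp
    ring
  rw [h, zero_sub] at e
  rw [← neg_div, eq_div_iff (hty k l)]
  linear_combination e

lemma hasDerivAt_prod_line (c w : Fin r → 𝕜) (S : Finset (Fin r)) :
    HasDerivAt (fun τ : 𝕜 => ∏ j ∈ S, (c j + τ * w j))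
      (∑ l ∈ S, w l * ∏ j ∈ S.erase l, c j) 0 := by
  have h := HasDerivAt.fun_finsetProd (u := S) (f := fun j (τ : 𝕜) => c j + τ * w j)
    (f' := w) (x := 0) fun j _ => by
      simpa using ((hasDerivAt_id (0 : 𝕜)).mul_const (w j)).const_add (c j)
  refine h.congr_deriv (sum_congr rfl fun l _ => ?_)
  simp [mul_comm]

/-- The derivative of the residual along a line through one of its zeros. -/
lemma hasDerivAt_residual_line {a m : Fin n → 𝕜} {t y : Fin r → 𝕜}
    (hta : ∀ i j, a i + t j ≠ 0) (hty : ∀ k l, y k + t l ≠ 0) (hy : Function.Injective y)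
    (hres : residual a m t y = 0) (v w : Fin r → 𝕜) (k : Fin r) :
    HasDerivAt (fun τ : 𝕜 => residual a m (t + τ • v) (y + τ • w) k)
      (-(gramDiag a m t y k * w k) + ∑ l, 2 * errWeight a m t y l / (y k + t l) * v l) 0 := by
  have hterm : ∀ i, HasDerivAt (fun τ : 𝕜 => m i * ((a i - (y + τ • w) k) *
      ratio (t + τ • v) (y + τ • w) (univ.erase k) (a i) ^ 2))
      (m i * (-(ratio t y (univ.erase k) (a i) ^ 2 * w k) -
        2 * ∑ l ∈ univ.erase k, w l * (ratio t y (univ.erase k) (a i) *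
          ratio t y (univ.erase l) (a i)) -
        2 * ∑ l, v l * ((a i - y k) * ratio t y (univ.erase k) (a i) ^ 2 / (a i + t l)))) 0 :=
    fun i => by
    have hN := hasDerivAt_prod_line (fun j => a i - y j) (fun j => -(w j)) (univ.erase k)
    have hD := hasDerivAt_prod_line (fun j => a i + t j) v univ
    have hD0 : ∏ j, (a i + t j) ≠ 0 := prod_ne_zero_iff.2 fun j _ => hta i j
    have hD0' : ∏ j, (a i + t j + 0 * v j) ≠ 0 := by simpa using hD0
    have hl : HasDerivAt (fun τ : 𝕜 => a i - y k + τ * -(w k)) (-(w k)) 0 := by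
      simpa using ((hasDerivAt_id (0 : 𝕜)).mul_const (-(w k))).const_add (a i - y k)
    have h := ((hl.mul ((hN.div hD hD0').pow 2)).const_mul (m i))
    have hfun : (fun τ : 𝕜 => m i * ((a i - (y + τ • w) k) *
        ratio (t + τ • v) (y + τ • w) (univ.erase k) (a i) ^ 2)) = fun τ : 𝕜 => m i *
        ((a i - y k + τ * -(w k)) * ((∏ j ∈ univ.erase k, (a i - y j + τ * -(w j))) /
          ∏ j, (a i + t j + τ * v j)) ^ 2) := by
      funext τ
      simp only [ratio, Pi.add_apply, Pi.smul_apply, smul_eq_mul]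
      congr 2
      · ring
      · congr 2
        · exact prod_congr rfl fun j _ => by ring
        · exact prod_congr rfl fun j _ => by ring
    rw [hfun]
    refine h.congr_deriv ?_
    simp only [zero_mul, add_zero, Pi.div_apply, Pi.pow_apply]
    set R := ratio t y (univ.erase k) (a i) with hR
    have hRdef : (∏ j ∈ univ.erase k, (a i - y j)) / ∏ j, (a i + t j) = R := rfl
    have hRN : ∏ j ∈ univ.erase k, (a i - y j) = R * ∏ j, (a i + t j) := by
      rw [← hRdef]; field_simp
    have hN' : (a i - y k) * (∑ l ∈ univ.erase k, -(w l) * ∏ j ∈ (univ.erase k).erase l,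
        (a i - y j)) = -(∑ l ∈ univ.erase k, w l * ratio t y (univ.erase l) (a i)) *
          ∏ j, (a i + t j) := by
      rw [neg_mul, sum_mul, mul_sum, ← sum_neg_distrib]
      refine sum_congr rfl fun l hl => ?_
      have : ratio t y (univ.erase l) (a i) * ∏ j, (a i + t j) =
          (a i - y k) * ∏ j ∈ (univ.erase k).erase l, (a i - y j) := by
        rw [ratio, div_mul_cancel₀ _ hD0, erase_right_comm,
          mul_prod_erase (univ.erase l) (fun j => a i - y j)
            (mem_erase.2 ⟨(mem_erase.1 hl).1.symm, mem_univ k⟩)]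
      linear_combination w l * this
    have hD' : ∑ l, v l * ∏ j ∈ univ.erase l, (a i + t j) =
        (∑ l, v l / (a i + t l)) * ∏ j, (a i + t j) := by
      rw [sum_mul]
      refine sum_congr rfl fun l _ => ?_
      rw [← mul_prod_erase univ _ (mem_univ l)]
      have := hta i l
      field_simp
    have e1 : ∑ l ∈ univ.erase k, w l * (R * ratio t y (univ.erase l) (a i)) =
        R * ∑ l ∈ univ.erase k, w l * ratio t y (univ.erase l) (a i) := by
      rw [mul_sum]; exact sum_congr rfl fun l _ => by ring
    have e2 : ∑ l, v l * ((a i - y k) * R ^ 2 / (a i + t l)) =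
        (a i - y k) * R ^ 2 * ∑ l, v l / (a i + t l) := by
      rw [mul_sum]; exact sum_congr rfl fun l _ => by ring
    rw [e1, e2, hRdef, hD', hRN]
    generalize hDg : ∏ j, (a i + t j) = D at *
    generalize (∑ l ∈ univ.erase k, w l * ratio t y (univ.erase l) (a i)) = A at *
    generalize (∑ l, v l / (a i + t l)) = B at *
    generalize (∑ l ∈ univ.erase k, -(w l) * ∏ j ∈ (univ.erase k).erase l,
        (a i - y j)) = C at *
    have : (C * D - R * D * (B * D)) / D ^ 2 = C / D - R * B := by field_simp
    rw [this]
    have h3 : (a i - y k) * (C / D) = -A := by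
      rw [← mul_div_assoc, hN']; field_simp
    simp only [Nat.cast_ofNat, Nat.add_one_sub_one, pow_one]
    linear_combination 2 * m i * R * h3
  have hsum := HasDerivAt.fun_sum (u := univ) fun i _ => hterm i
  refine hsum.congr_deriv ?_
  simp_rw [mul_sub, sum_sub_distrib]
  have e1 : ∑ i, m i * -(ratio t y (univ.erase k) (a i) ^ 2 * w k) =
      -(gramDiag a m t y k * w k) := by
    rw [gramDiag, sum_mul, ← sum_neg_distrib]; exact sum_congr rfl fun i _ => by ring
  -- Orthogonality of the p_k removes the dependence on w_l for l ≠ k; this is what makes the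
  -- derivative in y diagonal.
  have e2 : ∑ i, m i * (2 * ∑ l ∈ univ.erase k, w l * (ratio t y (univ.erase k) (a i) *
          ratio t y (univ.erase l) (a i))) = 0 := by
    simp_rw [mul_sum]
    rw [sum_comm]
    refine sum_eq_zero fun l hl => ?_
    have := gramOff_eq_zero hy hres (mem_erase.1 hl).1.symm
    rw [gramOff] at this
    have h2 := congrArg (fun q => 2 * w l * q) this
    simp only [mul_zero, mul_sum] at h2
    rw [← h2]
    exact sum_congr rfl fun i _ => by ring
  have e3 : ∑ i, m i * (2 * ∑ l, v l * ((a i - y k) * ratio t y (univ.erase k) (a i) ^ 2 /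
      (a i + t l))) = -∑ l, 2 * errWeight a m t y l / (y k + t l) * v l := by
    simp_rw [mul_sum]
    rw [sum_comm, ← sum_neg_distrib]
    refine sum_congr rfl fun l _ => ?_
    have := sum_errWeight hta hty hres k l
    have h2 := congrArg (fun q => 2 * v l * q) this
    simp only [mul_sum] at h2
    rw [show -(2 * errWeight a m t y l / (y k + t l) * v l) =
      2 * v l * -(errWeight a m t y l / (y k + t l)) by ring, ← h2]
    exact sum_congr rfl fun i _ => by ring
  rw [e1, e2, e3]
  ring

/-- The strict derivative of the residual at one of its zeros. -/
lemma exists_hasStrictFDerivAt_residual {a m : Fin n → 𝕜} {t y : Fin r → 𝕜}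
    (hta : ∀ i j, a i + t j ≠ 0) (hty : ∀ k l, y k + t l ≠ 0) (hy : Function.Injective y)
    (hres : residual a m t y = 0) :
    ∃ f' : ((Fin r → 𝕜) × (Fin r → 𝕜)) →L[𝕜] (Fin r → 𝕜),
      HasStrictFDerivAt (fun p : (Fin r → 𝕜) × (Fin r → 𝕜) => residual a m p.1 p.2) f' (t, y) ∧
      ∀ v w k, f' (v, w) k = -(gramDiag a m t y k * w k) +
        ∑ l, 2 * errWeight a m t y l / (y k + t l) * v l := by
  have hs := (contDiffAt_residual a m (p := (t, y)) hta).hasStrictFDerivAt (by simp)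
  refine ⟨_, hs, fun v w k => ?_⟩
  have hline : HasDerivAt (fun τ : 𝕜 => ((t, y) : (Fin r → 𝕜) × (Fin r → 𝕜)) + τ • (v, w)) (v, w)
      0 := by
    simpa using ((hasDerivAt_id (0 : 𝕜)).smul_const
      ((v, w) : (Fin r → 𝕜) × (Fin r → 𝕜))).const_add (t, y)
  have hfd : HasFDerivAt (fun p : (Fin r → 𝕜) × (Fin r → 𝕜) => residual a m p.1 p.2)
      (fderiv 𝕜 (fun p : (Fin r → 𝕜) × (Fin r → 𝕜) => residual a m p.1 p.2) (t, y))
      (((t, y) : (Fin r → 𝕜) × (Fin r → 𝕜)) + (0 : 𝕜) • (v, w)) := by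
    simpa using hs.hasFDerivAt
  have h1 := hasDerivAt_pi.1 (hfd.comp_hasDerivAt (0 : 𝕜) hline) k
  exact h1.unique (hasDerivAt_residual_line hta hty hy hres v w k)

/-- The Jacobian of the iteration at a fixed point. -/
def jac (a m : Fin n → 𝕜) (x : Fin r → 𝕜) : Matrix (Fin r) (Fin r) 𝕜 :=
  Matrix.of fun k l => 2 * errWeight a m x x l / (x k + x l) / gramDiag a m x x k

/-- The iteration map near a fixed point. -/
lemma exists_iteration {a m : Fin n → 𝕜} {x : Fin r → 𝕜} (hxa : ∀ i j, a i + x j ≠ 0)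
    (hx : IsNode x) (hd : ∀ k, gramDiag a m x x k ≠ 0) (hres : residual a m x x = 0) :
    ∃ F : (Fin r → 𝕜) → (Fin r → 𝕜), F x = x ∧
      HasStrictFDerivAt F (Matrix.toLin' (jac a m x)).toContinuousLinearMap x ∧
      (∀ᶠ t in 𝓝 x, residual a m t (F t) = 0) ∧
      ∀ᶠ p in 𝓝 (x, x), residual a m p.1 p.2 = 0 → F p.1 = p.2 := by
  obtain ⟨f', hf', hval⟩ := exists_hasStrictFDerivAt_residual hxa hx.add_ne hx.inj hres
  have hinr : ∀ w k, (f' ∘L .inr 𝕜 (Fin r → 𝕜) (Fin r → 𝕜)) w k =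
      -(gramDiag a m x x k * w k) := fun w k => by
    simp [hval]
  have hinj : Function.Injective (f' ∘L .inr 𝕜 (Fin r → 𝕜) (Fin r → 𝕜)) := by
    refine (injective_iff_map_eq_zero _).2 fun w hw => funext fun k => ?_
    have := congrFun hw k
    rw [hinr] at this
    simpa [hd k] using this
  -- The derivative in y is diagonal with nonzero entries, so the implicit function theorem defines
  -- the iteration map.
  have hinv : (f' ∘L .inr 𝕜 (Fin r → 𝕜) (Fin r → 𝕜)).IsInvertible := by
    refine ⟨(LinearEquiv.ofInjectiveEndo
      (f' ∘L .inr 𝕜 (Fin r → 𝕜) (Fin r → 𝕜)).toLinearMap hinj).toContinuousLinearEquiv, ?_⟩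
    ext w k
    rfl
  have hF := hf'.hasStrictFDerivAt_implicitFunctionOfProdDomain hinv
  have hiff := hf'.eventually_apply_eq_iff_implicitFunctionOfProdDomain hinv
  refine ⟨hf'.implicitFunctionOfProdDomain hinv, hiff.self_of_nhds.1 rfl, ?_, ?_, ?_⟩
  · refine hF.congr_fderiv (ContinuousLinearMap.ext fun v => ?_)
    have hsol : (f' ∘L .inr 𝕜 (Fin r → 𝕜) (Fin r → 𝕜)) (-((jac a m x) *ᵥ v)) =
        (f' ∘L .inl 𝕜 (Fin r → 𝕜) (Fin r → 𝕜)) v := by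
      funext k
      rw [hinr]
      simp only [ContinuousLinearMap.comp_apply, ContinuousLinearMap.inl_apply, hval, mulVec,
        dotProduct, jac, of_apply, Pi.neg_apply, Pi.zero_apply, mul_zero, neg_zero, zero_add,
        mul_neg, neg_neg]
      rw [mul_sum]
      refine sum_congr rfl fun l _ => ?_
      have := hd k
      field_simp
    have h3 := hinv.inverse_apply_eq.2 hsol.symm
    change -((f' ∘L .inr 𝕜 (Fin r → 𝕜) (Fin r → 𝕜)).inverse
      ((f' ∘L .inl 𝕜 (Fin r → 𝕜) (Fin r → 𝕜)) v)) = jac a m x *ᵥ v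
    rw [h3, neg_neg]
  · filter_upwards [hf'.eventually_apply_implicitFunctionOfProdDomain hinv] with t ht
    rw [ht]; exact hres
  · filter_upwards [hiff] with p hp hp0
    exact hp.1 (hp0.trans hres.symm)

end Smooth

end IRKA

namespace IRKA

open Finset MeasureTheory

/-! ### The H₂ norm of real rational functions -/

section Norm

lemma integrable_poisson {α : ℝ} (hα : 0 < α) :
    Integrable (fun ω : ℝ => α / (α ^ 2 + ω ^ 2)) := by
  have h := (integrable_inv_one_add_sq.comp_div hα.ne').const_mul α⁻¹
  refine h.congr (Eventually.of_forall fun ω => ?_)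
  have : 0 < α ^ 2 + ω ^ 2 := by positivity
  field_simp

lemma integral_poisson {α : ℝ} (hα : 0 < α) :
    ∫ ω : ℝ, α / (α ^ 2 + ω ^ 2) = Real.pi := by
  have h := Measure.integral_comp_div (fun ω : ℝ => (1 + ω ^ 2)⁻¹) α
  rw [integral_univ_inv_one_add_sq, abs_of_pos hα, smul_eq_mul] at h
  have e : (fun ω : ℝ => α / (α ^ 2 + ω ^ 2)) = fun ω => α⁻¹ * (1 + (ω / α) ^ 2)⁻¹ := by
    funext ω
    have : 0 < α ^ 2 + ω ^ 2 := by positivity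
    field_simp
  rw [e, integral_const_mul, h]
  field_simp

/-- The `H₂` norm of a rational function with real poles and residues. -/
lemma h2Norm_sq {ι : Type*} [Fintype ι] (η α : ι → ℝ) (hα : ∀ i, 0 < α i) (F : ℂ → ℂ)
    (hF : ∀ ω : ℝ, F (Complex.I * ω) = ∑ i, (η i : ℂ) / (Complex.I * ω + α i)) :
    h2Norm F ^ 2 = ∑ i, ∑ j, η i * η j / (α i + α j) := by
  -- Pairing the real and imaginary parts gives η_i η_j (α_i α_j + ω²) over the two denominators,
  -- which splits into two Poisson kernels because α_i (α_j² + ω²) + α_j (α_i² + ω²) = (α_i +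
  -- α_j)(α_i α_j + ω²). Each kernel integrates to π.
  have hpt : ∀ ω : ℝ, ‖F (Complex.I * ω)‖ ^ 2 = ∑ i, ∑ j, η i * η j / (α i + α j) *
      (α i / (α i ^ 2 + ω ^ 2) + α j / (α j ^ 2 + ω ^ 2)) := fun ω => by
    have hre : ∀ i, ((η i : ℂ) / (Complex.I * ω + α i)).re = η i * (α i / (α i ^ 2 + ω ^ 2)) :=
      fun i => by
      rw [Complex.div_re]
      simp [Complex.normSq_apply]
      ring
    have him : ∀ i, ((η i : ℂ) / (Complex.I * ω + α i)).im =
        η i * (-ω / (α i ^ 2 + ω ^ 2)) := fun i => by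
      rw [Complex.div_im]
      simp [Complex.normSq_apply]
      ring
    rw [hF, ← Complex.normSq_eq_norm_sq, Complex.normSq_apply, Complex.re_sum, Complex.im_sum]
    simp_rw [hre, him]
    rw [sum_mul_sum, sum_mul_sum, ← sum_add_distrib]
    refine sum_congr rfl fun i _ => ?_
    rw [← sum_add_distrib]
    refine sum_congr rfl fun j _ => ?_
    have hi := hα i
    have hj := hα j
    have h1 : 0 < α i ^ 2 + ω ^ 2 := by positivity
    have h2 : 0 < α j ^ 2 + ω ^ 2 := by positivity
    field_simp
    ring
  have hint : ∀ i, Integrable (fun ω : ℝ => α i / (α i ^ 2 + ω ^ 2)) :=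
    fun i => integrable_poisson (hα i)
  have hint2 : ∀ i j, Integrable (fun ω : ℝ => η i * η j / (α i + α j) *
      (α i / (α i ^ 2 + ω ^ 2) + α j / (α j ^ 2 + ω ^ 2))) :=
    fun i j => ((hint i).add (hint j)).const_mul _
  have hI : ∫ ω : ℝ, ‖F (Complex.I * ω)‖ ^ 2 =
      (2 * Real.pi) * ∑ i, ∑ j, η i * η j / (α i + α j) := by
    simp_rw [hpt]
    rw [integral_finsetSum _ fun i _ => integrable_finsetSum _ fun j _ => hint2 i j, mul_sum]
    refine sum_congr rfl fun i _ => ?_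
    rw [integral_finsetSum _ fun j _ => hint2 i j, mul_sum]
    refine sum_congr rfl fun j _ => ?_
    rw [integral_const_mul, integral_add (hint i) (hint j), integral_poisson (hα i),
      integral_poisson (hα j)]
    ring
  have hpi := Real.pi_pos
  rw [h2Norm, Real.sq_sqrt (by
    have : 0 ≤ ∫ ω : ℝ, ‖F (Complex.I * ω)‖ ^ 2 := integral_nonneg fun ω => by positivity
    positivity), hI]
  field_simp

/-- The Cauchy matrix is positive semidefinite. -/
lemma cauchy_form_nonneg {ι : Type*} [Fintype ι] (η α : ι → ℝ) (hα : ∀ i, 0 < α i) :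
    0 ≤ ∑ i, ∑ j, η i * η j / (α i + α j) := by
  rw [← h2Norm_sq η α hα (fun z => ∑ i, (η i : ℂ) / (z + α i)) fun ω => rfl]
  positivity

end Norm

/-! ### The reduced error and its derivative -/

section Cost

variable {n r : ℕ}

/-- The optimal residues for prescribed interpolation points. -/
noncomputable def optResidue (a m : Fin n → ℝ) (x : Fin r → ℝ) (k : Fin r) : ℝ :=
  bweight x k * ritzMoment a m x x k

/-- The squared error as a function of the residues and the negative poles. -/
noncomputable def errCost (a m : Fin n → ℝ) (ψ x : Fin r → ℝ) : ℝ :=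
  ∑ i, ∑ j, m i * m j / (a i + a j) - 2 * ∑ k, ψ k * ∑ i, m i / (x k + a i) +
    ∑ k, ∑ l, ψ k * ψ l / (x k + x l)

variable {a m : Fin n → ℝ} {x : Fin r → ℝ}

/-- The interpolation error in terms of the Blaschke product. -/
lemma IsNode.interpolation_error {K : Type*} [Field K] {a m : Fin n → K} {x : Fin r → K}
    (hx : IsNode x) (hax : ∀ i j, a i + x j ≠ 0) {z : K}
    (hza : ∀ i, z + a i ≠ 0) (hzx : ∀ j, z + x j ≠ 0) :
    ∑ i, m i / (z + a i) - ∑ l, bweight x l * ritzMoment a m x x l / (z + x l) =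
      blaschke x z * ∑ i, m i * blaschke x (a i) / (z + a i) := by
  have h : ∀ i, m i / (z + a i) - m i * ∑ l, bweight x l * ratio x x (univ.erase l) (a i) /
      (z + x l) = blaschke x z * (m i * blaschke x (a i) / (z + a i)) := fun i => by
    have h1 := hx.cauchy_interpolation (hax i) hzx
    have h2 := hza i
    have h3 : ∑ l, bweight x l * ratio x x (univ.erase l) (a i) / (z + x l) =
        (1 - blaschke x z * blaschke x (a i)) / (z + a i) := by
      rw [eq_div_iff h2, mul_comm, h1]
    rw [h3]
    field_simp
    ring
  rw [mul_sum, ← sum_congr rfl fun i _ => h i, sum_sub_distrib]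
  congr 1
  simp_rw [ritzMoment, mul_sum, sum_div]
  rw [sum_comm]
  exact sum_congr rfl fun i _ => sum_congr rfl fun l _ => by ring

/-- In 1 / (z + a_i) the part (1 - B(z) B(a_i)) / (z + a_i) is expanded by the Cauchy interpolation
formula and produces the residuals. If they vanish, a second factor B(z) appears in the
interpolation error: Hermite interpolation at the nodes. -/
lemma IsNode.sum_blaschke {K : Type*} [Field K] {a m : Fin n → K} {x : Fin r → K}
    (hx : IsNode x) (hax : ∀ i j, a i + x j ≠ 0) {z : K}
    (hza : ∀ i, z + a i ≠ 0) (hzx : ∀ j, z + x j ≠ 0) :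
    ∑ i, m i * blaschke x (a i) / (z + a i) =
      blaschke x z * ∑ i, m i * (blaschke x (a i) ^ 2 / (a i + z)) +
      ∑ l, bweight x l / (z + x l) * residual a m x x l := by
  have h : ∀ i, m i * blaschke x (a i) / (z + a i) =
      blaschke x z * (m i * (blaschke x (a i) ^ 2 / (a i + z))) +
      ∑ l, bweight x l / (z + x l) *
        (m i * ((a i - x l) * ratio x x (univ.erase l) (a i) ^ 2)) := fun i => by
    have h1 := hx.cauchy_interpolation (hax i) hzx
    have h2 := hza i
    have h3 : ∑ l, bweight x l / (z + x l) *
        (m i * ((a i - x l) * ratio x x (univ.erase l) (a i) ^ 2)) = m i * blaschke x (a i) *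
        ∑ l, bweight x l * ratio x x (univ.erase l) (a i) / (z + x l) := by
      rw [mul_sum]
      refine sum_congr rfl fun l _ => ?_
      rw [blaschke_eq x l]
      ring
    have h4 : ∑ l, bweight x l * ratio x x (univ.erase l) (a i) / (z + x l) =
        (1 - blaschke x z * blaschke x (a i)) / (z + a i) := by
      rw [eq_div_iff h2, mul_comm, h1]
    rw [h3, h4, add_comm (a i) z]
    ring
  rw [sum_congr rfl fun i _ => h i, sum_add_distrib, mul_sum]
  congr 1
  simp_rw [residual, mul_sum]
  rw [sum_comm]

lemma isNode_of_pos (hx0 : ∀ k, 0 < x k) (hx : Function.Injective x) : IsNode x :=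
  ⟨hx, fun i j => (add_pos (hx0 i) (hx0 j)).ne'⟩

/-- The derivative of the interpolation error at an interpolation point. -/
lemma interpolation_error_deriv (ha : ∀ i, 0 < a i) (hx0 : ∀ k, 0 < x k)
    (hx : Function.Injective x) (k : Fin r) :
    ∑ i, m i * -((x k + a i) ^ 2)⁻¹ - ∑ l, optResidue a m x l * -((x k + x l) ^ 2)⁻¹ =
      (bweight x k)⁻¹ * ∑ l, bweight x l / (x k + x l) * residual a m x x l := by
  have hn := isNode_of_pos hx0 hx
  have hax : ∀ i j, a i + x j ≠ 0 := fun i j => (add_pos (ha i) (hx0 j)).ne'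
  have hxa : ∀ j i, x j + a i ≠ 0 := fun j i => (add_pos (hx0 j) (ha i)).ne'
  have hf : HasDerivAt (fun z => ∑ i, m i * (z + a i)⁻¹ - ∑ l, optResidue a m x l * (z + x l)⁻¹)
      (∑ i, m i * -((x k + a i) ^ 2)⁻¹ - ∑ l, optResidue a m x l * -((x k + x l) ^ 2)⁻¹) (x k) :=
    (HasDerivAt.fun_sum fun i _ => (hasDerivAt_inv_add (hxa k i)).const_mul _).sub
      (HasDerivAt.fun_sum fun l _ => (hasDerivAt_inv_add (hn.add_ne k l)).const_mul _)
  have hq : HasDerivAt (fun z => ∑ i, m i * blaschke x (a i) * (z + a i)⁻¹)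
      (∑ i, m i * blaschke x (a i) * -((x k + a i) ^ 2)⁻¹) (x k) :=
    HasDerivAt.fun_sum fun i _ => (hasDerivAt_inv_add (hxa k i)).const_mul _
  have hg := (hn.hasDerivAt_blaschke k).mul hq
  have heq : (fun z => ∑ i, m i * (z + a i)⁻¹ - ∑ l, optResidue a m x l * (z + x l)⁻¹) =ᶠ[𝓝 (x k)]
      (blaschke x * fun z => ∑ i, m i * blaschke x (a i) * (z + a i)⁻¹) := by
    filter_upwards [lt_mem_nhds (hx0 k)] with z hz
    have := hn.interpolation_error (m := m) hax (z := z) (fun i => (add_pos hz (ha i)).ne')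
      fun j => (add_pos hz (hx0 j)).ne'
    simpa only [div_eq_mul_inv, Pi.mul_apply, optResidue] using this
  rw [hf.unique (hg.congr_of_eventuallyEq heq), blaschke_self, zero_mul, add_zero]
  have h := hn.sum_blaschke (m := m) hax (z := x k) (hxa k) (hn.add_ne k)
  rw [blaschke_self, zero_mul, zero_add] at h
  rw [← h]
  simp only [div_eq_mul_inv]

/-- The error contains the factor B, which vanishes at x_k. These are the normal equations of the
least squares problem in the residues, so `errCost` is stationary in the residues at `optResidue`.
-/
lemma interpolation_error_self (ha : ∀ i, 0 < a i) (hx0 : ∀ k, 0 < x k)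
    (hx : Function.Injective x) (k : Fin r) :
    ∑ i, m i / (x k + a i) = ∑ l, optResidue a m x l / (x k + x l) := by
  have hn := isNode_of_pos hx0 hx
  have := hn.interpolation_error (m := m) (fun i j => (add_pos (ha i) (hx0 j)).ne') (z := x k)
    (fun i => (add_pos (hx0 k) (ha i)).ne') (hn.add_ne k)
  rw [blaschke_self, zero_mul, sub_eq_zero] at this
  exact this

/-- The derivative of the reduced cost at `x` in the direction `v`, up to the factor `-2`, as a
function of the residual `q`. -/
noncomputable def slopeForm (a m : Fin n → ℝ) (x v q : Fin r → ℝ) : ℝ :=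
  ∑ k, optResidue a m x k * (bweight x k)⁻¹ * v k * ∑ l, bweight x l / (x k + x l) * q l

lemma differentiableAt_optResidue {γ : ℝ → Fin r → ℝ} {τ : ℝ}
    (hγ : DifferentiableAt ℝ γ τ) (ha : ∀ i, 0 < a i) (hx0 : ∀ k, 0 < γ τ k)
    (hx : Function.Injective (γ τ)) (k : Fin r) :
    DifferentiableAt ℝ (fun τ => optResidue a m (γ τ) k) τ := by
  have hc : ∀ j, DifferentiableAt ℝ (fun τ => γ τ j) τ := fun j => differentiableAt_pi.1 hγ j
  have hn := isNode_of_pos hx0 hx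
  unfold optResidue bweight ritzMoment ratio
  refine DifferentiableAt.mul (DifferentiableAt.inv (DifferentiableAt.div ?_ ?_ ?_) ?_)
    (DifferentiableAt.fun_sum fun i _ => DifferentiableAt.mul (by fun_prop)
      (DifferentiableAt.div ?_ ?_ ?_))
  · exact DifferentiableAt.fun_finsetProd fun j _ => (hc k).sub (hc j)
  · exact DifferentiableAt.fun_finsetProd fun j _ => (hc k).add (hc j)
  · exact prod_ne_zero_iff.2 fun j _ => hn.add_ne k j
  · exact fun h0 => hn.bweight_ne k (inv_eq_zero.2 h0)
  · exact DifferentiableAt.fun_finsetProd fun j _ => (hc j).const_sub _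
  · exact DifferentiableAt.fun_finsetProd fun j _ => (hc j).const_add _
  · exact prod_ne_zero_iff.2 fun j _ => (add_pos (ha i) (hx0 j)).ne'

/-- The derivative of the cost along a curve of interpolation points. -/
lemma hasDerivAt_errCost {γ : ℝ → Fin r → ℝ} {γ' : Fin r → ℝ} {τ : ℝ}
    (hγ : HasDerivAt γ γ' τ) (ha : ∀ i, 0 < a i) (hx0 : ∀ k, 0 < γ τ k)
    (hx : Function.Injective (γ τ)) :
    HasDerivAt (fun τ => errCost a m (optResidue a m (γ τ)) (γ τ))
      (-2 * slopeForm a m (γ τ) γ' (residual a m (γ τ) (γ τ))) τ := by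
  have hn := isNode_of_pos hx0 hx
  have hc : ∀ j, HasDerivAt (fun τ => γ τ j) (γ' j) τ := hasDerivAt_pi.1 hγ
  -- The value of P' is irrelevant: its contribution cancels by the interpolation conditions, as in
  -- the envelope theorem.
  obtain ⟨P', hP⟩ : ∃ P' : Fin r → ℝ, ∀ k, HasDerivAt (fun τ => optResidue a m (γ τ) k) (P' k) τ :=
    ⟨_, fun k => (differentiableAt_optResidue (m := m) hγ.differentiableAt ha hx0 hx k).hasDerivAt⟩
  have hxa : ∀ j i, γ τ j + a i ≠ 0 := fun j i => (add_pos (hx0 j) (ha i)).ne'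
  have h1 : HasDerivAt (fun τ => ∑ k, optResidue a m (γ τ) k * ∑ i, m i / (γ τ k + a i))
      (∑ k, (P' k * ∑ i, m i / (γ τ k + a i) + optResidue a m (γ τ) k *
        ∑ i, m i * (-((γ τ k + a i) ^ 2)⁻¹ * γ' k))) τ := by
    refine HasDerivAt.fun_sum fun k _ => (hP k).mul (HasDerivAt.fun_sum fun i _ => ?_)
    simp_rw [div_eq_mul_inv]
    exact (((hasDerivAt_inv_add (hxa k i)).comp τ (hc k))).const_mul _
  have h2 : HasDerivAt (fun τ => ∑ k, ∑ l, optResidue a m (γ τ) k * optResidue a m (γ τ) l /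
      (γ τ k + γ τ l)) (∑ k, ∑ l, ((P' k * optResidue a m (γ τ) l +
        optResidue a m (γ τ) k * P' l) * (γ τ k + γ τ l)⁻¹ +
        optResidue a m (γ τ) k * optResidue a m (γ τ) l *
          (-(γ' k + γ' l) / (γ τ k + γ τ l) ^ 2))) τ := by
    refine HasDerivAt.fun_sum fun k _ => HasDerivAt.fun_sum fun l _ => ?_
    simp_rw [div_eq_mul_inv]
    exact ((hP k).mul (hP l)).mul (((hc k).add (hc l)).inv (hn.add_ne k l))
  have h := ((h1.const_mul 2).const_sub (∑ i, ∑ j, m i * m j / (a i + a j))).add h2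
  refine h.congr_deriv ?_
  set x := γ τ with hxdef
  set P := optResidue a m x with hPdef
  have hsym : ∑ k, ∑ l, ((P' k * P l + P k * P' l) * (x k + x l)⁻¹ +
        P k * P l * (-(γ' k + γ' l) / (x k + x l) ^ 2)) =
      2 * ∑ k, (P' k * ∑ l, P l / (x k + x l) + P k * γ' k * ∑ l, P l * -((x k + x l) ^ 2)⁻¹) := by
    have e1 : ∑ k, ∑ l, ((P' k * P l + P k * P' l) * (x k + x l)⁻¹ +
        P k * P l * (-(γ' k + γ' l) / (x k + x l) ^ 2)) =
        ∑ k, ∑ l, (P' k * (P l / (x k + x l)) + P k * γ' k * (P l * -((x k + x l) ^ 2)⁻¹)) +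
        ∑ k, ∑ l, (P' l * (P k / (x l + x k)) + P l * γ' l * (P k * -((x l + x k) ^ 2)⁻¹)) := by
      rw [← sum_add_distrib]
      refine sum_congr rfl fun k _ => ?_
      rw [← sum_add_distrib]
      refine sum_congr rfl fun l _ => ?_
      rw [add_comm (x l) (x k)]
      ring
    rw [e1, sum_comm (f := fun k l => P' l * (P k / (x l + x k)) +
      P l * γ' l * (P k * -((x l + x k) ^ 2)⁻¹)), ← two_mul]
    congr 1
    refine sum_congr rfl fun k _ => ?_
    rw [sum_add_distrib, mul_sum, mul_sum]
  rw [hsym, slopeForm, mul_sum, mul_sum, mul_sum, ← sum_neg_distrib, ← sum_add_distrib]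
  refine sum_congr rfl fun k _ => ?_
  have hd := interpolation_error_deriv (m := m) ha hx0 hx k
  have he := interpolation_error_self (m := m) ha hx0 hx k
  rw [← hPdef] at hd he ⊢
  have e2 : ∑ i, m i * (-((x k + a i) ^ 2)⁻¹ * γ' k) =
      γ' k * ∑ i, m i * -((x k + a i) ^ 2)⁻¹ := by
    rw [mul_sum]; exact sum_congr rfl fun i _ => by ring
  rw [he, e2]
  linear_combination (-2 * P k * γ' k) * hd

end Cost

end IRKA

namespace IRKA

open Finset Matrix

/-! ### Positivity of the weights and of the slope form -/

section Critical

variable {n r : ℕ}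

/-- The full model: positive masses at more than `r` distinct positive points. -/
structure IsModel (a m : Fin n → ℝ) (r : ℕ) : Prop where
  a_pos : ∀ i, 0 < a i
  m_pos : ∀ i, 0 < m i
  a_inj : Function.Injective a
  lt : r < n

/-- Distinct positive points. -/
structure IsPoints (x : Fin r → ℝ) : Prop where
  pos : ∀ k, 0 < x k
  inj : Function.Injective x

variable {a m : Fin n → ℝ} {x : Fin r → ℝ}

lemma IsPoints.isNode (hx : IsPoints x) : IsNode x := isNode_of_pos hx.pos hx.inj

lemma IsModel.add_ne (h : IsModel a m r) {t : Fin r → ℝ} (ht : ∀ k, 0 < t k) (i : Fin n)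
    (j : Fin r) : a i + t j ≠ 0 := (add_pos (h.a_pos i) (ht j)).ne'

/-- Pigeonhole: more than r distinct poles cannot all lie among r numbers. This makes the Gram
entries and the error weights strictly positive. -/
lemma IsModel.exists_notMem (h : IsModel a m r) (y : Fin r → ℝ) : ∃ i, ∀ j, a i ≠ y j := by
  by_contra hcon
  push Not at hcon
  choose f hf using hcon
  have hinj : Function.Injective f := fun i j hij => h.a_inj (by rw [hf i, hf j, hij])
  have := Fintype.card_le_of_injective f hinj
  simp only [Fintype.card_fin] at this
  have := h.lt
  omega

lemma IsModel.exists_ratio_ne (h : IsModel a m r) {t : Fin r → ℝ} (ht : ∀ k, 0 < t k)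
    (y : Fin r → ℝ) : ∃ i, ∀ S, ratio t y S (a i) ≠ 0 := by
  obtain ⟨i, hi⟩ := h.exists_notMem y
  exact ⟨i, fun S => div_ne_zero (prod_ne_zero_iff.2 fun j _ => sub_ne_zero.2 (hi j))
    (prod_ne_zero_iff.2 fun j _ => h.add_ne ht i j)⟩

lemma IsModel.gramDiag_pos (h : IsModel a m r) {t : Fin r → ℝ} (ht : ∀ k, 0 < t k)
    (y : Fin r → ℝ) (k : Fin r) : 0 < gramDiag a m t y k := by
  obtain ⟨i, hi⟩ := h.exists_ratio_ne ht y
  refine sum_pos' (fun i _ => mul_nonneg (h.m_pos i).le (sq_nonneg _)) ⟨i, mem_univ i, ?_⟩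
  have := hi (univ.erase k)
  have := h.m_pos i
  positivity

lemma IsModel.errWeight_pos (h : IsModel a m r) {t : Fin r → ℝ} (ht : ∀ k, 0 < t k)
    (y : Fin r → ℝ) (k : Fin r) : 0 < errWeight a m t y k := by
  obtain ⟨i, hi⟩ := h.exists_ratio_ne ht y
  refine sum_pos' (fun i _ => ?_) ⟨i, mem_univ i, ?_⟩
  · have := h.m_pos i
    have := h.a_pos i
    have := ht k
    positivity
  · have := h.m_pos i
    have := h.a_pos i
    have := ht k
    have := hi univ
    positivity

/-- The interpolation property at infinity writes 1 = B + ∑_l `bweight x l` · ratio_l. Paired with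
ratio_k, the term B gives the residual and the terms l ≠ k vanish by orthogonality. -/
lemma IsNode.ritzMoment_eq {K : Type*} [Field K] {a m : Fin n → K} {x : Fin r → K}
    (hx : IsNode x) (hax : ∀ i j, a i + x j ≠ 0) (hres : residual a m x x = 0) (k : Fin r) :
    ritzMoment a m x x k = bweight x k * gramDiag a m x x k := by
  have h1 : ∀ i, m i * ratio x x (univ.erase k) (a i) =
      m i * ((a i - x k) * ratio x x (univ.erase k) (a i) ^ 2) +
      ∑ l, bweight x l * (m i * (ratio x x (univ.erase k) (a i) *
        ratio x x (univ.erase l) (a i))) := fun i => by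
    have h2 := hx.sum_bweight_mul_ratio (hax i)
    rw [blaschke_eq x k] at h2
    have h3 : ∑ l, bweight x l * (m i * (ratio x x (univ.erase k) (a i) *
        ratio x x (univ.erase l) (a i))) = m i * ratio x x (univ.erase k) (a i) *
        ∑ l, bweight x l * ratio x x (univ.erase l) (a i) := by
      rw [mul_sum]; exact sum_congr rfl fun l _ => by ring
    rw [h3, h2]; ring
  have h0 : ∑ i, m i * ((a i - x k) * ratio x x (univ.erase k) (a i) ^ 2) = 0 := congrFun hres k
  rw [ritzMoment, sum_congr rfl fun i _ => h1 i, sum_add_distrib, h0, zero_add, sum_comm,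
    sum_eq_single k]
  · rw [← mul_sum, ← gramOff_self, gramOff]
  · intro l _ hl
    have := gramOff_eq_zero hx.inj hres (Ne.symm hl)
    rw [gramOff] at this
    rw [← mul_sum, this, mul_zero]
  · simp

/-- At a zero of the residual the optimal residues are positive. -/
lemma optResidue_eq (h : IsModel a m r) (hx : IsPoints x) (hres : residual a m x x = 0)
    (k : Fin r) : optResidue a m x k = bweight x k ^ 2 * gramDiag a m x x k := by
  rw [optResidue, hx.isNode.ritzMoment_eq (h.add_ne hx.pos) hres]
  ring

/-- The Cauchy matrix is positive definite. -/
lemma IsPoints.cauchy_form_pos (hx : IsPoints x) {η : Fin r → ℝ} (hη : η ≠ 0) :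
    0 < ∑ i, ∑ j, η i * η j / (x i + x j) := by
  have hH : (cauchy x).IsHermitian := by
    ext i j; simp [cauchy, add_comm]
  have he : ∀ η : Fin r → ℝ, star η ⬝ᵥ (cauchy x *ᵥ η) = ∑ i, ∑ j, η i * η j / (x i + x j) :=
    fun η => by
    simp only [dotProduct, mulVec, cauchy, of_apply, star_trivial, mul_sum]
    exact sum_congr rfl fun i _ => sum_congr rfl fun j _ => by ring
  -- The form is a squared H₂ norm, hence nonnegative; invertibility of the Cauchy matrix makes it
  -- definite.
  have hpsd : (cauchy x).PosSemidef := PosSemidef.of_dotProduct_mulVec_nonneg hH fun η => by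
    rw [he]; exact cauchy_form_nonneg η x hx.pos
  have hpd := hpsd.posDef_iff_isUnit.2 hx.isNode.isUnit_cauchy
  have := hpd.dotProduct_mulVec_pos hη
  rwa [he] at this

/-- The slope in a positive direction that the residual points to is positive. -/
lemma slopeForm_pos (h : IsModel a m r) (hx : IsPoints x) (hres : residual a m x x = 0)
    {w : Fin r → ℝ} (hw : w ≠ 0) :
    0 < slopeForm a m x w (fun k => gramDiag a m x x k * w k) := by
  have e : slopeForm a m x w (fun k => gramDiag a m x x k * w k) =
      ∑ k, ∑ l, (bweight x k * gramDiag a m x x k * w k) *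
        (bweight x l * gramDiag a m x x l * w l) / (x k + x l) := by
    refine sum_congr rfl fun k _ => ?_
    rw [mul_sum]
    refine sum_congr rfl fun l _ => ?_
    rw [optResidue_eq h hx hres]
    have := hx.isNode.bweight_ne k
    field_simp
  rw [e]
  refine hx.cauchy_form_pos (η := fun k => bweight x k * gramDiag a m x x k * w k) fun h0 => hw ?_
  funext k
  have := congrFun h0 k
  simpa [hx.isNode.bweight_ne k, (h.gramDiag_pos hx.pos x k).ne'] using this

end Critical

/-! ### The second-order condition bounds the eigenvalues -/

section SecondOrder

/-- The second-order necessary condition. -/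
lemma nonneg_of_isLocalMin {f f' : ℝ → ℝ} {A : ℝ} (hf : ∀ᶠ τ in 𝓝 0, HasDerivAt f (f' τ) τ)
    (hf' : HasDerivAt f' A 0) (h0 : f' 0 = 0) (hmin : IsLocalMin f 0) : 0 ≤ A := by
  by_contra hA
  push Not at hA
  have hd : deriv f =ᶠ[𝓝 0] f' := hf.mono fun τ hτ => hτ.deriv
  have hd2 : deriv (deriv f) 0 = A := by rw [hd.deriv_eq, hf'.deriv]
  -- If the second derivative were negative, 0 would be a local maximum as well as a local minimum;
  -- then f is locally constant and the second derivative is 0.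
  have hmax := isLocalMax_of_deriv_deriv_neg (f := f) (x₀ := 0) (by rw [hd2]; exact hA)
    (by rw [hd.self_of_nhds, h0]) hf.self_of_nhds.continuousAt
  have hconst : f =ᶠ[𝓝 0] fun _ => f 0 := by
    filter_upwards [hmin, hmax] with τ h1 h2 using le_antisymm h2 h1
  have : deriv (deriv f) 0 = 0 := by
    have h1 : deriv f =ᶠ[𝓝 0] fun _ => 0 := by
      have := hconst.deriv
      simpa using this
    rw [h1.deriv_eq]; simp
  linarith

variable {n r : ℕ} {a m : Fin n → ℝ} {x : Fin r → ℝ}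

lemma IsPoints.eventually (hx : IsPoints x) : ∀ᶠ y in 𝓝 x, IsPoints y := by
  have h1 : ∀ᶠ y in 𝓝 x, ∀ k, 0 < y k := eventually_all.2 fun k =>
    (continuous_apply k).continuousAt.eventually (lt_mem_nhds (hx.pos k))
  have h2 : ∀ᶠ y in 𝓝 x, ∀ k l, k ≠ l → y k ≠ y l := by
    refine eventually_all.2 fun k => eventually_all.2 fun l => ?_
    by_cases hkl : k = l
    · simp [hkl]
    · have hc : ContinuousAt (fun y : Fin r → ℝ => y k - y l) x := by fun_prop
      filter_upwards [hc.eventually_ne (sub_ne_zero.2 (hx.inj.ne hkl))] with y hy _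
      exact sub_ne_zero.1 hy
  filter_upwards [h1, h2] with y hy1 hy2
  exact ⟨hy1, fun k l hkl => by_contra fun hne => hy2 k l hne hkl⟩

/-- The reduced cost. -/
noncomputable def redCost (a m : Fin n → ℝ) (y : Fin r → ℝ) : ℝ :=
  errCost a m (optResidue a m y) y

lemma hasDerivAt_line (x w : Fin r → ℝ) (τ : ℝ) :
    HasDerivAt (fun τ : ℝ => x + τ • w) w τ := by
  simpa using ((hasDerivAt_id τ).smul_const w).const_add x

lemma differentiableAt_bweight {γ : ℝ → Fin r → ℝ} {τ : ℝ}
    (hγ : DifferentiableAt ℝ γ τ) (hx : IsPoints (γ τ)) (k : Fin r) :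
    DifferentiableAt ℝ (fun τ => bweight (γ τ) k) τ := by
  have hc : ∀ j, DifferentiableAt ℝ (fun τ => γ τ j) τ := fun j => differentiableAt_pi.1 hγ j
  unfold bweight ratio
  refine DifferentiableAt.inv (DifferentiableAt.div ?_ ?_ ?_) ?_
  · exact DifferentiableAt.fun_finsetProd fun j _ => (hc k).sub (hc j)
  · exact DifferentiableAt.fun_finsetProd fun j _ => (hc k).add (hc j)
  · exact prod_ne_zero_iff.2 fun j _ => hx.isNode.add_ne k j
  · exact fun h0 => hx.isNode.bweight_ne k (inv_eq_zero.2 h0)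

/-- The growth of the cost along the direction of a positive eigenvector bounds the eigenvalue. -/
lemma eigenvalue_bound (h : IsModel a m r) (hx : IsPoints x) (hres : residual a m x x = 0)
    {w : Fin r → ℝ} {ρ : ℝ} (hρ : jac a m x *ᵥ w = ρ • w) {κ : ℝ}
    (hgrow : ∀ᶠ τ : ℝ in 𝓝 0, redCost a m x + κ * ‖τ • w‖ ^ 2 ≤ redCost a m (x + τ • w)) :
    κ * ‖w‖ ^ 2 ≤
      (1 - ρ) * slopeForm a m x w (fun k => gramDiag a m x x k * w k) := by
  set d := gramDiag a m x x with hd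
  have hd0 : ∀ k, 0 < d k := h.gramDiag_pos hx.pos x
  set γ : ℝ → Fin r → ℝ := fun τ => x + τ • w with hγ
  have hγ0 : γ 0 = x := by simp [hγ]
  have hγd : ∀ τ, HasDerivAt γ w τ := hasDerivAt_line x w
  have hpts : ∀ᶠ τ in 𝓝 (0 : ℝ), IsPoints (γ τ) := by
    have : Tendsto γ (𝓝 0) (𝓝 x) := by
      have := (hγd 0).continuousAt.tendsto
      rwa [hγ0] at this
    exact this.eventually hx.eventually
  have hderiv : ∀ᶠ τ in 𝓝 (0 : ℝ), HasDerivAt (fun τ => redCost a m (γ τ))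
      (-2 * slopeForm a m (γ τ) w (residual a m (γ τ) (γ τ))) τ := by
    filter_upwards [hpts] with τ hτ
    exact hasDerivAt_errCost (hγd τ) h.a_pos hτ.pos hτ.inj
  -- On the diagonal t = y the residual has derivative `gramDiag` · (J - 1); on the eigenvector w
  -- this is (ρ - 1) d w.
  have hresd : ∀ l, HasDerivAt (fun τ => residual a m (γ τ) (γ τ) l) ((ρ - 1) * (d l * w l)) 0 :=
    fun l => by
    refine (hasDerivAt_residual_line (h.add_ne hx.pos) hx.isNode.add_ne hx.inj hres w w
      l).congr_deriv ?_
    have := congrFun hρ l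
    simp only [mulVec, dotProduct, jac, of_apply, Pi.smul_apply, smul_eq_mul] at this
    have h2 : ∑ j, 2 * errWeight a m x x j / (x l + x j) * w j = d l * (ρ * w l) := by
      rw [← this, mul_sum]
      refine sum_congr rfl fun j _ => ?_
      have := (hd0 l).ne'
      rw [← hd]
      field_simp
    rw [h2]; ring
  have hsecond : HasDerivAt
      (fun τ => slopeForm a m (γ τ) w (residual a m (γ τ) (γ τ)))
      (slopeForm a m x w (fun l => (ρ - 1) * (d l * w l))) 0 := by
    have hx' : IsPoints (γ 0) := by rw [hγ0]; exact hx
    have hD : DifferentiableAt ℝ γ 0 := (hγd 0).differentiableAt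
    refine HasDerivAt.fun_sum fun k _ => ?_
    have h1 : HasDerivAt (fun τ => ∑ l, bweight (γ τ) l / (γ τ k + γ τ l) *
        residual a m (γ τ) (γ τ) l)
        (∑ l, bweight x l / (x k + x l) * ((ρ - 1) * (d l * w l))) 0 := by
      refine HasDerivAt.fun_sum fun l _ => ?_
      have hc : DifferentiableAt ℝ (fun τ => bweight (γ τ) l / (γ τ k + γ τ l)) 0 :=
        (differentiableAt_bweight hD hx' l).div
          ((differentiableAt_pi.1 hD k).add (differentiableAt_pi.1 hD l)) (hx'.isNode.add_ne k l)
      refine (hc.hasDerivAt.mul (hresd l)).congr_deriv ?_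
      rw [hγ0, hres]
      simp
    have hc : DifferentiableAt ℝ (fun τ => optResidue a m (γ τ) k * (bweight (γ τ) k)⁻¹ * w k) 0 :=
      ((differentiableAt_optResidue hD h.a_pos hx'.pos hx'.inj k).mul
        ((differentiableAt_bweight hD hx' k).inv (hx'.isNode.bweight_ne k))).mul_const _
    refine (hc.hasDerivAt.mul h1).congr_deriv ?_
    rw [hγ0, hres]
    simp
  have hscale : slopeForm a m x w (fun l => (ρ - 1) * (d l * w l)) =
      (ρ - 1) * slopeForm a m x w (fun l => d l * w l) := by
    simp only [slopeForm, mul_sum]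
    exact sum_congr rfl fun k _ => sum_congr rfl fun l _ => by ring
  -- Subtracting κ ‖w‖² τ² from the error along the line leaves a function with a local minimum at
  -- 0. In its second derivative the coefficients of the slope form need not be differentiated,
  -- since the residual vanishes at x.
  have hfin := nonneg_of_isLocalMin
    (f := fun τ => redCost a m (γ τ) - κ * ‖w‖ ^ 2 * τ ^ 2)
    (f' := fun τ => -2 * slopeForm a m (γ τ) w (residual a m (γ τ) (γ τ)) - κ * ‖w‖ ^ 2 * (2 * τ))
    (A := -2 * slopeForm a m x w (fun l => (ρ - 1) * (d l * w l)) - κ * ‖w‖ ^ 2 * 2)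
    (by
      filter_upwards [hderiv] with τ hτ
      have : HasDerivAt (fun τ : ℝ => κ * ‖w‖ ^ 2 * τ ^ 2) (κ * ‖w‖ ^ 2 * (2 * τ)) τ := by
        simpa using (hasDerivAt_pow 2 τ).const_mul (κ * ‖w‖ ^ 2)
      exact hτ.sub this)
    (by
      have : HasDerivAt (fun τ : ℝ => κ * ‖w‖ ^ 2 * (2 * τ)) (κ * ‖w‖ ^ 2 * 2) 0 := by
        simpa using ((hasDerivAt_id (0 : ℝ)).const_mul 2).const_mul (κ * ‖w‖ ^ 2)
      exact (hsecond.const_mul (-2)).sub this)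
    (by
      simp only [hγ0, hres]
      simp [slopeForm])
    (by
      filter_upwards [hgrow] with τ hτ
      rw [norm_smul, mul_pow, Real.norm_eq_abs, sq_abs] at hτ
      simp only [hγ0]
      change _ ≤ redCost a m (x + τ • w) - _
      linarith)
  rw [hscale] at hfin
  linarith

end SecondOrder

/-! ### The Perron eigenvector of the Jacobian -/

section Perron

variable {r : ℕ}

/-- A symmetric matrix with positive entries has a positive eigenvector. -/
lemma exists_pos_eigenvector_symm (hr : 0 < r) {N : Matrix (Fin r) (Fin r) ℝ}
    (hsymm : Nᵀ = N) (hpos : ∀ k l, 0 < N k l) :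
    ∃ (ρ : ℝ) (w : Fin r → ℝ), 0 < ρ ∧ (∀ k, 0 < w k) ∧ N *ᵥ w = ρ • w := by
  set E := EuclideanSpace ℝ (Fin r)
  set T : E →L[ℝ] E := toEuclideanCLM (𝕜 := ℝ) N with hT
  have hsa : IsSelfAdjoint T := by
    have : IsSelfAdjoint N := by
      rw [IsSelfAdjoint, star_eq_conjTranspose, conjTranspose_eq_transpose_of_trivial, hsymm]
    exact this.map (toEuclideanCLM (n := Fin r) (𝕜 := ℝ))
  have hval : ∀ v : E, T.reApplyInnerSelf v = ∑ k, ∑ l, N k l * (v k * v l) := fun v => by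
    rw [ContinuousLinearMap.reApplyInnerSelf_apply, real_inner_comm, inner_toEuclideanCLM]
    simp only [dotProduct, mulVec, mul_sum, RCLike.re_to_real]
    exact sum_congr rfl fun k _ => sum_congr rfl fun l _ => by ring
  have : Nonempty (Fin r) := ⟨⟨0, hr⟩⟩
  obtain ⟨x₀, hx₀⟩ : ∃ x : E, x ≠ 0 := exists_ne 0
  obtain ⟨u, hu, hmax⟩ := (isCompact_sphere (0 : E) ‖x₀‖).exists_isMaxOn ⟨x₀, by simp⟩
    T.reApplyInnerSelf_continuous.continuousOn
  have hunorm : ‖u‖ = ‖x₀‖ := by simpa using hu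
  -- Taking absolute values keeps the norm and does not decrease a quadratic form with positive
  -- entries, so v is a nonnegative maximiser on the sphere and hence an eigenvector. Applying N
  -- once makes it strictly positive.
  set v : E := WithLp.toLp 2 fun k => |u k| with hv
  have hvk : ∀ k, v k = |u k| := fun k => rfl
  have hvnorm : ‖v‖ = ‖x₀‖ := by
    rw [← hunorm, EuclideanSpace.norm_eq, EuclideanSpace.norm_eq]
    congr 1
    exact sum_congr rfl fun k _ => by rw [hvk, Real.norm_eq_abs, abs_abs, Real.norm_eq_abs]
  have hle : T.reApplyInnerSelf u ≤ T.reApplyInnerSelf v := by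
    rw [hval, hval]
    refine sum_le_sum fun k _ => sum_le_sum fun l _ => mul_le_mul_of_nonneg_left ?_ (hpos k l).le
    rw [hvk, hvk, ← abs_mul]
    exact le_abs_self _
  have hvmax : IsMaxOn T.reApplyInnerSelf (Metric.sphere (0 : E) ‖v‖) v := fun z hz => by
    rw [hvnorm] at hz
    exact (hmax hz).trans hle
  have heig := hsa.eq_smul_self_of_isLocalExtrOn (x₀ := v) (Or.inr hvmax.localize)
  set ρ : ℝ := T.rayleighQuotient v with hρ
  have hNv : ∀ k, ∑ l, N k l * v l = ρ * v k := fun k => by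
    exact congrArg (fun q : E => q k) heig
  have hv0 : v ≠ 0 := by
    rw [← norm_pos_iff, hvnorm]; exact norm_pos_iff.2 hx₀
  obtain ⟨k₀, hk₀⟩ : ∃ k, v k ≠ 0 := by
    by_contra hcon
    push Not at hcon
    exact hv0 (by ext k; simpa using hcon k)
  have hvnn : ∀ k, 0 ≤ v k := fun k => by rw [hvk]; exact abs_nonneg _
  have hvk₀ : 0 < v k₀ := lt_of_le_of_ne (hvnn k₀) (Ne.symm hk₀)
  have hsum : ∀ k, 0 < ∑ l, N k l * v l := fun k =>
    sum_pos' (fun l _ => mul_nonneg (hpos k l).le (hvnn l))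
      ⟨k₀, mem_univ _, mul_pos (hpos k k₀) hvk₀⟩
  have hρ0 : 0 < ρ := by
    have := hsum k₀
    rw [hNv] at this
    exact pos_of_mul_pos_left this hvk₀.le
  refine ⟨ρ, fun k => v k, hρ0, fun k => ?_, funext fun k => hNv k⟩
  have := hsum k
  rw [hNv] at this
  exact pos_of_mul_pos_right this hρ0.le

variable {n : ℕ} {a m : Fin n → ℝ} {x : Fin r → ℝ}

lemma jac_pos (h : IsModel a m r) (hx : IsPoints x) (k l : Fin r) : 0 < jac a m x k l := by
  have h1 := h.errWeight_pos hx.pos x l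
  have h2 := h.gramDiag_pos hx.pos x k
  have h3 := hx.pos k
  have h4 := hx.pos l
  simp only [jac, of_apply]
  positivity

/-- The Jacobian has a positive eigenvector. -/
lemma exists_pos_eigenvector (hr : 0 < r) (h : IsModel a m r) (hx : IsPoints x) :
    ∃ (ρ : ℝ) (w : Fin r → ℝ), 0 < ρ ∧ (∀ k, 0 < w k) ∧ jac a m x *ᵥ w = ρ • w := by
  set d := gramDiag a m x x with hd
  set e := errWeight a m x x with he
  have hd0 : ∀ k, 0 < d k := h.gramDiag_pos hx.pos x
  have he0 : ∀ k, 0 < e k := h.errWeight_pos hx.pos x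
  -- Chosen so that conjugation by diag(d_k p_k) turns the Jacobian into the symmetric matrix p_k
  -- p_l / (x_k + x_l).
  set p : Fin r → ℝ := fun k => Real.sqrt (2 * e k / d k) with hp
  have hp0 : ∀ k, 0 < p k := fun k => Real.sqrt_pos.2 (by have := hd0 k; have := he0 k; positivity)
  have hp2 : ∀ k, p k * p k * d k = 2 * e k := fun k => by
    have := hd0 k; have := he0 k
    rw [hp, Real.mul_self_sqrt (by positivity)]
    field_simp
  obtain ⟨ρ, w, hρ, hw, heig⟩ := exists_pos_eigenvector_symm hr
    (N := Matrix.of fun k l => p k * p l / (x k + x l))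
    (by ext k l; simp [add_comm, mul_comm])
    (fun k l => by
      have := hp0 k; have := hp0 l; have := hx.pos k; have := hx.pos l
      simp only [of_apply]; positivity)
  refine ⟨ρ, fun k => w k / (d k * p k), hρ, fun k => div_pos (hw k) (mul_pos (hd0 k) (hp0 k)), ?_⟩
  funext k
  have h1 := congrFun heig k
  simp only [mulVec, dotProduct, jac, of_apply, Pi.smul_apply, smul_eq_mul] at h1 ⊢
  have h2 : ρ * (w k / (d k * p k)) = (∑ l, p k * p l / (x k + x l) * w l) / (d k * p k) := by
    rw [h1]; ring
  rw [h2, sum_div]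
  refine sum_congr rfl fun l _ => ?_
  rw [← hd, ← he, ← hp2 l]
  have := (hp0 k).ne'
  have := (hp0 l).ne'
  have := (hd0 k).ne'
  have := (hd0 l).ne'
  have := hx.isNode.add_ne k l
  field_simp

end Perron

end IRKA

namespace IRKA

open Finset Matrix

/-! ### Lyapunov–Schmidt reduction along the Perron direction -/

section Curve

variable {n r : ℕ} {a m : Fin n → ℝ} {x : Fin r → ℝ}

/-- The matrix e_k d_k J_kl = 2 e_k e_l / (x_k + x_l) is symmetric, with error weights e and Gram
entries d. Thus e d w is a left eigenvector whenever w is a right one. -/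
lemma sum_jac_mulVec (h : IsModel a m r) (hx : IsPoints x) {w : Fin r → ℝ} {ρ : ℝ}
    (hρ : jac a m x *ᵥ w = ρ • w) (v : Fin r → ℝ) :
    ∑ k, errWeight a m x x k * gramDiag a m x x k * w k * (jac a m x *ᵥ v) k =
      ρ * ∑ k, errWeight a m x x k * gramDiag a m x x k * w k * v k := by
  have hd := fun k => (h.gramDiag_pos hx.pos x k).ne'
  have h1 : ∀ l, errWeight a m x x l * gramDiag a m x x l * v l * (jac a m x *ᵥ w) l =
      ρ * (errWeight a m x x l * gramDiag a m x x l * w l * v l) := fun l => by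
    rw [hρ, Pi.smul_apply, smul_eq_mul]; ring
  rw [mul_sum, ← sum_congr rfl fun l _ => h1 l]
  simp only [mulVec, dotProduct, mul_sum, jac, of_apply]
  rw [sum_comm]
  refine sum_congr rfl fun l _ => sum_congr rfl fun k _ => ?_
  have := hd k
  have := hd l
  rw [add_comm (x k) (x l)]
  field_simp

/-- A solution of `J v = v` that is orthogonal to the left eigenvector vanishes. -/
lemma eq_zero_of_jac_mulVec (h : IsModel a m r) (hx : IsPoints x) {w : Fin r → ℝ}
    (hw : ∀ k, 0 < w k) {ρ : ℝ} (hρ : jac a m x *ᵥ w = ρ • w) (hρ1 : ρ ≤ 1) {v : Fin r → ℝ}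
    (hv : jac a m x *ᵥ v = v) {c : Fin r → ℝ} (hc : ∀ k, 0 < c k) (hcv : ∑ k, c k * v k = 0) :
    v = 0 := by
  rcases Nat.eq_zero_or_pos r with rfl | hr
  · exact Subsingleton.elim _ _
  have : Nonempty (Fin r) := ⟨⟨0, hr⟩⟩
  obtain ⟨k₀, hk₀⟩ := Finite.exists_min fun k => v k / w k
  -- The largest t with t w ≤ v. Since v is orthogonal to the positive vector c, it satisfies t ≤ 0,
  -- and u = v - t w ≥ 0 vanishes at k₀.
  set t := v k₀ / w k₀ with ht
  have hvw : ∀ k, t * w k ≤ v k := fun k => by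
    have := hk₀ k
    rwa [le_div_iff₀ (hw k)] at this
  have hcw : 0 < ∑ k, c k * w k := sum_pos (fun k _ => mul_pos (hc k) (hw k)) univ_nonempty
  have ht0 : t ≤ 0 := by
    have h1 : t * ∑ k, c k * w k ≤ ∑ k, c k * v k := by
      rw [mul_sum]
      refine sum_le_sum fun k _ => ?_
      have := mul_le_mul_of_nonneg_left (hvw k) (hc k).le
      linarith
    rw [hcv] at h1
    by_contra hcon
    push Not at hcon
    have := mul_pos hcon hcw
    linarith
  set u : Fin r → ℝ := v - t • w with hu
  have hu0 : ∀ k, 0 ≤ u k := fun k => by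
    have := hvw k
    simp only [hu, Pi.sub_apply, Pi.smul_apply, smul_eq_mul]
    linarith
  have huk₀ : u k₀ = 0 := by
    simp only [hu, Pi.sub_apply, Pi.smul_apply, smul_eq_mul, ht]
    have := (hw k₀).ne'
    field_simp
    ring
  -- From J u = u + t (1 - ρ) w the entry at k₀ is ≤ 0, while a matrix with positive entries makes
  -- it positive unless u = 0. So v = t w, and orthogonality to c gives t = 0.
  have hJu : (jac a m x *ᵥ u) k₀ = t * (1 - ρ) * w k₀ := by
    have : jac a m x *ᵥ u = u + (t * (1 - ρ)) • w := by
      rw [hu, mulVec_sub, mulVec_smul, hv, hρ]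
      module
    rw [this, Pi.add_apply, huk₀, zero_add, Pi.smul_apply, smul_eq_mul]
  have hle : (jac a m x *ᵥ u) k₀ ≤ 0 := by
    rw [hJu]
    exact mul_nonpos_of_nonpos_of_nonneg
      (mul_nonpos_of_nonpos_of_nonneg ht0 (by linarith)) (hw k₀).le
  have hterm : ∀ l, u l = 0 := fun l => by
    have hs : (jac a m x *ᵥ u) k₀ = ∑ l, jac a m x k₀ l * u l := rfl
    have hnn : ∀ l ∈ univ, 0 ≤ jac a m x k₀ l * u l := fun l _ =>
      mul_nonneg (jac_pos h hx k₀ l).le (hu0 l)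
    have hz : ∑ l, jac a m x k₀ l * u l = 0 := le_antisymm (hs ▸ hle) (sum_nonneg hnn)
    have := (sum_eq_zero_iff_of_nonneg hnn).1 hz l (mem_univ l)
    exact (mul_eq_zero.1 this).resolve_left (jac_pos h hx k₀ l).ne'
  have hveq : ∀ k, v k = t * w k := fun k => by
    have := hterm k
    simp only [hu, Pi.sub_apply, Pi.smul_apply, smul_eq_mul] at this
    linarith
  have ht' : t = 0 := by
    have : t * ∑ k, c k * w k = 0 := by
      rw [← hcv, mul_sum]
      exact sum_congr rfl fun k _ => by rw [hveq]; ring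
    exact (mul_eq_zero.1 this).resolve_right hcw.ne'
  funext k
  rw [hveq, ht', zero_mul]
  rfl

/-- An analytic curve through `x` along which the residual stays proportional to a fixed positive
vector, and which contains all zeros of the residual near `x`. -/
structure IsCurve (a m : Fin n → ℝ) (x w : Fin r → ℝ) (γ : ℝ → Fin r → ℝ) (η : ℝ → ℝ) :
    Prop where
  zero : γ 0 = x
  analytic_γ : AnalyticAt ℝ γ 0
  analytic_η : AnalyticAt ℝ η 0
  deriv_zero : deriv γ 0 = w
  residual_eq : ∀ᶠ τ in 𝓝 0, residual a m (γ τ) (γ τ) = η τ • fun k => gramDiag a m x x k * w k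
  uniq : ∃ ℓ : (Fin r → ℝ) → ℝ, Tendsto ℓ (𝓝 x) (𝓝 0) ∧
    ∀ᶠ y in 𝓝 x, residual a m y y = 0 → γ (ℓ y) = y ∧ η (ℓ y) = 0

lemma contDiffAt_residual_diag (h : IsModel a m r) (hx : IsPoints x) :
    ContDiffAt ℝ ⊤ (fun y => residual a m y y) x :=
  ContDiffAt.comp (f := fun y => (y, y)) (g := fun p => residual a m p.1 p.2) x
    (contDiffAt_residual a m (p := (x, x)) (h.add_ne hx.pos)) (contDiffAt_id.prodMk contDiffAt_id)

/-- The derivative of the diagonal residual at one of its zeros. -/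
lemma exists_hasFDerivAt_residual_diag (h : IsModel a m r) (hx : IsPoints x)
    (hres : residual a m x x = 0) :
    ∃ D : (Fin r → ℝ) →L[ℝ] (Fin r → ℝ), HasFDerivAt (fun y => residual a m y y) D x ∧
      ∀ v k, D v k = gramDiag a m x x k * ((jac a m x *ᵥ v) k - v k) := by
  obtain ⟨f', hf', hval⟩ :=
    exists_hasStrictFDerivAt_residual (h.add_ne hx.pos) hx.isNode.add_ne hx.inj hres
  have hc : HasFDerivAt (fun y => residual a m y y)
      (f'.comp ((ContinuousLinearMap.id ℝ (Fin r → ℝ)).prod (.id ℝ (Fin r → ℝ)))) x :=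
    HasFDerivAt.comp (f := fun y => (y, y)) (g := fun p => residual a m p.1 p.2) x
      hf'.hasFDerivAt ((hasFDerivAt_id x).prodMk (hasFDerivAt_id x))
  refine ⟨_, hc, fun v k => ?_⟩
  have : (f'.comp ((ContinuousLinearMap.id ℝ (Fin r → ℝ)).prod (.id ℝ (Fin r → ℝ)))) v k =
      f' (v, v) k := rfl
  rw [this, hval, mul_sub]
  simp only [mulVec, dotProduct, jac, of_apply, mul_sum]
  have hd := (h.gramDiag_pos hx.pos x k).ne'
  have e : ∑ l, gramDiag a m x x k * (2 * errWeight a m x x l / (x k + x l) /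
      gramDiag a m x x k * v l) = ∑ l, 2 * errWeight a m x x l / (x k + x l) * v l :=
    sum_congr rfl fun l _ => by field_simp
  rw [e]
  ring

/-- The inverse function theorem is applied to (y, ε) ↦ (residual(y, y) - ε d w, λ(y - x)). The
extra unknown ε and the functional λ remove the possible kernel and cokernel of the linearisation d
(J - 1) when ρ = 1, and do no harm when ρ < 1. -/
lemma exists_isCurve (hr : 0 < r) (h : IsModel a m r) (hx : IsPoints x)
    (hres : residual a m x x = 0) {w : Fin r → ℝ} (hw : ∀ k, 0 < w k) {ρ : ℝ}
    (hρ : jac a m x *ᵥ w = ρ • w) (hρ1 : ρ ≤ 1) :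
    ∃ γ η, IsCurve a m x w γ η := by
  have : Nonempty (Fin r) := ⟨⟨0, hr⟩⟩
  obtain ⟨D, hD, hval⟩ := exists_hasFDerivAt_residual_diag h hx hres
  set d := gramDiag a m x x with hd
  have hd0 : ∀ k, 0 < d k := h.gramDiag_pos hx.pos x
  set q : Fin r → ℝ := fun k => d k * w k with hq
  -- A left eigenvector of the Jacobian; λ is pairing with it, normalised by λ(w) = 1.
  set c : Fin r → ℝ := fun k => errWeight a m x x k * d k * w k with hc
  have hc0 : ∀ k, 0 < c k := fun k => mul_pos (mul_pos (h.errWeight_pos hx.pos x k) (hd0 k)) (hw k)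
  set S : ℝ := ∑ k, c k * w k with hS
  have hS0 : 0 < S := sum_pos (fun k _ => mul_pos (hc0 k) (hw k)) univ_nonempty
  set lam : (Fin r → ℝ) →L[ℝ] ℝ :=
    S⁻¹ • ∑ k, c k • ContinuousLinearMap.proj (R := ℝ) (φ := fun _ : Fin r => ℝ) k with hlam
  have hlamv : ∀ v, lam v = S⁻¹ * ∑ k, c k * v k := fun v => by
    simp [hlam]
  have hlamw : lam w = 1 := by rw [hlamv]; exact inv_mul_cancel₀ hS0.ne'
  set Ξ : (Fin r → ℝ) × ℝ → (Fin r → ℝ) × ℝ :=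
    fun p => (residual a m p.1 p.1 - p.2 • q, lam (p.1 - x)) with hΞ
  set L : (Fin r → ℝ) × ℝ →L[ℝ] (Fin r → ℝ) × ℝ :=
    ((D.comp (.fst ℝ (Fin r → ℝ) ℝ)) - (ContinuousLinearMap.snd ℝ (Fin r → ℝ) ℝ).smulRight q).prod
      (lam.comp (.fst ℝ (Fin r → ℝ) ℝ)) with hL
  have hLv : ∀ v ε, L (v, ε) = (D v - ε • q, lam v) := fun v ε => rfl
  have hinj : Function.Injective L := by
    refine (injective_iff_map_eq_zero _).2 fun p hp => ?_
    obtain ⟨v, ε⟩ := p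
    rw [hLv, Prod.mk_eq_zero] at hp
    obtain ⟨h1, h2⟩ := hp
    have hJ : ∀ k, (jac a m x *ᵥ v) k = v k + ε * w k := fun k => by
      have := congrFun h1 k
      simp only [Pi.sub_apply, hval, Pi.smul_apply, smul_eq_mul, hq, Pi.zero_apply] at this
      have h3 : d k * ((jac a m x *ᵥ v) k - v k - ε * w k) = 0 := by
        linear_combination this
      have := (mul_eq_zero.1 h3).resolve_left (hd0 k).ne'
      linarith
    have hcv : ∑ k, c k * v k = 0 := by
      rw [hlamv] at h2
      exact (mul_eq_zero.1 h2).resolve_left (inv_ne_zero hS0.ne')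
    -- Pairing J v = v + ε w with the left eigenvector gives ε S = ρ λ-part of v = 0, with S > 0.
    have hε : ε = 0 := by
      have h4 := sum_jac_mulVec h hx hρ v
      have h5 : ∑ k, c k * (jac a m x *ᵥ v) k = ε * S := by
        simp_rw [hJ, mul_add, sum_add_distrib, hcv, zero_add, hS, mul_sum]
        exact sum_congr rfl fun k _ => by ring
      have h6 : ε * S = ρ * ∑ k, c k * v k := by rw [← h5]; exact h4
      rw [hcv, mul_zero] at h6
      exact (mul_eq_zero.1 h6).resolve_right hS0.ne'
    have hv : v = 0 := eq_zero_of_jac_mulVec h hx hw hρ hρ1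
      (funext fun k => by rw [hJ, hε]; ring) hc0 hcv
    rw [hv, hε]; rfl
  set e : ((Fin r → ℝ) × ℝ) ≃L[ℝ] (Fin r → ℝ) × ℝ :=
    (LinearEquiv.ofInjectiveEndo L.toLinearMap hinj).toContinuousLinearEquiv with he
  have heL : (e : (Fin r → ℝ) × ℝ →L[ℝ] (Fin r → ℝ) × ℝ) = L := by
    ext <;> rfl
  have hcd : ContDiffAt ℝ ⊤ Ξ (x, 0) := by
    refine ContDiffAt.prodMk (ContDiffAt.sub ?_ ?_) ?_
    · exact (contDiffAt_residual_diag h hx).comp (x, (0 : ℝ)) contDiffAt_fst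
    · exact contDiffAt_snd.smul contDiffAt_const
    · exact lam.contDiff.contDiffAt.comp (x, (0 : ℝ)) (contDiffAt_fst.sub contDiffAt_const)
  have hfd : HasFDerivAt Ξ (e : (Fin r → ℝ) × ℝ →L[ℝ] (Fin r → ℝ) × ℝ) (x, 0) := by
    rw [heL]
    refine HasFDerivAt.prodMk (HasFDerivAt.sub ?_ ?_) ?_
    · exact HasFDerivAt.comp (x, (0 : ℝ)) (g := fun y => residual a m y y) hD hasFDerivAt_fst
    · exact (ContinuousLinearMap.snd ℝ (Fin r → ℝ) ℝ).hasFDerivAt.smul_const q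
    · exact lam.hasFDerivAt.comp (x, (0 : ℝ)) (hasFDerivAt_fst.sub_const x)
  have hst := hcd.hasStrictFDerivAt' hfd (by simp)
  have hΞ0 : Ξ (x, 0) = (0, 0) := by simp [hΞ, hres]
  set Λ := hcd.localInverse hfd (by simp) with hΛ
  have hΛc : ContDiffAt ℝ ⊤ Λ (0, 0) := hΞ0 ▸ hcd.to_localInverse hfd (by simp)
  have hΛ0 : Λ (0, 0) = (x, 0) := hΞ0 ▸ hcd.localInverse_apply_image hfd (by simp)
  have hΛd : HasFDerivAt Λ (e.symm : (Fin r → ℝ) × ℝ →L[ℝ] (Fin r → ℝ) × ℝ) (0, 0) :=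
    hΞ0 ▸ hst.to_localInverse.hasFDerivAt
  have hright : ∀ᶠ p in 𝓝 ((0, 0) : (Fin r → ℝ) × ℝ), Ξ (Λ p) = p :=
    hΞ0 ▸ hst.eventually_right_inverse
  have hleft : ∀ᶠ p in 𝓝 ((x, 0) : (Fin r → ℝ) × ℝ), Λ (Ξ p) = p := hst.eventually_left_inverse
  have hin : ContDiff ℝ ⊤ fun τ : ℝ => ((0, τ) : (Fin r → ℝ) × ℝ) := by fun_prop
  have hcurve : ContDiffAt ℝ ⊤ (fun τ : ℝ => Λ (0, τ)) 0 :=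
    ContDiffAt.comp (0 : ℝ) (g := Λ) hΛc hin.contDiffAt
  -- The curve is the image of {0} × ℝ under the local inverse. Since L(w, ρ - 1) = (0, 1), its
  -- tangent is w and η has derivative ρ - 1.
  have hder : HasDerivAt (fun τ : ℝ => Λ (0, τ)) (w, ρ - 1) 0 := by
    have hi : HasDerivAt (fun τ : ℝ => ((0, τ) : (Fin r → ℝ) × ℝ)) (0, 1) 0 :=
      (hasDerivAt_const (0 : ℝ) (0 : Fin r → ℝ)).prodMk (hasDerivAt_id 0)
    have h1 := HasFDerivAt.comp_hasDerivAt (0 : ℝ) (l := Λ) hΛd hi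
    refine h1.congr_deriv ?_
    have : e (w, ρ - 1) = (0, 1) := by
      change L (w, ρ - 1) = _
      rw [hLv, hlamw]
      congr 1
      funext k
      simp only [Pi.sub_apply, hval, hρ, Pi.smul_apply, smul_eq_mul, hq, Pi.zero_apply]
      ring
    rw [← this]
    exact e.symm_apply_apply _
  refine ⟨fun τ => (Λ (0, τ)).1, fun τ => (Λ (0, τ)).2, ?_, ?_, ?_, ?_, ?_, ?_⟩
  · simp [hΛ0]
  · exact (contDiffAt_fst.comp (0 : ℝ) hcurve).analyticAt
  · exact (contDiffAt_snd.comp (0 : ℝ) hcurve).analyticAt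
  · exact (HasFDerivAt.comp_hasDerivAt (0 : ℝ)
      (l := Prod.fst) hasFDerivAt_fst hder).deriv
  · have ht : Tendsto (fun τ : ℝ => ((0, τ) : (Fin r → ℝ) × ℝ)) (𝓝 0) (𝓝 (0, 0)) :=
      hin.continuous.tendsto 0
    filter_upwards [ht.eventually hright] with τ hτ
    have := congrArg Prod.fst hτ
    simp only [hΞ] at this
    exact sub_eq_zero.1 this
  · refine ⟨fun y => lam (y - x), ?_, ?_⟩
    · have : Continuous fun y => lam (y - x) := by fun_prop
      have h1 := this.tendsto x
      simpa using h1
    · have ht : Tendsto (fun y : Fin r → ℝ => (y, (0 : ℝ))) (𝓝 x) (𝓝 (x, 0)) := by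
        have : Continuous fun y : Fin r → ℝ => (y, (0 : ℝ)) := by fun_prop
        exact this.tendsto x
      -- A zero y of the residual satisfies Ξ(y, 0) = (0, λ(y - x)), so the local inverse places it
      -- on the curve at the parameter λ(y - x), with η = 0.
      filter_upwards [ht.eventually hleft] with y hy hy0
      have h1 : Ξ (y, 0) = (0, lam (y - x)) := by simp [hΞ, hy0]
      rw [h1] at hy
      exact ⟨by rw [hy], by rw [hy]⟩

namespace IsCurve

variable {w : Fin r → ℝ} {γ : ℝ → Fin r → ℝ} {η : ℝ → ℝ}

lemma tendsto (hc : IsCurve a m x w γ η) : Tendsto γ (𝓝 0) (𝓝 x) := by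
  have := hc.analytic_γ.continuousAt.tendsto
  rwa [hc.zero] at this

lemma eventually_isPoints (hc : IsCurve a m x w γ η) (hx : IsPoints x) :
    ∀ᶠ τ in 𝓝 0, IsPoints (γ τ) := hc.tendsto.eventually hx.eventually

lemma eventually_hasDerivAt (hc : IsCurve a m x w γ η) :
    ∀ᶠ τ in 𝓝 0, HasDerivAt γ (deriv γ τ) τ :=
  hc.analytic_γ.eventually_analyticAt.mono fun _ hτ => hτ.differentiableAt.hasDerivAt

lemma tendsto_deriv (hc : IsCurve a m x w γ η) : Tendsto (deriv γ) (𝓝 0) (𝓝 w) := by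
  have := hc.analytic_γ.deriv.continuousAt.tendsto
  rwa [hc.deriv_zero] at this

lemma eventually_deriv_pos (hc : IsCurve a m x w γ η) (hw : ∀ k, 0 < w k) :
    ∀ᶠ τ in 𝓝 0, ∀ k, 0 < deriv γ τ k :=
  eventually_all.2 fun k =>
    ((continuous_apply k).continuousAt.tendsto.comp hc.tendsto_deriv).eventually
      (lt_mem_nhds (hw k))

/-- The components of the curve increase. -/
lemma exists_strictMonoOn (hc : IsCurve a m x w γ η) (hw : ∀ k, 0 < w k) :
    ∃ ε > 0, ∀ k, StrictMonoOn (fun τ => γ τ k) (Set.Ioo (-ε) ε) := by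
  obtain ⟨ε, hε, hball⟩ := Metric.eventually_nhds_iff.1
    (hc.eventually_hasDerivAt.and (hc.eventually_deriv_pos hw))
  have hmem : ∀ τ ∈ Set.Ioo (-ε) ε, dist τ 0 < ε := fun τ hτ => by
    rw [Real.dist_0_eq_abs, abs_lt]; exact hτ
  refine ⟨ε, hε, fun k => strictMonoOn_of_deriv_pos (convex_Ioo _ _) (fun τ hτ => ?_)
    fun τ hτ => ?_⟩
  · exact (hasDerivAt_pi.1 (hball (hmem τ hτ)).1 k).continuousAt.continuousWithinAt
  · rw [interior_Ioo] at hτ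
    rw [(hasDerivAt_pi.1 (hball (hmem τ hτ)).1 k).deriv]
    exact (hball (hmem τ hτ)).2 k

end IsCurve

end Curve

end IRKA

namespace IRKA

open Finset Matrix

/-! ### Fixed points on the curve are isolated -/

section Critical

variable {n r : ℕ} {a m : Fin n → ℝ} {x : Fin r → ℝ}

/-- The zeros of the diagonal residual at which its derivative has a positive null vector. -/
def critSet (a m : Fin n → ℝ) (r : ℕ) : Set (Fin r → ℝ) :=
  {x | IsPoints x ∧ residual a m x x = 0 ∧ ∃ w : Fin r → ℝ, (∀ k, 0 < w k) ∧ jac a m x *ᵥ w = w}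

/-- Zeros of an orthogonal polynomial lie in the convex hull of the support: otherwise a_i - x_k has
one sign and the defect cannot vanish. This gives the a priori bound for compactness. -/
lemma exists_le_of_residual_eq_zero (h : IsModel a m r) (hx : ∀ k, 0 < x k)
    (hres : residual a m x x = 0) (k : Fin r) : (∃ i, a i ≤ x k) ∧ ∃ i, x k ≤ a i := by
  obtain ⟨i, hi⟩ := h.exists_ratio_ne hx x
  have hs : ∑ i, m i * ((a i - x k) * ratio x x (univ.erase k) (a i) ^ 2) = 0 := congrFun hres k
  constructor <;> by_contra! hcon
  · refine (sum_pos' (fun j _ => ?_) ⟨i, mem_univ i, ?_⟩).ne' hs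
    · exact mul_nonneg (h.m_pos j).le (mul_nonneg (sub_nonneg.2 (hcon j).le) (sq_nonneg _))
    · exact mul_pos (h.m_pos i) (mul_pos (sub_pos.2 (hcon i)) (sq_pos_of_ne_zero (hi _)))
  · refine (sum_neg' (fun j _ => ?_) ⟨i, mem_univ i, ?_⟩).ne hs
    · exact mul_nonpos_of_nonneg_of_nonpos (h.m_pos j).le
        (mul_nonpos_of_nonpos_of_nonneg (sub_nonpos.2 (hcon j).le) (sq_nonneg _))
    · exact mul_neg_of_pos_of_neg (h.m_pos i)
        (mul_neg_of_neg_of_pos (sub_neg.2 (hcon i)) (sq_pos_of_ne_zero (hi _)))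

/-- If two nodes coincide, then p_k = p_l and the inner product is a positive squared norm. Thus the
closed condition of orthogonality prevents nodes from colliding in a limit. -/
lemma gramOff_pos_of_eq (h : IsModel a m r) (hx : ∀ k, 0 < x k) {k l : Fin r}
    (hkl : x k = x l) : 0 < gramOff a m x x k l := by
  have : gramOff a m x x k l = gramDiag a m x x k := by
    refine sum_congr rfl fun i _ => ?_
    have hR : ratio x x (univ.erase l) (a i) = ratio x x (univ.erase k) (a i) := by
      rcases eq_or_ne k l with rfl | hne
      · rfl
      rcases eq_or_ne (a i) (x k) with he | he
      · have h1 : ratio x x (univ.erase l) (a i) = 0 := by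
          rw [he]; exact ratio_erase_of_ne x hne
        have h2 : ratio x x (univ.erase k) (a i) = 0 := by
          rw [he, hkl]; exact ratio_erase_of_ne x hne.symm
        rw [h1, h2]
      · have h1 := ratio_univ x x k (a i)
        rw [ratio_univ x x l, ← hkl] at h1
        exact mul_left_cancel₀ (sub_ne_zero.2 he) h1
    rw [hR]; ring
  rw [this]
  exact h.gramDiag_pos hx x k

lemma continuousOn_ratio (z : ℝ) (hz : 0 < z) (S : Finset (Fin r)) :
    ContinuousOn (fun x : Fin r → ℝ => ratio x x S z) {x | ∀ k, 0 < x k} := by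
  refine ContinuousOn.div (by fun_prop) (by fun_prop) fun x hx => ?_
  exact prod_ne_zero_iff.2 fun j _ => (add_pos hz (hx j)).ne'

lemma jac_mulVec_iff (h : IsModel a m r) (hx : IsPoints x) (w : Fin r → ℝ) :
    jac a m x *ᵥ w = w ↔
      ∀ k, ∑ l, 2 * errWeight a m x x l / (x k + x l) * w l - gramDiag a m x x k * w k = 0 := by
  rw [funext_iff]
  refine forall_congr' fun k => ?_
  have hd := (h.gramDiag_pos hx.pos x k).ne'
  have : ∑ l, 2 * errWeight a m x x l / (x k + x l) * w l =
      gramDiag a m x x k * (jac a m x *ᵥ w) k := by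
    simp only [mulVec, dotProduct, jac, of_apply, mul_sum]
    exact sum_congr rfl fun l _ => by field_simp
  rw [this, ← mul_sub, mul_eq_zero, or_iff_right hd, sub_eq_zero]

lemma pos_of_jac_mulVec (h : IsModel a m r) (hx : IsPoints x) {w : Fin r → ℝ}
    (hw : ∀ k, 0 ≤ w k) (hw1 : ∑ k, w k = 1) (hJ : jac a m x *ᵥ w = w) (k : Fin r) : 0 < w k := by
  rw [← hJ]
  obtain ⟨l, -, hl⟩ := exists_ne_zero_of_sum_ne_zero (hw1 ▸ one_ne_zero : ∑ k, w k ≠ 0)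
  exact sum_pos' (fun j _ => mul_nonneg (jac_pos h hx k j).le (hw j))
    ⟨l, mem_univ l, mul_pos (jac_pos h hx k l) (lt_of_le_of_ne (hw l) (Ne.symm hl))⟩

/-- The set is the projection of a closed subset of a compact box of pairs (x, w). Strict conditions
are replaced by closed ones that imply them: distinct nodes by orthogonality, and w > 0 by w ≥ 0, ∑
w_k = 1 and J w = w. -/
lemma isCompact_critSet (h : IsModel a m r) (hr : 0 < r) : IsCompact (critSet a m r) := by
  have hn : Nonempty (Fin n) := ⟨⟨0, hr.trans h.lt⟩⟩
  obtain ⟨i₀, hi₀⟩ := Finite.exists_min a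
  obtain ⟨i₁, hi₁⟩ := Finite.exists_max a
  set box : Set ((Fin r → ℝ) × (Fin r → ℝ)) :=
    Set.Icc (fun _ => a i₀) (fun _ => a i₁) ×ˢ Set.Icc 0 1 with hbox
  have hboxc : IsCompact box := isCompact_Icc.prod isCompact_Icc
  have hpos : ∀ p ∈ box, ∀ k, 0 < p.1 k := fun p hp k =>
    (h.a_pos i₀).trans_le (hp.1.1 k)
  set Φ : (Fin r → ℝ) × (Fin r → ℝ) →
      (Fin r → ℝ) × (Fin r → Fin r → ℝ) × ℝ × (Fin r → ℝ) := fun p =>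
    (residual a m p.1 p.1, fun k l => if k = l then 0 else gramOff a m p.1 p.1 k l,
      ∑ k, p.2 k - 1, fun k => ∑ l, 2 * errWeight a m p.1 p.1 l / (p.1 k + p.1 l) * p.2 l -
        gramDiag a m p.1 p.1 k * p.2 k) with hΦ
  have hratio : ∀ i S, ContinuousOn (fun p : (Fin r → ℝ) × (Fin r → ℝ) =>
      ratio p.1 p.1 S (a i)) box := fun i S =>
    (continuousOn_ratio (a i) (h.a_pos i) S).comp continuousOn_fst hpos
  have h1 : ∀ k, ContinuousOn (fun p : (Fin r → ℝ) × (Fin r → ℝ) => p.1 k) box := fun k => by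
    fun_prop
  have h2 : ∀ k, ContinuousOn (fun p : (Fin r → ℝ) × (Fin r → ℝ) => p.2 k) box := fun k => by
    fun_prop
  have hcont : ContinuousOn Φ box := by
    refine ContinuousOn.prodMk ?_ (ContinuousOn.prodMk ?_ (ContinuousOn.prodMk ?_ ?_))
    · refine continuousOn_pi.2 fun k => continuousOn_finsetSum _ fun i _ => ?_
      exact continuousOn_const.mul ((continuousOn_const.sub (h1 k)).mul ((hratio i _).pow 2))
    · refine continuousOn_pi.2 fun k => continuousOn_pi.2 fun l => ?_
      split_ifs
      · exact continuousOn_const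
      · refine continuousOn_finsetSum _ fun i _ => ?_
        exact continuousOn_const.mul ((hratio i _).mul (hratio i _))
    · fun_prop
    · refine continuousOn_pi.2 fun k => ContinuousOn.sub ?_ ?_
      · refine continuousOn_finsetSum _ fun l _ => ContinuousOn.mul (ContinuousOn.div
          (continuousOn_const.mul ?_) ((h1 k).add (h1 l)) fun p hp => ?_) (h2 l)
        · refine continuousOn_finsetSum _ fun i _ => continuousOn_const.mul (ContinuousOn.div
            ((hratio i _).pow 2) (continuousOn_const.add (h1 l))
            fun p hp => (add_pos (h.a_pos i) (hpos p hp l)).ne')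
        · exact (add_pos (hpos p hp k) (hpos p hp l)).ne'
      · refine ContinuousOn.mul (continuousOn_finsetSum _ fun i _ => ?_) (h2 k)
        exact continuousOn_const.mul ((hratio i _).pow 2)
  have hT : IsCompact (box ∩ Φ ⁻¹' {0}) :=
    hboxc.of_isClosed_subset
      (hcont.preimage_isClosed_of_isClosed hboxc.isClosed isClosed_singleton) Set.inter_subset_left
  have himg : critSet a m r = Prod.fst '' (box ∩ Φ ⁻¹' {0}) := by
    ext x
    constructor
    · rintro ⟨hx, hres, w, hw, hJ⟩
      have : Nonempty (Fin r) := ⟨⟨0, hr⟩⟩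
      have hs : 0 < ∑ k, w k := sum_pos (fun k _ => hw k) univ_nonempty
      have hs1 : ∑ k, ((∑ k, w k)⁻¹ • w) k = 1 := by
        simp only [Pi.smul_apply, smul_eq_mul, ← mul_sum]
        exact inv_mul_cancel₀ hs.ne'
      have hnn : ∀ k, 0 ≤ ((∑ k, w k)⁻¹ • w) k := fun k =>
        mul_nonneg (inv_nonneg.2 hs.le) (hw k).le
      refine ⟨(x, (∑ k, w k)⁻¹ • w), ⟨⟨⟨fun k => ?_, fun k => ?_⟩, fun k => hnn k, fun k => ?_⟩,
        ?_⟩, rfl⟩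
      · obtain ⟨i, hi⟩ := (exists_le_of_residual_eq_zero h hx.pos hres k).1
        exact (hi₀ i).trans hi
      · obtain ⟨i, hi⟩ := (exists_le_of_residual_eq_zero h hx.pos hres k).2
        exact hi.trans (hi₁ i)
      · change ((∑ k, w k)⁻¹ • w) k ≤ 1
        rw [← hs1]
        exact single_le_sum (f := ((∑ k, w k)⁻¹ • w)) (fun j _ => hnn j) (mem_univ k)
      · change Φ _ = 0
        have hJ' : jac a m x *ᵥ ((∑ k, w k)⁻¹ • w) = (∑ k, w k)⁻¹ • w := by
          rw [mulVec_smul, hJ]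
        refine Prod.ext hres (Prod.ext ?_ (Prod.ext (sub_eq_zero.2 hs1) ?_))
        · funext k l
          change (if k = l then 0 else gramOff a m x x k l) = 0
          split_ifs with hkl
          · rfl
          · exact gramOff_eq_zero hx.inj hres hkl
        · exact funext ((jac_mulVec_iff h hx _).1 hJ')
    · rintro ⟨⟨y, w⟩, ⟨hp, hp0⟩, rfl⟩
      have hp0' : Φ (y, w) = 0 := hp0
      have e1 : residual a m y y = 0 := congrArg Prod.fst hp0'
      have e2 : ∀ k l, (if k = l then 0 else gramOff a m y y k l) = 0 := fun k l =>
        congrFun (congrFun (congrArg (fun q => q.2.1) hp0') k) l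
      have e3 : ∑ k, w k - 1 = 0 := congrArg (fun q => q.2.2.1) hp0'
      have e4 := congrFun (congrArg (fun q => q.2.2.2) hp0')
      have hy0 : ∀ k, 0 < y k := hpos _ hp
      have hy : IsPoints y := ⟨hy0, fun k l hkl => by
        by_contra hne
        have := e2 k l
        rw [if_neg hne] at this
        exact (gramOff_pos_of_eq h hy0 hkl).ne' this⟩
      have hJ : jac a m y *ᵥ w = w := (jac_mulVec_iff h hy w).2 e4
      exact ⟨hy, e1, w, pos_of_jac_mulVec h hy (fun k => hp.2.1 k) (sub_eq_zero.1 e3) hJ, hJ⟩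
  rw [himg]
  exact hT.image continuous_fst

namespace IsCurve

variable {w : Fin r → ℝ} {γ : ℝ → Fin r → ℝ} {η : ℝ → ℝ}

/-- Differentiating residual(γ, γ) = 0 along the curve shows that γ' is fixed by the Jacobian, and
γ' stays positive near its initial value w. -/
lemma eventually_mem_critSet (hc : IsCurve a m x w γ η) (h : IsModel a m r) (hx : IsPoints x)
    (hw : ∀ k, 0 < w k) (hη : ∀ᶠ τ in 𝓝 0, η τ = 0) : ∀ᶠ τ in 𝓝 0, γ τ ∈ critSet a m r := by
  have hres : ∀ᶠ τ in 𝓝 0, residual a m (γ τ) (γ τ) = 0 := by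
    filter_upwards [hc.residual_eq, hη] with τ h1 h2
    rw [h1, h2, zero_smul]
  filter_upwards [hres.eventually_nhds, hc.eventually_isPoints hx, hc.eventually_hasDerivAt,
    hc.eventually_deriv_pos hw] with τ h1 h2 h3 h4
  refine ⟨h2, h1.self_of_nhds, _, h4, ?_⟩
  obtain ⟨D, hD, hval⟩ := exists_hasFDerivAt_residual_diag h h2 h1.self_of_nhds
  have hcomp := HasFDerivAt.comp_hasDerivAt τ (l := fun y => residual a m y y) hD h3
  have hzero : HasDerivAt ((fun y => residual a m y y) ∘ γ) 0 τ :=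
    (hasDerivAt_const τ (0 : Fin r → ℝ)).congr_of_eventuallyEq h1
  have hu := hcomp.unique hzero
  funext k
  have := congrFun hu k
  rw [hval, Pi.zero_apply] at this
  exact sub_eq_zero.1 ((mul_eq_zero.1 this).resolve_left (h.gramDiag_pos h2.pos _ k).ne')

/-- If the curve consists of zeros of the residual, it runs through accumulation points of the
critical set with a larger sum of coordinates. -/
lemma exists_accPt (hc : IsCurve a m x w γ η) (h : IsModel a m r) (hr : 0 < r) (hx : IsPoints x)
    (hw : ∀ k, 0 < w k) (hη : ∀ᶠ τ in 𝓝 0, η τ = 0) :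
    ∃ y ∈ critSet a m r ∩ derivedSet (critSet a m r), ∑ k, x k < ∑ k, y k := by
  have : Nonempty (Fin r) := ⟨⟨0, hr⟩⟩
  obtain ⟨ε, hε, hmono⟩ := hc.exists_strictMonoOn hw
  have hIoo : ∀ᶠ τ : ℝ in 𝓝 0, τ ∈ Set.Ioo (-ε) ε := Ioo_mem_nhds (by linarith) hε
  have hall := ((hc.eventually_mem_critSet h hx hw hη).and
    (hIoo.and hc.eventually_hasDerivAt)).eventually_nhds
  obtain ⟨τ, hτ, hτ0⟩ :=
    ((hall.filter_mono nhdsWithin_le_nhds).and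
      (self_mem_nhdsWithin : Set.Ioi (0 : ℝ) ∈ 𝓝[>] 0)).exists
  have hself := hτ.self_of_nhds
  refine ⟨γ τ, ⟨hself.1, ?_⟩, ?_⟩
  · rw [mem_derivedSet, accPt_iff_frequently]
    have ht : Tendsto γ (𝓝[>] τ) (𝓝 (γ τ)) :=
      hself.2.2.continuousAt.tendsto.mono_left nhdsWithin_le_nhds
    refine ht.frequently (Eventually.frequently ?_)
    filter_upwards [hτ.filter_mono nhdsWithin_le_nhds, self_mem_nhdsWithin] with σ hσ hστ
    exact ⟨fun he => (hmono ⟨0, hr⟩ hself.2.1 hσ.2.1 hστ).ne' (congrFun he _), hσ.1⟩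
  · refine sum_lt_sum_of_nonempty univ_nonempty fun k _ => ?_
    have := hmono k ⟨by linarith, hε⟩ hself.2.1 hτ0
    simpa [hc.zero] using this

/-- Critical points accumulating at x lie on the curve at nonzero parameters tending to 0, where η
vanishes; an analytic function with such zeros is identically zero nearby. -/
lemma eventually_eta_zero (hc : IsCurve a m x w γ η) (hacc : AccPt x (𝓟 (critSet a m r))) :
    ∀ᶠ τ in 𝓝 0, η τ = 0 := by
  rw [accPt_iff_frequently] at hacc
  obtain ⟨ℓ, hℓ, huniq⟩ := hc.uniq
  refine hc.analytic_η.frequently_zero_iff_eventually_zero.1 ?_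
  have h1 : ∃ᶠ y in 𝓝 x, ℓ y ≠ 0 ∧ η (ℓ y) = 0 := by
    refine (hacc.and_eventually huniq).mono fun y hy => ?_
    obtain ⟨⟨hne, hmem⟩, hu⟩ := hy
    obtain ⟨h1, h2⟩ := hu hmem.2.1
    refine ⟨fun h0 => hne ?_, h2⟩
    rw [← h1, h0, hc.zero]
  have h2 := hℓ.frequently (p := fun τ => τ ≠ 0 ∧ η τ = 0) h1
  rw [frequently_nhdsWithin_iff]
  exact h2.mono fun τ hτ => ⟨hτ.2, hτ.1⟩

/-- Zeros of the residual along the curve are isolated. -/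
lemma eventually_eta_ne (hc : IsCurve a m x w γ η) (h : IsModel a m r) (hr : 0 < r)
    (hx : IsPoints x) (hw : ∀ k, 0 < w k) : ∀ᶠ τ in 𝓝[≠] 0, η τ ≠ 0 := by
  refine hc.analytic_η.eventually_eq_zero_or_eventually_ne_zero.resolve_left fun hη => ?_
  obtain ⟨y₀, hy₀, -⟩ := hc.exists_accPt h hr hx hw hη
  have hcomp : IsCompact (critSet a m r ∩ derivedSet (critSet a m r)) :=
    (isCompact_critSet h hr).inter_right (isClosed_derivedSet _)
  -- An accumulation point with the largest coordinate sum. The curve through it also consists of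
  -- critical points and contains accumulation points with a larger sum.
  obtain ⟨y, hy, hmax⟩ := hcomp.exists_isMaxOn ⟨y₀, hy₀⟩
    (f := fun y : Fin r → ℝ => ∑ k, y k) (by fun_prop)
  obtain ⟨hyp, hyres, u, hu, hJ⟩ := hy.1
  obtain ⟨γ', η', hc'⟩ := exists_isCurve hr h hyp hyres hu (ρ := 1) (by rw [hJ, one_smul]) le_rfl
  obtain ⟨z, hz, hlt⟩ := hc'.exists_accPt h hr hyp hu (hc'.eventually_eta_zero hy.2)
  exact absurd (hmax hz) (not_le.2 hlt)

end IsCurve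

end Critical

end IRKA

namespace IRKA

open Finset Matrix

/-! ### Monotone iteration near a local minimiser -/

section Dynamics

/-- Isolated zeros give η a constant sign to the right of 0. A positive sign would make f strictly
decreasing there, contrary to minimality at 0. -/
lemma eventually_neg_of_isLocalMin {f η g : ℝ → ℝ}
    (hf : ∀ᶠ τ in 𝓝 0, HasDerivAt f (-(η τ * g τ)) τ) (hg : ∀ᶠ τ in 𝓝 0, 0 < g τ)
    (hη : ∀ᶠ τ in 𝓝 0, ContinuousAt η τ) (hne : ∀ᶠ τ in 𝓝[≠] 0, η τ ≠ 0)
    (hmin : IsLocalMin f 0) : ∀ᶠ τ in 𝓝[>] 0, η τ < 0 := by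
  obtain ⟨ε, hε, hball⟩ := Metric.eventually_nhds_iff.1
    (hf.and (hg.and (hη.and ((eventually_nhdsWithin_iff.1 hne).and hmin))))
  have hb : ∀ τ ∈ Set.Ico (0 : ℝ) ε, dist τ 0 < ε := fun τ hτ => by
    rw [Real.dist_0_eq_abs, abs_of_nonneg hτ.1]; exact hτ.2
  have hne' : ∀ τ ∈ Set.Ioo (0 : ℝ) ε, η τ ≠ 0 := fun τ hτ =>
    (hball (hb τ (Set.Ioo_subset_Ico_self hτ))).2.2.2.1 hτ.1.ne'
  have hcont : ContinuousOn η (Set.Ioo 0 ε) := fun τ hτ =>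
    (hball (hb τ (Set.Ioo_subset_Ico_self hτ))).2.2.1.continuousWithinAt
  filter_upwards [Ioo_mem_nhdsGT hε] with τ hτ
  by_contra hcon
  have hpos : 0 < η τ := lt_of_le_of_ne (not_lt.1 hcon) (hne' τ hτ).symm
  have hall : ∀ σ ∈ Set.Ioo (0 : ℝ) ε, 0 < η σ := fun σ hσ => by
    by_contra hcon'
    have hneg : η σ < 0 := lt_of_le_of_ne (not_lt.1 hcon') (hne' σ hσ)
    obtain ⟨c, hc, hc0⟩ := isPreconnected_Ioo.intermediate_value hσ hτ hcont
      (show (0 : ℝ) ∈ Set.Icc (η σ) (η τ) from ⟨hneg.le, hpos.le⟩)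
    exact hne' c hc hc0
  have hanti : StrictAntiOn f (Set.Icc 0 τ) := by
    have hsub : ∀ σ ∈ Set.Icc 0 τ, dist σ 0 < ε := fun σ hσ => hb σ ⟨hσ.1, hσ.2.trans_lt hτ.2⟩
    refine strictAntiOn_of_deriv_neg (convex_Icc _ _)
      (fun σ hσ => (hball (hsub σ hσ)).1.continuousAt.continuousWithinAt) fun σ hσ => ?_
    rw [interior_Icc] at hσ
    have h1 := hball (hsub σ (Set.Ioo_subset_Icc_self hσ))
    rw [h1.1.deriv, neg_lt_zero]
    exact mul_pos (hall σ ⟨hσ.1, hσ.2.trans hτ.2⟩) h1.2.1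
  have h1 := hanti (Set.left_mem_Icc.2 hτ.1.le) (Set.right_mem_Icc.2 hτ.1.le) hτ.1
  exact absurd ((hball (hb τ (Set.Ioo_subset_Ico_self hτ))).2.2.2.2) (not_le.2 h1)

variable {n r : ℕ} {a m : Fin n → ℝ} {x : Fin r → ℝ}

/-- Local minimality is growth with constant κ = 0, and the slope form multiplying 1 - ρ is
positive. -/
lemma le_one_of_isLocalMin (h : IsModel a m r) (hx : IsPoints x) (hres : residual a m x x = 0)
    {w : Fin r → ℝ} (hw : w ≠ 0) {ρ : ℝ} (hρ : jac a m x *ᵥ w = ρ • w)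
    (hmin : IsLocalMin (redCost a m) x) : ρ ≤ 1 := by
  have ht : Tendsto (fun τ : ℝ => x + τ • w) (𝓝 0) (𝓝 x) := by
    have h1 := (hasDerivAt_line x w 0).continuousAt.tendsto
    simpa using h1
  have hb := eigenvalue_bound h hx hres hρ (κ := 0) (by simpa using ht.eventually hmin)
  have hs := slopeForm_pos h hx hres hw
  rw [zero_mul] at hb
  by_contra hcon
  exact absurd hb (not_le.2 (mul_neg_of_neg_of_pos (by linarith) hs))

namespace IsCurve

variable {w : Fin r → ℝ} {γ : ℝ → Fin r → ℝ} {η : ℝ → ℝ}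

/-- Along the curve the error has derivative -η g, where g is twice the slope form of γ' and d w. At
0 this form is positive definite in w, so g > 0 nearby and minimality fixes the sign of η on both
sides. -/
lemma eventually_eta_sign (hc : IsCurve a m x w γ η) (h : IsModel a m r) (hr : 0 < r)
    (hx : IsPoints x) (hres : residual a m x x = 0) (hw : ∀ k, 0 < w k)
    (hmin : IsLocalMin (redCost a m) x) :
    ∀ᶠ τ in 𝓝[>] 0, η τ < 0 ∧ 0 < η (-τ) := by
  have hw0 : w ≠ 0 := fun h0 => (hw ⟨0, hr⟩).ne' (congrFun h0 _)
  set q : Fin r → ℝ := fun k => gramDiag a m x x k * w k with hq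
  set g : ℝ → ℝ := fun τ => 2 * slopeForm a m (γ τ) (deriv γ τ) q with hg
  have hf : ∀ᶠ τ in 𝓝 0, HasDerivAt (fun τ => redCost a m (γ τ)) (-(η τ * g τ)) τ := by
    filter_upwards [hc.eventually_hasDerivAt, hc.eventually_isPoints hx, hc.residual_eq]
      with τ h1 h2 h3
    refine (hasDerivAt_errCost (m := m) h1 h.a_pos h2.pos h2.inj).congr_deriv ?_
    have h4 : slopeForm a m (γ τ) (deriv γ τ) (η τ • q) =
        η τ * slopeForm a m (γ τ) (deriv γ τ) q := by
      unfold slopeForm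
      simp only [Pi.smul_apply, smul_eq_mul, mul_sum]
      exact sum_congr rfl fun k _ => sum_congr rfl fun l _ => by ring
    rw [h3, h4]
    simp only [hg]
    ring
  have hgpos : ∀ᶠ τ in 𝓝 0, 0 < g τ := by
    have hγ0 : IsPoints (γ 0) := hc.zero.symm ▸ hx
    have hdiff := hc.analytic_γ.differentiableAt
    have hγk : ∀ k, ContinuousAt (fun τ => γ τ k) 0 := fun k =>
      (continuousAt_pi.1 hc.analytic_γ.continuousAt) k
    have hγ'k : ∀ k, ContinuousAt (fun τ => deriv γ τ k) 0 := fun k =>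
      (continuousAt_pi.1 hc.analytic_γ.deriv.continuousAt) k
    have hb : ∀ k, ContinuousAt (fun τ => bweight (γ τ) k) 0 := fun k =>
      (differentiableAt_bweight hdiff hγ0 k).continuousAt
    have ho : ∀ k, ContinuousAt (fun τ => optResidue a m (γ τ) k) 0 := fun k =>
      (differentiableAt_optResidue hdiff h.a_pos hγ0.pos hγ0.inj k).continuousAt
    have hcont : ContinuousAt g 0 := by
      refine continuousAt_const.mul (tendsto_finsetSum _ fun k _ => ?_)
      refine (((ho k).mul ((hb k).inv₀ (hγ0.isNode.bweight_ne k))).mul (hγ'k k)).mul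
        (tendsto_finsetSum _ fun l _ => ?_)
      exact ((hb l).div ((hγk k).add (hγk l))
        (add_pos (hγ0.pos k) (hγ0.pos l)).ne').mul continuousAt_const
    have h0 : 0 < g 0 := by
      have := slopeForm_pos h hx hres hw0
      simp only [hg, hc.zero, hc.deriv_zero]
      linarith
    exact hcont.eventually (lt_mem_nhds h0)
  have hη : ∀ᶠ τ in 𝓝 0, ContinuousAt η τ :=
    hc.analytic_η.eventually_analyticAt.mono fun _ hτ => hτ.continuousAt
  have hne := hc.eventually_eta_ne h hr hx hw
  have hmin' : IsLocalMin (fun τ => redCost a m (γ τ)) 0 := by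
    have := hc.tendsto.eventually hmin
    simpa [IsLocalMin, IsMinFilter, hc.zero] using this
  have hneg : Tendsto (fun τ : ℝ => -τ) (𝓝 0) (𝓝 0) := by
    simpa using (continuous_neg.tendsto (0 : ℝ))
  refine (eventually_neg_of_isLocalMin hf hgpos hη hne hmin').and ?_
  -- The left side follows from the reflected curve τ ↦ γ(-τ), for which η is replaced by -η(-τ).
  have := eventually_neg_of_isLocalMin (f := fun τ => redCost a m (γ (-τ)))
    (η := fun τ => -η (-τ)) (g := fun τ => g (-τ)) ?_ (hneg.eventually hgpos) ?_ ?_ ?_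
  · exact this.mono fun τ hτ => by linarith
  · filter_upwards [hneg.eventually hf] with τ hτ
    refine (HasDerivAt.scomp τ hτ (hasDerivAt_neg τ)).congr_deriv ?_
    simp
  · filter_upwards [hneg.eventually hη] with τ hτ
    exact (ContinuousAt.comp (g := η) (f := fun τ => -τ) hτ continuous_neg.continuousAt).neg
  · have hneg' : Tendsto (fun τ : ℝ => -τ) (𝓝[≠] 0) (𝓝[≠] 0) := by
      refine tendsto_nhdsWithin_iff.2 ⟨hneg.mono_left nhdsWithin_le_nhds, ?_⟩
      filter_upwards [self_mem_nhdsWithin] with τ hτ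
      simpa using hτ
    exact (hneg'.eventually hne).mono fun τ hτ => by simpa using hτ
  · have := hneg.eventually hmin'
    simpa [IsLocalMin, IsMinFilter] using this

lemma eventually_eq_of_residual (hc : IsCurve a m x w γ η) (h : IsModel a m r) (hr : 0 < r)
    (hx : IsPoints x) (hw : ∀ k, 0 < w k) :
    ∀ᶠ y in 𝓝 x, residual a m y y = 0 → y = x := by
  obtain ⟨ℓ, hℓ, huniq⟩ := hc.uniq
  have hne := eventually_nhdsWithin_iff.1 (hc.eventually_eta_ne h hr hx hw)
  filter_upwards [huniq, hℓ.eventually hne] with y h1 h2 h3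
  obtain ⟨h4, h5⟩ := h1 h3
  have : ℓ y = 0 := by
    by_contra h0
    exact h2 h0 h5
  rw [← h4, this, hc.zero]

end IsCurve

/-- Where the residual is a small multiple of `gramDiag · w`, the iteration moves approximately in
the direction of this multiple of `w`. -/
lemma eventually_abs_sub_le (h : IsModel a m r) (hr : 0 < r) (hx : IsPoints x)
    (hres : residual a m x x = 0) {w : Fin r → ℝ} (hw : ∀ k, 0 < w k)
    {F : (Fin r → ℝ) → (Fin r → ℝ)} (hFx : F x = x) (hFc : ContinuousAt F x)
    (hF : ∀ᶠ t in 𝓝 x, residual a m t (F t) = 0) :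
    ∀ᶠ t in 𝓝 x, ∀ η : ℝ, residual a m t t = η • (fun k => gramDiag a m x x k * w k) →
      ∀ k, |F t k - t k - η * w k| ≤ |η| * w k := by
  have : Nonempty (Fin r) := ⟨⟨0, hr⟩⟩
  obtain ⟨f', hf', hval⟩ :=
    exists_hasStrictFDerivAt_residual (h.add_ne hx.pos) hx.isNode.add_ne hx.inj hres
  set d := gramDiag a m x x with hd
  have hd0 : ∀ k, 0 < d k := h.gramDiag_pos hx.pos x
  obtain ⟨k₁, hk₁⟩ := Finite.exists_min w
  obtain ⟨k₂, hk₂⟩ := Finite.exists_max w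
  obtain ⟨k₃, hk₃⟩ := Finite.exists_min d
  have hw1 := hw k₁
  have hw2 := hw k₂
  have hd3 := hd0 k₃
  set c : ℝ := w k₁ / (2 * w k₂) with hc
  have hc0 : 0 < c := by positivity
  have hc2 : c ≤ 1 / 2 := by
    rw [hc, div_le_iff₀ (by positivity)]
    have := hk₂ k₁
    linarith
  have ht : Tendsto (fun t => ((t, F t), (t, t))) (𝓝 x) (𝓝 ((x, x), (x, x))) := by
    have hFt : Tendsto F (𝓝 x) (𝓝 x) := by
      have := hFc.tendsto
      rwa [hFx] at this
    exact (tendsto_id.prodMk_nhds hFt).prodMk_nhds (tendsto_id.prodMk_nhds tendsto_id)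
  have ho := (hf'.isLittleO.bound (mul_pos hd3 hc0))
  filter_upwards [ht.eventually ho, hF] with t h1 h2 η hη k
  set e : Fin r → ℝ := F t - t with he
  -- The residuals at (t, F t) and (t, t) differ only through the second argument, so just the
  -- diagonal part of the derivative enters.
  have hpair : ((t, F t) - (t, t) : (Fin r → ℝ) × (Fin r → ℝ)) = (0, e) := by simp [he]
  simp only [hpair, h2] at h1
  have hnorm : ‖((0 : Fin r → ℝ), e)‖ = ‖e‖ := by simp
  rw [hnorm, hη] at h1
  have hk : ∀ k, |e k - η * w k| ≤ c * ‖e‖ := fun k => by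
    have h3 := (norm_le_pi_norm _ k).trans h1
    simp only [Pi.sub_apply, Pi.zero_apply, Pi.smul_apply, smul_eq_mul, hval, mul_zero,
      sum_const_zero, add_zero, Real.norm_eq_abs] at h3
    have h4 : 0 - η * (d k * w k) - -(d k * e k) = d k * (e k - η * w k) := by ring
    rw [h4, abs_mul, abs_of_pos (hd0 k)] at h3
    have h5 : d k₃ * |e k - η * w k| ≤ d k₃ * (c * ‖e‖) := by
      have := mul_le_mul_of_nonneg_right (hk₃ k) (abs_nonneg (e k - η * w k))
      linarith
    exact le_of_mul_le_mul_left h5 hd3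
  have hen : ‖e‖ ≤ 2 * (|η| * w k₂) := by
    have h6 : ‖e‖ ≤ |η| * w k₂ + c * ‖e‖ := by
      refine (pi_norm_le_iff_of_nonneg (by positivity)).2 fun j => ?_
      have h7 := hk j
      have h8 : |η * w j| ≤ |η| * w k₂ := by
        rw [abs_mul, abs_of_pos (hw j)]
        exact mul_le_mul_of_nonneg_left (hk₂ j) (abs_nonneg _)
      rw [Real.norm_eq_abs]
      have h9 : |e j| ≤ |e j - η * w j| + |η * w j| := by
        simpa using abs_add_le (e j - η * w j) (η * w j)
      linarith
    have := mul_le_mul_of_nonneg_right hc2 (norm_nonneg e)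
    linarith
  have h10 := hk k
  have h11 : c * ‖e‖ ≤ |η| * w k₁ := by
    refine (mul_le_mul_of_nonneg_left hen hc0.le).trans_eq ?_
    rw [hc]
    field_simp
  have h12 := mul_le_mul_of_nonneg_left (hk₁ k) (abs_nonneg η)
  have h13 : e k = F t k - t k := rfl
  rw [← h13]
  linarith

/-- A map whose strict derivative has positive entries is locally monotone. -/
lemma eventually_monotone {F : (Fin r → ℝ) → (Fin r → ℝ)} {J : Matrix (Fin r) (Fin r) ℝ}
    (hr : 0 < r) (hJ : ∀ k l, 0 < J k l)
    (hF : HasStrictFDerivAt F (Matrix.toLin' J).toContinuousLinearMap x) :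
    ∀ᶠ p : (Fin r → ℝ) × (Fin r → ℝ) in 𝓝 (x, x), p.1 ≤ p.2 → F p.1 ≤ F p.2 := by
  have : Nonempty (Fin r × Fin r) := ⟨(⟨0, hr⟩, ⟨0, hr⟩)⟩
  -- The smallest entry of J serves as the error constant: for e ≥ 0 each component of J e is at
  -- least this entry times ∑ e_l, hence at least this entry times ‖e‖, and so dominates the error.
  obtain ⟨⟨k₀, l₀⟩, hmin⟩ := Finite.exists_min fun p : Fin r × Fin r => J p.1 p.2
  filter_upwards [hF.isLittleO.bound (hJ k₀ l₀)] with p hp hle k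
  set e := p.2 - p.1 with he
  have he0 : ∀ l, 0 ≤ e l := fun l => sub_nonneg.2 (hle l)
  have hpe : p.1 - p.2 = -e := by rw [he]; abel
  rw [hpe, norm_neg] at hp
  have h1 := (norm_le_pi_norm _ k).trans hp
  have h2 : J k₀ l₀ * ‖e‖ ≤ (J *ᵥ e) k := by
    have hne : ‖e‖ ≤ ∑ l, e l := by
      refine (pi_norm_le_iff_of_nonneg (sum_nonneg fun l _ => he0 l)).2 fun j => ?_
      rw [Real.norm_eq_abs, abs_of_nonneg (he0 j)]
      exact single_le_sum (f := e) (fun l _ => he0 l) (mem_univ j)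
    refine (mul_le_mul_of_nonneg_left hne (hJ k₀ l₀).le).trans ?_
    rw [mul_sum]
    exact sum_le_sum fun l _ => mul_le_mul_of_nonneg_right (hmin (k, l)) (he0 l)
  have h3 : (Matrix.toLin' J).toContinuousLinearMap (-e) k = -(J *ᵥ e) k := by
    simp [Matrix.mulVec_neg]
  simp only [Pi.sub_apply, h3, Real.norm_eq_abs] at h1
  have h4 := (abs_le.1 h1).2
  linarith

/-- Iterating a monotone map on an order interval that contains a single fixed point. -/
lemma tendsto_iterate_of_monotone {F : (Fin r → ℝ) → (Fin r → ℝ)} {u v : Fin r → ℝ}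
    (hu : u ≤ F u) (hv : F v ≤ v) (huv : u ≤ v)
    (hmono : MonotoneOn F (Set.Icc u v)) (hcont : ContinuousOn F (Set.Icc u v))
    (hfix : ∀ y ∈ Set.Icc u v, F y = y → y = x) :
    (∀ t ∈ Set.Icc u v, F t ∈ Set.Icc u v) ∧
      ∀ t ∈ Set.Icc u v, Tendsto (fun k => F^[k] t) atTop (𝓝 x) := by
  have hul : u ∈ Set.Icc u v := Set.left_mem_Icc.2 huv
  have hvr : v ∈ Set.Icc u v := Set.right_mem_Icc.2 huv
  have hmaps : ∀ t ∈ Set.Icc u v, F t ∈ Set.Icc u v := fun t ht =>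
    ⟨hu.trans (hmono hul ht ht.1), (hmono ht hvr ht.2).trans hv⟩
  have hit : ∀ k, ∀ t ∈ Set.Icc u v, F^[k] t ∈ Set.Icc u v := fun k => by
    induction k with
    | zero => exact fun t ht => ht
    | succ k ih => exact fun t ht => ih _ (hmaps t ht)
  have hlim : ∀ t ∈ Set.Icc u v, ∀ y, Tendsto (fun k => F^[k] t) atTop (𝓝 y) → y = x := by
    intro t ht y hy
    have hmem : y ∈ Set.Icc u v := isClosed_Icc.mem_of_tendsto hy (Eventually.of_forall fun k =>
      hit k t ht)
    refine hfix y hmem ?_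
    have h1 : Tendsto (fun k => F (F^[k] t)) atTop (𝓝 (F y)) :=
      (hcont y hmem).tendsto.comp (tendsto_nhdsWithin_iff.2
        ⟨hy, Eventually.of_forall fun k => hit k t ht⟩)
    have h2 : Tendsto (fun k => F (F^[k] t)) atTop (𝓝 y) := by
      have := hy.comp (tendsto_add_atTop_nat 1)
      refine this.congr fun k => ?_
      exact Function.iterate_succ_apply' F k t
    exact tendsto_nhds_unique h1 h2
  have hmonoit : ∀ k, ∀ s ∈ Set.Icc u v, ∀ t ∈ Set.Icc u v, s ≤ t → F^[k] s ≤ F^[k] t := fun k => by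
    induction k with
    | zero => exact fun s _ t _ hst => hst
    | succ k ih => exact fun s hs t ht hst => ih _ (hmaps s hs) _ (hmaps t ht) (hmono hs ht hst)
  -- The iterates of u increase and those of v decrease; both limits are fixed points in the
  -- interval, hence x, and every other orbit is squeezed between them.
  have hup : Monotone fun k => F^[k] u := monotone_nat_of_le_succ fun k => by
    exact hmonoit k u hul (F u) (hmaps u hul) hu
  have hdown : Antitone fun k => F^[k] v := antitone_nat_of_succ_le fun k => by
    exact hmonoit k (F v) (hmaps v hvr) v hvr hv
  have htu : Tendsto (fun k => F^[k] u) atTop (𝓝 x) := by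
    have h1 := tendsto_atTop_ciSup hup ⟨v, by rintro _ ⟨k, rfl⟩; exact (hit k u hul).2⟩
    rwa [hlim u hul _ h1] at h1
  have htv : Tendsto (fun k => F^[k] v) atTop (𝓝 x) := by
    have h1 := tendsto_atTop_ciInf hdown ⟨u, by rintro _ ⟨k, rfl⟩; exact (hit k v hvr).1⟩
    rwa [hlim v hvr _ h1] at h1
  exact ⟨hmaps, fun t ht => tendsto_pi_nhds.2 fun j =>
    tendsto_of_tendsto_of_tendsto_of_le_of_le (tendsto_pi_nhds.1 htu j) (tendsto_pi_nhds.1 htv j)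
      (fun k => hmonoit k u hul t ht ht.1 j) fun k => hmonoit k t ht v hvr ht.2 j⟩

/-- A locally optimal fixed point has arbitrarily small neighbourhoods that the iteration maps into
themselves and on which it converges. -/
lemma exists_attracting_nhds (h : IsModel a m r) (hx : IsPoints x)
    (hres : residual a m x x = 0) (hmin : IsLocalMin (redCost a m) x)
    {F : (Fin r → ℝ) → (Fin r → ℝ)} (hFx : F x = x)
    (hF' : HasStrictFDerivAt F (Matrix.toLin' (jac a m x)).toContinuousLinearMap x)
    (hF : ∀ᶠ t in 𝓝 x, residual a m t (F t) = 0) {P : (Fin r → ℝ) → Prop}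
    (hP : ∀ᶠ t in 𝓝 x, P t) :
    ∃ U ∈ 𝓝 x, (∀ t ∈ U, P t ∧ F t ∈ U) ∧
      ∀ t ∈ U, Tendsto (fun k => F^[k] t) atTop (𝓝 x) := by
  rcases Nat.eq_zero_or_pos r with rfl | hr
  · refine ⟨Set.univ, univ_mem, fun t _ => ⟨?_, trivial⟩, fun t _ => ?_⟩
    · rw [Subsingleton.elim t x]; exact hP.self_of_nhds
    · exact tendsto_const_nhds.congr fun k => Subsingleton.elim _ _
  obtain ⟨ρ, w, hρ0, hw, hρ⟩ := exists_pos_eigenvector hr h hx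
  have hw0 : w ≠ 0 := fun h0 => (hw ⟨0, hr⟩).ne' (congrFun h0 _)
  obtain ⟨γ, η, hc⟩ := exists_isCurve hr h hx hres hw hρ
    (le_one_of_isLocalMin h hx hres hw0 hρ hmin)
  have hFc : ∀ᶠ t in 𝓝 x, ContinuousAt F t := by
    obtain ⟨K, s, hs, hL⟩ := hF'.exists_lipschitzOnWith
    filter_upwards [eventually_mem_nhds_iff.2 hs] with t ht
    exact hL.continuousOn.continuousAt ht
  have hall : ∀ᶠ t in 𝓝 x, ContinuousAt F t ∧ residual a m t (F t) = 0 ∧ P t ∧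
      (residual a m t t = 0 → t = x) := by
    filter_upwards [hFc, hF, hP, hc.eventually_eq_of_residual h hr hx hw] with t h1 h2 h3 h4
    exact ⟨h1, h2, h3, h4⟩
  have hmono := eventually_monotone hr (jac_pos h hx) hF'
  obtain ⟨V₁, hV₁, V₂, hV₂, hVmono⟩ := mem_nhds_prod_iff.1 hmono
  obtain ⟨ε, hε, hball⟩ := Metric.mem_nhds_iff.1 (inter_mem hall (inter_mem hV₁ hV₂))
  obtain ⟨ε', hε', hstrict⟩ := hc.exists_strictMonoOn hw
  have hright : Tendsto γ (𝓝[>] 0) (𝓝 x) := hc.tendsto.mono_left nhdsWithin_le_nhds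
  have hneg : Tendsto (fun τ : ℝ => -τ) (𝓝[>] 0) (𝓝 0) := by
    simpa using (continuous_neg.tendsto (0 : ℝ)).mono_left nhdsWithin_le_nhds
  have hleft : Tendsto (fun τ => γ (-τ)) (𝓝[>] 0) (𝓝 x) := hc.tendsto.comp hneg
  have hstep := eventually_abs_sub_le h hr hx hres hw hFx hF'.continuousAt hF
  have hIoo : ∀ᶠ τ : ℝ in 𝓝[>] 0, τ ∈ Set.Ioo 0 ε' := Ioo_mem_nhdsGT hε'
  -- A parameter so small that both ends γ(±τ) lie in the ball where F is continuous and monotone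
  -- and has x as its only fixed point, and where the signs of η and the displacement estimate hold.
  obtain ⟨τ, hτ, hsign, hub, hvb, hus, hvs, hur, hvr⟩ := (hIoo.and
    ((hc.eventually_eta_sign h hr hx hres hw hmin).and
    ((hleft.eventually (Metric.ball_mem_nhds x hε)).and
    ((hright.eventually (Metric.ball_mem_nhds x hε)).and
    ((hleft.eventually hstep).and ((hright.eventually hstep).and
    ((hneg.eventually hc.residual_eq).and
      (hc.residual_eq.filter_mono nhdsWithin_le_nhds)))))))).exists
  set u := γ (-τ) with hu
  set v := γ τ with hv
  have hux : ∀ k, u k < x k := fun k => by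
    have := hstrict k (a := -τ) (b := 0) ⟨by linarith [hτ.2], by linarith [hτ.1]⟩
      ⟨by linarith, hε'⟩ (by linarith [hτ.1])
    simpa [hc.zero] using this
  have hxv : ∀ k, x k < v k := fun k => by
    have := hstrict k (a := 0) (b := τ) ⟨by linarith, hε'⟩ ⟨by linarith [hτ.1], hτ.2⟩ hτ.1
    simpa [hc.zero] using this
  have huv : u ≤ v := fun k => ((hux k).trans (hxv k)).le
  have hsub : Set.Icc u v ⊆ Metric.ball x ε := fun y hy => by
    refine (dist_pi_lt_iff hε).2 fun k => ?_
    have h1 := (dist_pi_lt_iff hε).1 hub k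
    have h2 := (dist_pi_lt_iff hε).1 hvb k
    rw [Real.dist_eq, abs_lt] at h1 h2 ⊢
    exact ⟨by linarith [hy.1 k], by linarith [hy.2 k]⟩
  -- The displacement differs from η w by at most |η| w, so it has the sign of η: upwards at the
  -- lower end, downwards at the upper end.
  have hFu : u ≤ F u := fun k => by
    have h1 := abs_le.1 (hus _ hur k)
    rw [abs_of_pos hsign.2] at h1
    linarith [h1.1]
  have hFv : F v ≤ v := fun k => by
    have h1 := abs_le.1 (hvs _ hvr k)
    rw [abs_of_neg hsign.1] at h1
    linarith [h1.2]
  obtain ⟨hmaps, hconv⟩ := tendsto_iterate_of_monotone (x := x) hFu hFv huv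
    (fun s hs t ht hst => hVmono (Set.mk_mem_prod (hball (hsub hs)).2.1 (hball (hsub ht)).2.2) hst)
    (fun t ht => (hball (hsub ht)).1.1.continuousWithinAt) fun y hy hfix => by
      have h1 := (hball (hsub hy)).1
      exact h1.2.2.2 (by have := h1.2.1; rwa [hfix] at this)
  refine ⟨Set.Icc u v, ?_, fun t ht => ⟨(hball (hsub ht)).1.2.2.1, hmaps t ht⟩, hconv⟩
  have hIcc : Set.Icc u v = Set.pi Set.univ fun k => Set.Icc (u k) (v k) :=
    (Set.pi_univ_Icc u v).symm
  rw [hIcc]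
  exact set_pi_mem_nhds Set.finite_univ fun k _ => Icc_mem_nhds (hux k) (hxv k)

end Dynamics

end IRKA

namespace IRKA

open Finset Matrix

/-! ### From the real iteration to IRKA -/

section Attractive

lemma ritzMoment_comp_perm {K : Type*} [Field K] {n r : ℕ} (a m : Fin n → K) (t y : Fin r → K)
    (π : Equiv.Perm (Fin r)) : ritzMoment a m (fun i => t (π i)) y = ritzMoment a m t y := by
  funext k
  simp [ritzMoment, ratio_comp_perm]

lemma tendsto_ratio {𝕜 ι : Type*} [RCLike 𝕜] {r : ℕ} {f : Filter ι} {t y : ι → Fin r → 𝕜}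
    {z : ι → 𝕜} {t₀ y₀ : Fin r → 𝕜} {z₀ : 𝕜} (ht : Tendsto t f (𝓝 t₀)) (hy : Tendsto y f (𝓝 y₀))
    (hz : Tendsto z f (𝓝 z₀)) (hne : ∀ j, z₀ + t₀ j ≠ 0) (S : Finset (Fin r)) :
    Tendsto (fun i => ratio (t i) (y i) S (z i)) f (𝓝 (ratio t₀ y₀ S z₀)) :=
  (tendsto_finsetProd _ fun j _ => hz.sub (tendsto_pi_nhds.1 hy j)).div
    (tendsto_finsetProd _ fun j _ => hz.add (tendsto_pi_nhds.1 ht j))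
    (prod_ne_zero_iff.2 fun j _ => hne j)

variable {n r : ℕ} {a b : Fin n → ℝ} {G : LTISystem ℝ n} {U : Matrix (Fin n) (Fin n) ℝ}

/-- The residues of the reduced model at `t` with poles `-y`. -/
noncomputable def ritzResidue (a m : Fin n → ℝ) (t y : Fin r → ℝ) (k : Fin r) : ℝ :=
  ritzMoment a m t y k ^ 2 / gramDiag a m t y k

/-- The IRKA steps at real positive points, given a zero of the residual. -/
lemma SpectralForm.reduced_of_real (h : SpectralForm G a b U)
    (hM : IsModel a (fun i => b i ^ 2) r) {t y : Fin r → ℝ} (ht : IsPoints t) (hy : IsPoints y)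
    (hres : residual a (fun i => b i ^ 2) t y = 0) (π : Equiv.Perm (Fin r)) :
    G.IsAdmissible (fun i => (t (π i) : ℂ)) ∧
    (∀ s', G.IRKAStep (fun i => (t (π i) : ℂ)) s' ↔
      ∃ π' : Equiv.Perm (Fin r), s' = fun i => (y (π' i) : ℂ)) ∧
    ∀ z : ℂ, (∀ k, z + y k ≠ 0) → (G.reduced (fun i => (t (π i) : ℂ))).transfer z =
      ∑ k, (ritzResidue a (fun i => b i ^ 2) t y k : ℂ) / (z + y k) := by
  set tc : Fin r → ℂ := fun i => (t i : ℂ) with htc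
  set yc : Fin r → ℂ := fun i => (y i : ℂ) with hyc
  have hyi : Function.Injective yc := fun i j hij => hy.inj (Complex.ofReal_injective hij)
  have hti : Function.Injective (fun i => tc (π i)) := fun i j hij =>
    π.injective (ht.inj (Complex.ofReal_injective hij))
  have hta : ∀ j i, tc (π j) + a i ≠ 0 := fun j i => by
    have := (add_pos (ht.pos (π j)) (hM.a_pos i)).ne'
    simp only [htc]
    exact_mod_cast this
  have hrc : residual (cpole a) (cmass b) (fun i => tc (π i)) yc = 0 := by
    rw [residual_comp_perm]
    funext k
    rw [← ofReal_residual, hres]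
    simp
  have hgd : ∀ k, gramDiag (cpole a) (cmass b) (fun i => tc (π i)) yc k =
      ((gramDiag a (fun i => b i ^ 2) t y k : ℝ) : ℂ) := fun k => by
    rw [gramDiag_comp_perm, ofReal_gramDiag]
  have hrm : ∀ k, ritzMoment (cpole a) (cmass b) (fun i => tc (π i)) yc k =
      ((ritzMoment a (fun i => b i ^ 2) t y k : ℝ) : ℂ) := fun k => by
    rw [ritzMoment_comp_perm, ofReal_ritzMoment]
  obtain ⟨h1, h2, h3⟩ := h.reduced_of_residual hti hta hyi hrc fun k => by
    rw [hgd]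
    exact_mod_cast (hM.gramDiag_pos ht.pos y k).ne'
  refine ⟨h1, fun s' => ⟨fun hs' => ?_, ?_⟩, fun z hz => ?_⟩
  · exact exists_perm_of_prod_eq hyi (hs'.2.symm.trans h2)
  · rintro ⟨π', rfl⟩
    refine ⟨h1, h2.trans ?_⟩
    exact (Equiv.prod_comp π' fun i => (Polynomial.X - Polynomial.C (-(yc i)))).symm
  · rw [h3 z hz]
    refine sum_congr rfl fun k _ => ?_
    rw [hgd, hrm, ritzResidue]
    push_cast
    rfl

/-- Families close to distinct real points are real if they are closed under conjugation. -/
lemma exists_real_of_isConjClosed {x : Fin r → ℝ} (hx : Function.Injective x) :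
    ∃ δ > 0, ∀ s : Fin r → ℂ, IsConjClosed s → ∀ σ : Equiv.Perm (Fin r),
      ‖(fun i => s (σ i)) - fun k => (x k : ℂ)‖ < δ →
      ∃ t : Fin r → ℝ, ∀ i, s (σ i) = (t i : ℂ) := by
  -- A radius below half of every gap between the nodes, so that a point cannot be δ-close to two of
  -- them.
  have hev : ∀ᶠ δ : ℝ in 𝓝[>] 0, ∀ i j, i ≠ j → 2 * δ < |x i - x j| := by
    refine eventually_all.2 fun i => eventually_all.2 fun j => ?_
    by_cases hij : i = j
    · exact Eventually.of_forall fun _ h => absurd hij h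
    have hpos : 0 < |x i - x j| := abs_pos.2 (sub_ne_zero.2 (hx.ne hij))
    have : Tendsto (fun δ : ℝ => 2 * δ) (𝓝[>] 0) (𝓝 0) := by
      have h1 : Continuous fun δ : ℝ => 2 * δ := by fun_prop
      have h2 := h1.tendsto 0
      rw [mul_zero] at h2
      exact h2.mono_left nhdsWithin_le_nhds
    exact (this.eventually (gt_mem_nhds hpos)).mono fun _ h _ => h
  obtain ⟨δ, hδ, hδ0⟩ := (hev.and (self_mem_nhdsWithin : Set.Ioi (0 : ℝ) ∈ 𝓝[>] 0)).exists
  refine ⟨δ, hδ0, fun s ⟨π, hπ⟩ σ hs => ⟨fun i => (s (σ i)).re, fun i => ?_⟩⟩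
  have hclose : ∀ i, ‖s (σ i) - x i‖ < δ := fun i => by
    simpa using (norm_le_pi_norm _ i).trans_lt hs
  set j := σ.symm (π (σ i)) with hj
  have hσj : s (σ j) = (starRingEnd ℂ) (s (σ i)) := by rw [hπ, hj, Equiv.apply_symm_apply]
  have h1 : ‖s (σ j) - x i‖ < δ := by
    have : s (σ j) - x i = (starRingEnd ℂ) (s (σ i) - x i) := by
      rw [hσj, map_sub, Complex.conj_ofReal]
    rw [this, RCLike.norm_conj]
    exact hclose i
  -- The conjugate of the point near x_i is one of the points and is also near the real number x_i,
  -- so it is that point itself.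
  have hji : i = j := by
    by_contra hne
    have h2 := hδ i j hne
    have h3 : |x i - x j| = ‖(s (σ j) - x j) - (s (σ j) - x i)‖ := by
      rw [sub_sub_sub_cancel_left, ← Complex.ofReal_sub, Complex.norm_real, Real.norm_eq_abs]
    have h4 := norm_sub_le (s (σ j) - x j) (s (σ j) - x i)
    have h5 := hclose j
    linarith
  rw [← hji] at hσj
  exact (Complex.conj_eq_iff_re.1 hσj.symm).symm

lemma unorderedDist_nonneg (s t : Fin r → ℂ) : 0 ≤ unorderedDist s t :=
  Real.iInf_nonneg fun _ => norm_nonneg _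

lemma unorderedDist_le (s t : Fin r → ℂ) (π : Equiv.Perm (Fin r)) :
    unorderedDist s t ≤ ‖(fun i => s (π i)) - t‖ :=
  ciInf_le ⟨0, by rintro _ ⟨π, rfl⟩; exact norm_nonneg _⟩ π

lemma h2Norm_nonneg (F : ℂ → ℂ) : 0 ≤ h2Norm F := Real.sqrt_nonneg _

/-- Continuous dependence of real models on their residues and poles. -/
lemma tendsto_h2Norm_sub {ψ y : ℕ → Fin r → ℝ} {ψ₀ y₀ : Fin r → ℝ} (hy : ∀ k i, 0 < y k i)
    (hy₀ : ∀ i, 0 < y₀ i) (hψ : Tendsto ψ atTop (𝓝 ψ₀)) (hyt : Tendsto y atTop (𝓝 y₀))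
    {H : ℕ → ℂ → ℂ} {H₀ : ℂ → ℂ}
    (hH : ∀ k (z : ℂ), (∀ i, z + y k i ≠ 0) → H k z = ∑ i, (ψ k i : ℂ) / (z + y k i))
    (hH₀ : ∀ z : ℂ, (∀ i, z + y₀ i ≠ 0) → H₀ z = ∑ i, (ψ₀ i : ℂ) / (z + y₀ i)) :
    Tendsto (fun k => h2Norm fun z => H k z - H₀ z) atTop (𝓝 0) := by
  have hne : ∀ (ω : ℝ) {c : ℝ}, 0 < c → Complex.I * ω + c ≠ 0 := fun ω c hc h0 => by
    have := congrArg Complex.re h0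
    simp at this
    exact hc.ne' this
  set e : (Fin r → ℝ) → Fin r ⊕ Fin r → ℝ := fun ψ => Sum.elim ψ (-ψ₀) with he
  set α : (Fin r → ℝ) → Fin r ⊕ Fin r → ℝ := fun y => Sum.elim y y₀ with hα
  have hαpos : ∀ y : Fin r → ℝ, (∀ i, 0 < y i) → ∀ i, 0 < α y i := fun y hy i => by
    rcases i with i | i
    · exact hy i
    · exact hy₀ i
  have hsq : ∀ k, h2Norm (fun z => H k z - H₀ z) ^ 2 =
      ∑ i, ∑ j, e (ψ k) i * e (ψ k) j / (α (y k) i + α (y k) j) := fun k => by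
    refine h2Norm_sq _ _ (hαpos _ (hy k)) _ fun ω => ?_
    rw [hH k _ fun i => hne ω (hy k i), hH₀ _ fun i => hne ω (hy₀ i), Fintype.sum_sum_type]
    simp only [he, hα, Sum.elim_inl, Sum.elim_inr, Pi.neg_apply, Complex.ofReal_neg, neg_div,
      sum_neg_distrib]
    ring
  have hsq0 : ∑ i, ∑ j, e ψ₀ i * e ψ₀ j / (α y₀ i + α y₀ j) = 0 := by
    rw [← h2Norm_sq _ _ (hαpos _ hy₀) (fun _ => 0) fun ω => ?_]
    · simp [h2Norm]
    · rw [Fintype.sum_sum_type]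
      simp only [he, hα, Sum.elim_inl, Sum.elim_inr, Pi.neg_apply, Complex.ofReal_neg, neg_div,
        sum_neg_distrib]
      ring
  have het : ∀ i, Tendsto (fun k => e (ψ k) i) atTop (𝓝 (e ψ₀ i)) := fun i => by
    rcases i with i | i
    · exact tendsto_pi_nhds.1 hψ i
    · exact tendsto_const_nhds
  have hαt : ∀ i, Tendsto (fun k => α (y k) i) atTop (𝓝 (α y₀ i)) := fun i => by
    rcases i with i | i
    · exact tendsto_pi_nhds.1 hyt i
    · exact tendsto_const_nhds
  have hlim : Tendsto (fun k => h2Norm (fun z => H k z - H₀ z) ^ 2) atTop (𝓝 0) := by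
    simp_rw [hsq]
    rw [← hsq0]
    exact tendsto_finsetSum _ fun i _ => tendsto_finsetSum _ fun j _ =>
      ((het i).mul (het j)).div ((hαt i).add (hαt j))
        (add_pos (hαpos _ hy₀ i) (hαpos _ hy₀ j)).ne'
  have := (Real.continuous_sqrt.tendsto 0).comp hlim
  rw [Real.sqrt_zero] at this
  exact this.congr fun k => Real.sqrt_sq (h2Norm_nonneg _)

lemma tendsto_ritzResidue {m : Fin n → ℝ} (hM : IsModel a m r) {x : Fin r → ℝ} (hx : IsPoints x)
    {t y : ℕ → Fin r → ℝ} (ht : Tendsto t atTop (𝓝 x)) (hy : Tendsto y atTop (𝓝 x)) :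
    Tendsto (fun k => ritzResidue a m (t k) (y k)) atTop (𝓝 (ritzResidue a m x x)) := by
  have hratio : ∀ i S, Tendsto (fun k => ratio (t k) (y k) S (a i)) atTop
      (𝓝 (ratio x x S (a i))) := fun i S =>
    tendsto_ratio ht hy tendsto_const_nhds (hM.add_ne hx.pos i) S
  refine tendsto_pi_nhds.2 fun l => Tendsto.div (Tendsto.pow ?_ 2) ?_
    (hM.gramDiag_pos hx.pos x l).ne'
  · exact tendsto_finsetSum _ fun i _ => (hratio i _).const_mul _
  · exact tendsto_finsetSum _ fun i _ => ((hratio i _).pow 2).const_mul _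

/-- Locally optimal fixed points are locally attractive. -/
theorem SpectralForm.isLocallyAttractive (h : SpectralForm G a b U)
    (hM : IsModel a (fun i => b i ^ 2) r) {x : Fin r → ℝ} (hx : IsPoints x)
    (hres : residual a (fun i => b i ^ 2) x x = 0)
    (hmin : IsLocalMin (redCost a fun i => b i ^ 2) x) :
    G.IsLocallyAttractive fun k => (x k : ℂ) := by
  obtain ⟨F, hFx, hF', hF, -⟩ := exists_iteration (hM.add_ne hx.pos) hx.isNode
    (fun k => (hM.gramDiag_pos hx.pos x k).ne') hres
  have hFt : Tendsto F (𝓝 x) (𝓝 x) := by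
    have := hF'.continuousAt.tendsto
    rwa [hFx] at this
  obtain ⟨V, hV, hVP, hconv⟩ := exists_attracting_nhds hM hx hres hmin hFx hF' hF
    (hx.eventually.and ((hFt.eventually hx.eventually).and hF))
  obtain ⟨δ₁, hδ₁, hball⟩ := Metric.mem_nhds_iff.1 hV
  obtain ⟨δ₂, hδ₂, hreal⟩ := exists_real_of_isConjClosed hx.inj
  have hit : ∀ k, ∀ t ∈ V, F^[k] t ∈ V := fun k => by
    induction k with
    | zero => exact fun t ht => ht
    | succ k ih => exact fun t ht => ih _ (hVP t ht).2
  have hstep : ∀ t ∈ V, ∀ π : Equiv.Perm (Fin r), _ := fun t ht π =>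
    h.reduced_of_real hM (hVP t ht).1.1 (hVP t ht).1.2.1 (hVP t ht).1.2.2 π
  refine ⟨min δ₁ δ₂, lt_min hδ₁ hδ₂, fun s₀ _ hconj hdist => ?_⟩
  obtain ⟨σ₀, hσ₀⟩ := exists_lt_of_ciInf_lt hdist
  obtain ⟨t₀, ht₀⟩ := hreal s₀ hconj σ₀ (hσ₀.trans_le (min_le_right _ _))
  have hs₀ : s₀ = fun i => (t₀ (σ₀.symm i) : ℂ) := funext fun i => by
    rw [← ht₀, Equiv.apply_symm_apply]
  have ht₀V : t₀ ∈ V := hball <| (dist_pi_lt_iff hδ₁).2 fun k => by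
    have h1 := (norm_le_pi_norm _ k).trans_lt (hσ₀.trans_le (min_le_left _ _))
    simp only [Pi.sub_apply, ht₀, ← Complex.ofReal_sub, Complex.norm_real] at h1
    exact h1
  -- The order of the poles is free at each step, but each step depends on the points only as a set;
  -- every run is therefore a reordering of the orbit of F.
  have hrun : ∀ (N : ℕ) (σ : ℕ → Fin r → ℂ), σ 0 = s₀ →
      (∀ k, k < N → G.IRKAStep (σ k) (σ (k + 1))) → ∀ k ≤ N,
        ∃ π : Equiv.Perm (Fin r), σ k = fun i => ((F^[k] t₀) (π i) : ℂ) := by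
    intro N σ h0 hσ k
    induction k with
    | zero => exact fun _ => ⟨σ₀.symm, h0.trans hs₀⟩
    | succ k ih =>
      intro hk
      obtain ⟨π, hπ⟩ := ih (by omega)
      have h1 := hσ k (by omega)
      rw [hπ] at h1
      obtain ⟨π', hπ'⟩ := ((hstep _ (hit k t₀ ht₀V) π).2.1 _).1 h1
      exact ⟨π', by rw [hπ', Function.iterate_succ_apply']⟩
  refine ⟨fun N σ h0 hσ => ?_, ⟨fun k i => ((F^[k] t₀) (σ₀.symm i) : ℂ), hs₀.symm, fun k => ?_⟩,
    fun σ hσ => ?_⟩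
  · obtain ⟨π, hπ⟩ := hrun N σ h0 hσ N le_rfl
    rw [hπ]
    exact (hstep _ (hit N t₀ ht₀V) π).1
  · refine ((hstep _ (hit k t₀ ht₀V) σ₀.symm).2.1 _).2 ⟨σ₀.symm, ?_⟩
    simp only [Function.iterate_succ_apply']
  · choose π hπ using fun k => hrun k σ hσ.1 (fun j _ => hσ.2 j) k le_rfl
    have hlim := hconv t₀ ht₀V
    have hlim' : Tendsto (fun k => F (F^[k] t₀)) atTop (𝓝 x) := hFt.comp hlim
    constructor
    · refine squeeze_zero (fun k => unorderedDist_nonneg _ _)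
        (fun k => unorderedDist_le _ _ (π k).symm) ?_
      rw [← tendsto_zero_iff_norm_tendsto_zero (f := fun k => (fun i => σ k ((π k).symm i)) -
        fun k => (x k : ℂ))]
      refine tendsto_pi_nhds.2 fun i => ?_
      have h1 : Tendsto (fun k => (((F^[k] t₀) i - x i : ℝ) : ℂ)) atTop (𝓝 ((x i - x i : ℝ) : ℂ)) :=
        (Complex.continuous_ofReal.tendsto _).comp ((tendsto_pi_nhds.1 hlim i).sub_const _)
      rw [sub_self, Complex.ofReal_zero] at h1
      refine h1.congr fun k => ?_
      rw [Pi.sub_apply, hπ k]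
      simp
    · refine tendsto_h2Norm_sub (fun k i => (hVP _ (hit k t₀ ht₀V)).1.2.1.pos i) hx.pos
        (tendsto_ritzResidue hM hx hlim hlim') hlim' (fun k z hz => ?_) fun z hz => ?_
      · rw [hπ k]
        exact (hstep _ (hit k t₀ ht₀V) (π k)).2.2 z hz
      · exact (h.reduced_of_real hM hx hx hres 1).2.2 z hz

end Attractive

end IRKA

namespace IRKA

open Finset Matrix

/-! ### Pole-residue parameters and the reduced error -/

section Bridge

variable {n r : ℕ} {a b : Fin n → ℝ} {G : LTISystem ℝ n} {U : Matrix (Fin n) (Fin n) ℝ}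
  {x : Fin r → ℝ}

lemma I_mul_add_ne (ω : ℝ) {c : ℝ} (hc : 0 < c) : Complex.I * ω + c ≠ 0 := fun h0 => by
  have := congrArg Complex.re h0
  simp at this
  exact hc.ne' this

/-- Pole-residue parameters of a model with real residues `ψ` and real poles `-y`. -/
noncomputable def realParam (ψ y : Fin r → ℝ) : (Fin r → ℂ) × (Fin r → ℂ) :=
  (fun k => (ψ k : ℂ), -fun k => (y k : ℂ))

lemma realParam_mem (ψ y : Fin r → ℝ) : realParam ψ y ∈ realParams r :=
  ⟨1, fun i => by simp [realParam]⟩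

lemma SpectralForm.h2Cost_realParam (h : SpectralForm G a b U) (ha : ∀ i, 0 < a i)
    (ψ : Fin r → ℝ) {y : Fin r → ℝ} (hy : ∀ k, 0 < y k) :
    G.h2Cost (realParam ψ y) = errCost a (fun i => b i ^ 2) ψ y := by
  rw [LTISystem.h2Cost, h2Norm_sq (Sum.elim (fun i => b i ^ 2) (-ψ)) (Sum.elim a y) ?_ _
    fun ω => ?_]
  · rw [Fintype.sum_sum_type]
    simp only [Fintype.sum_sum_type, Sum.elim_inl, Sum.elim_inr, Pi.neg_apply, errCost,
      sum_add_distrib]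
    have e1 : ∑ i, ∑ k, b i ^ 2 * -ψ k / (a i + y k) = -∑ k, ψ k * ∑ i, b i ^ 2 / (y k + a i) := by
      rw [sum_comm, ← sum_neg_distrib]
      refine sum_congr rfl fun k _ => ?_
      rw [mul_sum, ← sum_neg_distrib]
      exact sum_congr rfl fun i _ => by rw [add_comm]; ring
    have e2 : ∑ k, ∑ i, -ψ k * b i ^ 2 / (y k + a i) = -∑ k, ψ k * ∑ i, b i ^ 2 / (y k + a i) := by
      rw [← sum_neg_distrib]
      refine sum_congr rfl fun k _ => ?_
      rw [mul_sum, ← sum_neg_distrib]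
      exact sum_congr rfl fun i _ => by ring
    have e3 : ∑ k, ∑ l, -ψ k * -ψ l / (y k + y l) = ∑ k, ∑ l, ψ k * ψ l / (y k + y l) := by
      simp only [neg_mul_neg]
    rw [e1, e2, e3]
    ring
  · rintro (i | k)
    · exact ha i
    · exact hy k
  · rw [h.transfer_eq fun i => I_mul_add_ne ω (ha i), Fintype.sum_sum_type, poleResidue]
    simp only [realParam, Sum.elim_inl, Sum.elim_inr, Pi.neg_apply, Complex.ofReal_neg, neg_div,
      sum_neg_distrib, neg_neg, Complex.ofReal_pow, sub_eq_add_neg]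

lemma tendsto_optResidue {m : Fin n → ℝ} (hM : IsModel a m r) (hx : IsPoints x) :
    Tendsto (optResidue a m) (𝓝 x) (𝓝 (optResidue a m x)) := by
  refine tendsto_pi_nhds.2 fun k => Tendsto.mul ?_ (tendsto_finsetSum _ fun i _ => ?_)
  · refine Tendsto.inv₀ (tendsto_ratio tendsto_id tendsto_id ((continuous_apply k).tendsto x)
      (fun j => (add_pos (hx.pos k) (hx.pos j)).ne') _) ?_
    exact fun h0 => hx.isNode.bweight_ne k (inv_eq_zero.2 h0)
  · exact (tendsto_ratio tendsto_id tendsto_id tendsto_const_nhds (hM.add_ne hx.pos i) _).const_mul _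

lemma norm_ofReal_pi (v : Fin r → ℝ) : ‖fun k => (v k : ℂ)‖ = ‖v‖ := by
  refine le_antisymm ((pi_norm_le_iff_of_nonneg (norm_nonneg _)).2 fun k => ?_)
    ((pi_norm_le_iff_of_nonneg (norm_nonneg _)).2 fun k => ?_)
  · rw [Complex.norm_real]
    exact norm_le_pi_norm v k
  · rw [← Complex.norm_real]
    exact norm_le_pi_norm (fun k => (v k : ℂ)) k

/-- Growth of the error in the pole-residue parameters implies growth of the reduced error. -/
lemma SpectralForm.growth_redCost (h : SpectralForm G a b U)
    (hM : IsModel a (fun i => b i ^ 2) r) (hx : IsPoints x) {κ : ℝ} (hκ : 0 ≤ κ)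
    (hg : ∀ᶠ q in 𝓝[realParams r] (realParam (optResidue a (fun i => b i ^ 2) x) x),
      G.h2Cost (realParam (optResidue a (fun i => b i ^ 2) x) x) +
        κ * ‖q - realParam (optResidue a (fun i => b i ^ 2) x) x‖ ^ 2 ≤ G.h2Cost q) :
    ∀ᶠ y in 𝓝 x, redCost a (fun i => b i ^ 2) x + κ * ‖y - x‖ ^ 2 ≤
      redCost a (fun i => b i ^ 2) y := by
  set ψ := optResidue a (fun i => b i ^ 2) with hψ
  have hofReal : ∀ {g : (Fin r → ℝ) → Fin r → ℝ} {g₀ : Fin r → ℝ}, Tendsto g (𝓝 x) (𝓝 g₀) →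
      Tendsto (fun y => fun k => (g y k : ℂ)) (𝓝 x) (𝓝 fun k => (g₀ k : ℂ)) := fun hg =>
    tendsto_pi_nhds.2 fun k => (Complex.continuous_ofReal.tendsto _).comp (tendsto_pi_nhds.1 hg k)
  -- The reduced error is the full error restricted to the section y ↦ (optimal residues, -y). Since
  -- the pole component has norm ‖y - x‖, growth constants carry over.
  have ht : Tendsto (fun y => realParam (ψ y) y) (𝓝 x) (𝓝[realParams r] (realParam (ψ x) x)) :=
    tendsto_nhdsWithin_iff.2 ⟨(hofReal (tendsto_optResidue hM hx)).prodMk_nhds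
      (hofReal tendsto_id).neg, Eventually.of_forall fun y => realParam_mem _ _⟩
  filter_upwards [ht.eventually hg, hx.eventually] with y h1 hy
  rw [h.h2Cost_realParam hM.a_pos _ hx.pos, h.h2Cost_realParam hM.a_pos _ hy.pos] at h1
  refine le_trans ?_ h1
  have h2 : ‖y - x‖ ≤ ‖realParam (ψ y) y - realParam (ψ x) x‖ := by
    refine le_trans (le_of_eq ?_) (norm_snd_le _)
    rw [← norm_ofReal_pi, ← norm_neg]
    congr 1
    funext k
    simp [realParam]
    ring
  have h3 : ‖y - x‖ ^ 2 ≤ ‖realParam (ψ y) y - realParam (ψ x) x‖ ^ 2 :=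
    pow_le_pow_left₀ (norm_nonneg _) h2 2
  have := mul_le_mul_of_nonneg_left h3 hκ
  unfold redCost
  linarith

lemma ritzResidue_self {m : Fin n → ℝ} (hM : IsModel a m r) (hx : IsPoints x)
    (hres : residual a m x x = 0) : ritzResidue a m x x = optResidue a m x := by
  funext k
  have := (hM.gramDiag_pos hx.pos x k).ne'
  rw [optResidue_eq hM hx hres, ritzResidue, hx.isNode.ritzMoment_eq (hM.add_ne hx.pos) hres]
  field_simp

lemma isNode_ofReal (hx : IsPoints x) : IsNode fun k => (x k : ℂ) where
  inj i j hij := hx.inj (Complex.ofReal_injective hij)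
  add_ne i j := by
    have := (add_pos (hx.pos i) (hx.pos j)).ne'
    exact_mod_cast this

/-- The residues of the reduced model at a fixed point are the optimal ones. -/
lemma SpectralForm.residues_eq (h : SpectralForm G a b U)
    (hM : IsModel a (fun i => b i ^ 2) r) (hx : IsPoints x)
    (hres : residual a (fun i => b i ^ 2) x x = 0) {φ : Fin r → ℂ}
    (hφ : G.HasResidues (fun k => (x k : ℂ)) φ)
    (hstep : G.IRKAStep (fun k => (x k : ℂ)) fun k => (x k : ℂ)) :
    φ = fun k => (optResidue a (fun i => b i ^ 2) x k : ℂ) := by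
  have hnode := isNode_ofReal hx
  -- Evaluating both pole-residue forms at the nodes z = x_i gives a Cauchy system for the
  -- difference of the residues, which is invertible.
  have hz : cauchy (fun k => (x k : ℂ)) *ᵥ
      (φ - fun k => (optResidue a (fun i => b i ^ 2) x k : ℂ)) = 0 := by
    funext i
    have hdet : ((G.reduced fun k => (x k : ℂ)).pencil (x i)).det ≠ 0 := by
      have h1 := eval_charpoly (G.reduced fun k => (x k : ℂ)).A (x i : ℂ)
      rw [scalar_apply, ← smul_one_eq_diagonal] at h1
      rw [LTISystem.pencil, ← h1, hstep.2, Polynomial.eval_prod]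
      refine prod_ne_zero_iff.2 fun j _ => ?_
      simpa using hnode.add_ne i j
    have h2 := hφ _ hdet
    have h3 := (h.reduced_of_real hM hx hx hres 1).2.2 (x i) fun k => hnode.add_ne i k
    rw [ritzResidue_self hM hx hres] at h3
    simp only [Equiv.Perm.coe_one, id] at h3
    rw [h2, poleResidue] at h3
    simp only [Pi.neg_apply, sub_neg_eq_add] at h3
    simp only [mulVec, dotProduct, cauchy, of_apply, Pi.sub_apply, mul_sub, sum_sub_distrib,
      Pi.zero_apply]
    rw [sub_eq_zero]
    simpa only [div_eq_inv_mul] using h3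
  obtain ⟨u, hu⟩ := hnode.isUnit_cauchy
  rw [← hu] at hz
  have h4 : (u⁻¹).val *ᵥ (u.val *ᵥ (φ - fun k => (optResidue a (fun i => b i ^ 2) x k : ℂ))) = 0 := by
    rw [hz, mulVec_zero]
  rw [mulVec_mulVec, Units.inv_mul, one_mulVec] at h4
  exact sub_eq_zero.1 h4

end Bridge

end IRKA

namespace IRKA

open Finset Matrix

/-! ### Spectrum of the Jacobian and its second-order form -/

section Jacobian

lemma iteratedDeriv_two_sq_mul {g : ℂ → ℂ} {c : ℂ} (hg : AnalyticAt ℂ g c) :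
    iteratedDeriv 2 (fun z => (z - c) ^ 2 * g z) c = 2 * g c := by
  have h1 : deriv (fun z => (z - c) ^ 2 * g z) =ᶠ[𝓝 c]
      fun z => (z - c) * (2 * g z + (z - c) * deriv g z) := by
    filter_upwards [hg.eventually_analyticAt] with z hz
    have h2 : HasDerivAt (fun z => (z - c) ^ 2 * g z)
        ((2 : ℕ) * (z - c) ^ (2 - 1) * 1 * g z + (z - c) ^ 2 * deriv g z) z :=
      (((hasDerivAt_id z).sub_const c).pow 2).mul hz.differentiableAt.hasDerivAt
    rw [h2.deriv]
    push_cast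
    ring
  have h3 : DifferentiableAt ℂ (fun z => 2 * g z + (z - c) * deriv g z) c :=
    (hg.differentiableAt.const_mul 2).add
      (((differentiableAt_id).sub_const c).mul hg.deriv.differentiableAt)
  have h4 : HasDerivAt (fun z => (z - c) * (2 * g z + (z - c) * deriv g z))
      (1 * (2 * g c + (c - c) * deriv g c) + (c - c) * deriv (fun z => 2 * g z + (z - c) * deriv g z) c)
      c := ((hasDerivAt_id c).sub_const c).mul h3.hasDerivAt
  rw [iteratedDeriv_succ, iteratedDeriv_one, h1.deriv_eq, h4.deriv]
  ring

variable {n r : ℕ} {a b : Fin n → ℝ} {G : LTISystem ℝ n} {U : Matrix (Fin n) (Fin n) ℝ}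
  {x : Fin r → ℝ}

lemma analyticAt_ratio (t y : Fin r → ℂ) (S : Finset (Fin r)) {z : ℂ}
    (hz : ∀ j, z + t j ≠ 0) : AnalyticAt ℂ (ratio t y S) z := by
  refine AnalyticAt.div (Finset.analyticAt_fun_prod _ fun j _ => ?_)
    (Finset.analyticAt_fun_prod _ fun j _ => ?_) (prod_ne_zero_iff.2 fun j _ => hz j)
  · exact analyticAt_id.sub analyticAt_const
  · exact analyticAt_id.add analyticAt_const

/-- The second derivative of the interpolation error at the interpolation points. -/
lemma SpectralForm.matE_eq (h : SpectralForm G a b U)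
    (hM : IsModel a (fun i => b i ^ 2) r) (hx : IsPoints x)
    (hres : residual a (fun i => b i ^ 2) x x = 0) :
    G.matE (fun k => (x k : ℂ)) = diagonal fun l =>
      2 * ((bweight (fun k => (x k : ℂ)) l)⁻¹ ^ 2 *
        errWeight (cpole a) (cmass b) (fun k => (x k : ℂ)) (fun k => (x k : ℂ)) l) := by
  set s : Fin r → ℂ := fun k => (x k : ℂ) with hs
  have hnode : IsNode s := isNode_ofReal hx
  have hax : ∀ i j, cpole a i + s j ≠ 0 := fun i j => by
    have := hM.add_ne hx.pos i j
    simp only [cpole, hs]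
    exact_mod_cast this
  have hrc : residual (cpole a) (cmass b) s s = 0 := by
    funext k
    rw [hs, ← ofReal_residual, hres]
    simp
  rw [LTISystem.matE]
  congr 1
  funext l
  set g : ℂ → ℂ := fun z => ratio s s (univ.erase l) z ^ 2 *
    ∑ i, cmass b i * (blaschke s (cpole a i) ^ 2 / (cpole a i + z)) with hg
  have hzx : ∀ᶠ z in 𝓝 (s l), ∀ j, z + s j ≠ 0 := hnode.eventually_add_ne l
  have hza : ∀ᶠ z in 𝓝 (s l), ∀ i, z + cpole a i ≠ 0 := by
    refine eventually_all.2 fun i => ?_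
    have hc : ContinuousAt (fun z : ℂ => z + cpole a i) (s l) := by fun_prop
    exact hc.eventually_ne (by rw [add_comm]; exact hax i l)
  -- With vanishing residual the error is B(z)² times an analytic factor; one squared factor (z -
  -- s_l)² is split off, so the second derivative can be read from the cofactor.
  have hev : (fun z => G.complexify.transfer z - (G.reduced s).transfer z) =ᶠ[𝓝 (s l)]
      fun z => (z - s l) ^ 2 * g z := by
    filter_upwards [hzx, hza] with z h1 h2
    have h3 := (h.reduced_of_real hM hx hx hres 1).2.2 z h1
    simp only [Equiv.Perm.coe_one, id] at h3
    have h4 : ∀ k, (ritzResidue a (fun i => b i ^ 2) x x k : ℂ) =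
        bweight s k * ritzMoment (cpole a) (cmass b) s s k := fun k => by
      rw [ritzResidue_self hM hx hres, optResidue_eq hM hx hres, hnode.ritzMoment_eq hax hrc, hs,
        ← ofReal_gramDiag, bweight, bweight, ← ofReal_ratio]
      push_cast
      ring
    simp only [h4] at h3
    rw [h3, h.transfer_eq h2]
    have h5 := hnode.interpolation_error (m := cmass b) hax h2 h1
    rw [hnode.sum_blaschke hax h2 h1, hrc] at h5
    simp only [Pi.zero_apply, mul_zero, sum_const_zero, add_zero] at h5
    refine Eq.trans h5 ?_
    rw [hg, blaschke_eq s l z]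
    ring
  have hgan : AnalyticAt ℂ g (s l) := by
    refine ((analyticAt_ratio s s _ fun j => hnode.add_ne l j).pow 2).mul
      (Finset.analyticAt_fun_sum _ fun i _ => ?_)
    exact analyticAt_const.mul (analyticAt_const.div (analyticAt_const.add analyticAt_id) (hax i l))
  rw [hev.iteratedDeriv_eq, iteratedDeriv_two_sq_mul hgan]
  simp only [hg, bweight, inv_inv, errWeight, blaschke]

lemma diagonal_inv {φ : Fin r → ℂ} (hφ : ∀ k, φ k ≠ 0) :
    (diagonal φ)⁻¹ = diagonal fun k => (φ k)⁻¹ := by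
  refine inv_eq_right_inv ?_
  rw [diagonal_mul_diagonal, ← diagonal_one]
  congr 1
  funext k
  exact mul_inv_cancel₀ (hφ k)

/-- The Jacobian in terms of the matrices of the second-order analysis. -/
lemma SpectralForm.jac_eq (h : SpectralForm G a b U)
    (hM : IsModel a (fun i => b i ^ 2) r) (hx : IsPoints x)
    (hres : residual a (fun i => b i ^ 2) x x = 0) {φ : Fin r → ℂ}
    (hφ : φ = fun k => (optResidue a (fun i => b i ^ 2) x k : ℂ)) :
    (∀ k, φ k ≠ 0) ∧ jac (cpole a) (cmass b) (fun k => (x k : ℂ)) =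
      (diagonal φ)⁻¹ * ((matSc (-fun k => (x k : ℂ)))⁻¹ * G.matK (fun k => (x k : ℂ)) φ) *
        diagonal φ := by
  set s : Fin r → ℂ := fun k => (x k : ℂ) with hs
  have hnode : IsNode s := isNode_ofReal hx
  have hd : ∀ k, gramDiag (cpole a) (cmass b) s s k ≠ 0 := fun k => by
    rw [hs, ← ofReal_gramDiag]
    exact_mod_cast (hM.gramDiag_pos hx.pos x k).ne'
  have hφk : ∀ k, φ k = bweight s k ^ 2 * gramDiag (cpole a) (cmass b) s s k := fun k => by
    simp only [hφ]
    rw [optResidue_eq hM hx hres, hs, ← ofReal_gramDiag, bweight, bweight, ← ofReal_ratio]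
    push_cast
    ring
  have hφ0 : ∀ k, φ k ≠ 0 := fun k => by
    rw [hφk]
    exact mul_ne_zero (pow_ne_zero 2 (hnode.bweight_ne k)) (hd k)
  refine ⟨hφ0, ?_⟩
  rw [LTISystem.matK, h.matE_eq hM hx hres, hnode.matSc_inv, diagonal_inv hφ0]
  ext k l
  simp only [Matrix.mul_assoc, diagonal_mul_diagonal, diagonal_mul, mul_diagonal, jac, of_apply,
    cauchy, Pi.pow_apply]
  have h1 := hφ0 l
  have h2 := hd k
  have h3 := hnode.bweight_ne k
  have h4 := hnode.bweight_ne l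
  have h5 := hnode.add_ne k l
  rw [hφk k, ← hs]
  field_simp

lemma ofReal_jac (k l : Fin r) : jac (cpole a) (cmass b) (fun k => (x k : ℂ)) k l =
    ((jac a (fun i => b i ^ 2) x k l : ℝ) : ℂ) := by
  simp only [jac, of_apply, ← ofReal_gramDiag, ← ofReal_errWeight]
  push_cast
  rfl

/-- The weighted symmetric form of the Jacobian. -/
lemma gramDiag_mul_jac {m : Fin n → ℝ} (hM : IsModel a m r) (hx : IsPoints x) (k l : Fin r) :
    errWeight a m x x k * gramDiag a m x x k * jac a m x k l =
      2 * (errWeight a m x x k * errWeight a m x x l / (x k + x l)) := by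
  have := (hM.gramDiag_pos hx.pos x k).ne'
  simp only [jac, of_apply]
  field_simp

/-- Pairing J u = ρ u with e d u, where e and d are the error and Gram weights, gives ρ ∑ e d u² = 2
times the positive definite Cauchy form at e u. -/
lemma pos_of_jac_eigenvector {m : Fin n → ℝ} (hM : IsModel a m r) (hx : IsPoints x)
    {u : Fin r → ℝ} (hu : u ≠ 0) {ρ : ℝ} (hρ : jac a m x *ᵥ u = ρ • u) : 0 < ρ := by
  set κ := errWeight a m x x with hκ
  set d := gramDiag a m x x with hd
  have hκ0 : ∀ k, 0 < κ k := hM.errWeight_pos hx.pos x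
  have hd0 : ∀ k, 0 < d k := hM.gramDiag_pos hx.pos x
  have hη : (fun k => κ k * u k) ≠ 0 := fun h0 => hu (funext fun k =>
    (mul_eq_zero.1 (congrFun h0 k)).resolve_left (hκ0 k).ne')
  have hform := hx.cauchy_form_pos hη
  have h1 : ρ * ∑ k, κ k * d k * u k ^ 2 =
      2 * ∑ i, ∑ j, κ i * u i * (κ j * u j) / (x i + x j) := by
    rw [mul_sum, mul_sum]
    refine sum_congr rfl fun k _ => ?_
    have h2 : ρ * u k = ∑ l, jac a m x k l * u l := (congrFun hρ k).symm
    have h3 : ρ * (κ k * d k * u k ^ 2) = κ k * d k * u k * (ρ * u k) := by ring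
    rw [h3, h2, mul_sum, mul_sum]
    refine sum_congr rfl fun l _ => ?_
    linear_combination u k * u l * gramDiag_mul_jac hM hx k l
  have h4 : 0 ≤ ∑ k, κ k * d k * u k ^ 2 := sum_nonneg fun k _ =>
    mul_nonneg (mul_pos (hκ0 k) (hd0 k)).le (sq_nonneg _)
  by_contra hcon
  have := mul_nonpos_of_nonpos_of_nonneg (not_lt.1 hcon) h4
  linarith

/-- The eigenvalues of the Jacobian are real, with real eigenvectors. -/
lemma exists_real_eigenvector (hM : IsModel a (fun i => b i ^ 2) r) (hx : IsPoints x) {μ : ℂ}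
    (hμ : Module.End.HasEigenvalue
      (Matrix.toLin' (jac (cpole a) (cmass b) fun k => (x k : ℂ))) μ) :
    ∃ (ρ : ℝ) (u : Fin r → ℝ), μ = ρ ∧ u ≠ 0 ∧ jac a (fun i => b i ^ 2) x *ᵥ u = ρ • u := by
  obtain ⟨v, hv⟩ := hμ.exists_hasEigenvector
  have hv0 : v ≠ 0 := hv.2
  have hJ : ∀ k, ∑ l, ((jac a (fun i => b i ^ 2) x k l : ℝ) : ℂ) * v l = μ * v k := fun k => by
    have := congrFun hv.apply_eq_smul k
    simp only [← ofReal_jac]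
    simpa [mulVec, dotProduct] using this
  set m : Fin n → ℝ := fun i => b i ^ 2 with hm
  set κ := errWeight a m x x with hκ
  set d := gramDiag a m x x with hd
  have hκ0 : ∀ k, 0 < κ k := hM.errWeight_pos hx.pos x
  have hd0 : ∀ k, 0 < d k := hM.gramDiag_pos hx.pos x
  -- The value of conj(v)ᵀ diag(e d) J v. The weighted Jacobian is real symmetric, so Q is real; it
  -- also equals μ Θ with Θ > 0, so μ is real. The real or the imaginary part of v is then a real
  -- eigenvector.
  set Q : ℂ := ∑ k, ∑ l, ((2 * (κ k * κ l / (x k + x l)) : ℝ) : ℂ) *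
    ((starRingEnd ℂ) (v k) * v l) with hQ
  set Θ : ℝ := ∑ k, κ k * d k * Complex.normSq (v k) with hΘ
  have hΘ0 : 0 < Θ := by
    obtain ⟨k, hk⟩ := Function.ne_iff.1 hv0
    exact sum_pos' (fun j _ => mul_nonneg (mul_pos (hκ0 j) (hd0 j)).le (Complex.normSq_nonneg _))
      ⟨k, mem_univ k, mul_pos (mul_pos (hκ0 k) (hd0 k)) (Complex.normSq_pos.2 hk)⟩
  have hQΘ : Q = μ * Θ := by
    rw [hQ, hΘ]
    push_cast
    rw [mul_sum]
    refine sum_congr rfl fun k _ => ?_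
    have h1 : μ * (κ k * d k * (Complex.normSq (v k) : ℂ)) =
        κ k * d k * (starRingEnd ℂ) (v k) * (μ * v k) := by
      rw [Complex.normSq_eq_conj_mul_self]; ring
    rw [h1, ← hJ, mul_sum]
    refine sum_congr rfl fun l _ => ?_
    have h2 := congrArg (fun t : ℝ => (t : ℂ)) (gramDiag_mul_jac hM hx k l)
    push_cast at h2
    linear_combination -(starRingEnd ℂ) (v k) * v l * h2
  have hQconj : (starRingEnd ℂ) Q = Q := by
    rw [hQ, map_sum, sum_comm]
    simp only [map_sum, map_mul, Complex.conj_ofReal, Complex.conj_conj]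
    rw [sum_comm]
    conv_rhs => rw [sum_comm]
    refine sum_congr rfl fun k _ => sum_congr rfl fun l _ => ?_
    rw [add_comm (x l), mul_comm (κ l)]
    ring
  have hμconj : (starRingEnd ℂ) μ = μ := by
    rw [hQΘ, map_mul, Complex.conj_ofReal] at hQconj
    exact mul_right_cancel₀ (Complex.ofReal_ne_zero.2 hΘ0.ne') hQconj
  obtain ⟨ρ, hρ⟩ := Complex.conj_eq_iff_real.1 hμconj
  have hre : jac a m x *ᵥ (fun k => (v k).re) = ρ • fun k => (v k).re := by
    funext k
    have := congrArg Complex.re (hJ k)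
    rw [hρ] at this
    simpa [mulVec, dotProduct] using this
  have him : jac a m x *ᵥ (fun k => (v k).im) = ρ • fun k => (v k).im := by
    funext k
    have := congrArg Complex.im (hJ k)
    rw [hρ] at this
    simpa [mulVec, dotProduct] using this
  by_cases h0 : (fun k => (v k).re) = 0
  · refine ⟨ρ, _, hρ, fun h1 => hv0 (funext fun k => ?_), him⟩
    exact Complex.ext (congrFun h0 k) (congrFun h1 k)
  · exact ⟨ρ, _, hρ, h0, hre⟩

/-- The iteration map over the complex numbers. -/
lemma SpectralForm.exists_complex_iteration (h : SpectralForm G a b U)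
    (hM : IsModel a (fun i => b i ^ 2) r) (hx : IsPoints x)
    (hres : residual a (fun i => b i ^ 2) x x = 0) :
    ∃ F : (Fin r → ℂ) → (Fin r → ℂ), F (fun k => (x k : ℂ)) = (fun k => (x k : ℂ)) ∧
      (∀ᶠ t in 𝓝 (fun k => (x k : ℂ)), G.IRKAStep t (F t)) ∧
      HasFDerivAt F (Matrix.toLin' (jac (cpole a) (cmass b)
        fun k => (x k : ℂ))).toContinuousLinearMap (fun k => (x k : ℂ)) := by
  set s : Fin r → ℂ := fun k => (x k : ℂ) with hs
  have hnode : IsNode s := isNode_ofReal hx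
  have hax : ∀ i j, cpole a i + s j ≠ 0 := fun i j => by
    have := hM.add_ne hx.pos i j
    simp only [cpole, hs]
    exact_mod_cast this
  have hrc : residual (cpole a) (cmass b) s s = 0 := by
    funext k
    rw [hs, ← ofReal_residual, hres]
    simp
  have hd : ∀ k, gramDiag (cpole a) (cmass b) s s k ≠ 0 := fun k => by
    rw [hs, ← ofReal_gramDiag]
    exact_mod_cast (hM.gramDiag_pos hx.pos x k).ne'
  obtain ⟨F, hFs, hF', hF, -⟩ := exists_iteration hax hnode hd hrc
  have hFt : Tendsto F (𝓝 s) (𝓝 s) := by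
    have := hF'.continuousAt.tendsto
    rwa [hFs] at this
  have hinj : ∀ᶠ t in 𝓝 s, Function.Injective t := by
    have : ∀ᶠ t in 𝓝 s, ∀ i j, i ≠ j → t i - t j ≠ 0 := by
      refine eventually_all.2 fun i => eventually_all.2 fun j => ?_
      by_cases hij : i = j
      · exact Eventually.of_forall fun _ h => absurd hij h
      have hc : ContinuousAt (fun t : Fin r → ℂ => t i - t j) s := by fun_prop
      exact (hc.eventually_ne (sub_ne_zero.2 (hnode.inj.ne hij))).mono fun _ h _ => h
    filter_upwards [this] with t ht i j hij
    by_contra hne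
    exact ht i j hne (sub_eq_zero.2 hij)
  have hta : ∀ᶠ t in 𝓝 s, ∀ j i, t j + cpole a i ≠ 0 := by
    refine eventually_all.2 fun j => eventually_all.2 fun i => ?_
    have hc : ContinuousAt (fun t : Fin r → ℂ => t j + cpole a i) s :=
      (continuous_apply j).continuousAt.add continuousAt_const
    exact hc.eventually_ne (by rw [add_comm]; exact hax i j)
  have hgd : ∀ᶠ t in 𝓝 s, ∀ k, gramDiag (cpole a) (cmass b) t (F t) k ≠ 0 := by
    refine eventually_all.2 fun k => ?_
    have ht : Tendsto (fun t => gramDiag (cpole a) (cmass b) t (F t) k) (𝓝 s)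
        (𝓝 (gramDiag (cpole a) (cmass b) s s k)) :=
      tendsto_finsetSum _ fun i _ =>
        ((tendsto_ratio tendsto_id hFt tendsto_const_nhds (hax i) _).pow 2).const_mul _
    exact ht.eventually_ne (hd k)
  refine ⟨F, hFs, ?_, hF'.hasFDerivAt⟩
  -- Distinctness, avoidance of the poles and nonzero Gram entries are open conditions, so a zero of
  -- the complex residual is an IRKA step at every nearby t, real or not.
  filter_upwards [hinj, hta, hgd, hF, hFt.eventually hinj] with t h1 h2 h3 h4 h5
  obtain ⟨h6, h7, -⟩ := h.reduced_of_residual h1 h2 h5 h4 h3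
  exact ⟨h6, h7⟩

end Jacobian

end IRKA

theorem mainTheorem1 {n r : ℕ} (hrn : r < n) (G : LTISystem ℝ n)
    (hsss : G.IsSSS) (hmin : G.IsMinimal) (hstab : G.IsStable)
    (s φ : Fin r → ℂ) (hfix : G.IsIRKAFixedPoint s) (hres : G.HasResidues s φ)
    (hloc : G.IsLocalH2Minimizer (φ, -s)) :
    G.IsLocallyAttractive s ∧
    ∃ (F : (Fin r → ℂ) → (Fin r → ℂ)) (J : Matrix (Fin r) (Fin r) ℂ),
      F s = s ∧
      (∀ᶠ t in nhds s, G.IRKAStep t (F t)) ∧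
      HasFDerivAt F (Matrix.toLin' J).toContinuousLinearMap s ∧
      IsUnit (matS11 (-s)) ∧ IsUnit (matSc (-s)) ∧ (∀ j, φ j ≠ 0) ∧
      J = (Matrix.diagonal φ)⁻¹ * ((matSc (-s))⁻¹ * G.matK s φ) * Matrix.diagonal φ ∧
      (∀ μ : ℂ, Module.End.HasEigenvalue (Matrix.toLin' J) μ →
        ∃ x : ℝ, μ = (x : ℂ) ∧ 0 < x ∧ x ≤ 1) ∧
      (G.IsNondegenerateH2Minimizer (φ, -s) →
        ∀ μ : ℂ, Module.End.HasEigenvalue (Matrix.toLin' J) μ →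
          ∃ x : ℝ, μ = (x : ℂ) ∧ 0 < x ∧ x < 1) := by
  obtain ⟨a, b, U, hS⟩ := IRKA.exists_spectralForm G hsss
  obtain ⟨ha_inj, hb⟩ := hS.of_isMinimal hmin
  have hM : IRKA.IsModel a (fun i => b i ^ 2) r :=
    ⟨hS.pos_of_isStable hstab, fun i => sq_pos_of_ne_zero (hb i), ha_inj, hrn⟩
  obtain ⟨x, rfl, hx0, hxinj, hr0⟩ := hS.exists_real_fixedPoint hM.a_pos hfix
  have hx : IRKA.IsPoints x := ⟨hx0, hxinj⟩
  have hφ := hS.residues_eq hM hx hr0 hres hfix.2.2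
  have hp : (φ, -fun k => (x k : ℂ)) =
      IRKA.realParam (IRKA.optResidue a (fun i => b i ^ 2) x) x := by rw [hφ]; rfl
  obtain ⟨hφ0, hJ⟩ := hS.jac_eq hM hx hr0 hφ
  -- The growth statement with κ = 0 transfers plain local minimality to the reduced error.
  have hlmin : IsLocalMin (IRKA.redCost a fun i => b i ^ 2) x := by
    have h1 := hloc.2
    rw [hp] at h1
    have h2 := hS.growth_redCost hM hx (κ := 0) le_rfl (h1.mono fun q hq => by simpa using hq)
    exact h2.mono fun y hy => by simpa using hy
  obtain ⟨F, hFs, hFstep, hFd⟩ := hS.exists_complex_iteration hM hx hr0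
  refine ⟨hS.isLocallyAttractive hM hx hr0 hlmin, F, _, hFs, hFstep, hFd, ?_,
    (IRKA.isNode_ofReal hx).isUnit_matSc, hφ0, hJ, fun μ hμ => ?_, fun hnd μ hμ => ?_⟩
  · rw [IRKA.matS11_neg]
    exact (IRKA.isNode_ofReal hx).isUnit_cauchy
  · obtain ⟨ρ, u, rfl, hu, hρ⟩ := IRKA.exists_real_eigenvector hM hx hμ
    exact ⟨ρ, rfl, IRKA.pos_of_jac_eigenvector hM hx hu hρ,
      IRKA.le_one_of_isLocalMin hM hx hr0 hu hρ hlmin⟩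
  · obtain ⟨ρ, u, rfl, hu, hρ⟩ := IRKA.exists_real_eigenvector hM hx hμ
    refine ⟨ρ, rfl, IRKA.pos_of_jac_eigenvector hM hx hu hρ, ?_⟩
    obtain ⟨-, κ, hκ, hg⟩ := hnd
    rw [hp] at hg
    have h1 := hS.growth_redCost hM hx hκ.le hg
    have ht : Tendsto (fun τ : ℝ => x + τ • u) (𝓝 0) (𝓝 x) := by
      simpa using (IRKA.hasDerivAt_line x u 0).continuousAt.tendsto
    -- With κ > 0 the left side is strictly positive, so 1 - ρ cannot be ≤ 0.
    have h2 := IRKA.eigenvalue_bound hM hx hr0 hρ (κ := κ) (by simpa using ht.eventually h1)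
    have h3 : 0 < κ * ‖u‖ ^ 2 := mul_pos hκ (pow_pos (norm_pos_iff.2 hu) 2)
    have h4 := IRKA.slopeForm_pos hM hx hr0 hu
    by_contra hcon
    have := mul_nonpos_of_nonpos_of_nonneg (show 1 - ρ ≤ 0 by linarith) h4.le
    linarith
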